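/- **Definitions.** A *spin system* $\mathcal A$ on the oriented plane $\mathbb R^2$ consists of a countable set $\Lambda$ of sites, a map $\lambda:\Lambda\to\mathbb R^2$ such that every compact subset of $\mathbb R^2$ contains the locations of only finitely many sites, and dimensions $n:\Lambda\to\mathbb N$ with Hilbert spaces $\mathcal V_j=\mathbb C^{n(j)}$. For finite $\Gamma\subset\Lambda$ let $\mathcal A_\Gamma=\mathrm{End}(\bigotimes_{j\in\Gamma}\mathcal V_j)$; for $\Lambda'\subset\Lambda$ let $\mathcal A_{\Lambda'}$ be the norm completion of $\varinjlim_{\Gamma\subset\Lambda'}\mathcal A_\Gamma$, let $\mathcal A=\mathcal A_\Lambda$, and for $Y\subset\mathbb R^2$ let $\mathcal A_Y=\mathcal A_{\lambda^{-1}(Y)}$. An isomorphism of spin systems is a bijection of the sets of sites that preserves locations and dimensions. The stack $\mathcal A_1\otimes\mathcal A_2$ has as sites the disjoint union of the two sets of sites. States are positive normalized linear functionals on $\mathcal A$. A *trivial* state is a pure product state (a tensor product of states of the single sites), and a *trivial extension* of $\psi$ is a state $\psi\otimes\psi_0$ with $\psi_0$ trivial. A $*$-automorphism $\alpha$ of $\mathcal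 A$ is an *automorphism on* $U\subset\mathbb R^2$ if it fixes every element of $\mathcal A_{\mathbb R^2\setminus U}$. The open *cone* with apex $p\in\mathbb R^2$ and base an open interval $I\subset S^1$ is the set of all $x\ne p$ with $(x-p)/|x-p|\in I$. A *good conical cover* is a finite family $C=\{U_a\}_{a\in J}$ of cones with a common apex whose bases $I_a$ form a good open cover of $S^1$ (all non-empty finite intersections are contractible), such that $I_a\cap I_b$ is strictly smaller than both $I_a$ and $I_b$ for all $a\neq b$, and such that $J$ is the union of two disjoint subsets within each of which the cones are pairwise disjoint. A $*$-automorphism $\alpha$ of $\mathcal A$ is *$C$-local* if $$\alpha=\Big(\prod_{a\in J_0}\alpha_a\Big)\Big(\prod_{a\in J_1}\alpha_a\Big)\mathrm{Ad}_u$$ where $J=J_0\sqcup J_1$, the cones $U_a$, $a\in J_i$, are pairwise disjoint for $i=0$ and for $i=1$, $\alpha_a$ is an automorphism on $U_a$, and $u\in\mathcal A$ is unitary, $\mathrm{Ad}_u(x)=uxu^*$. Two pure states $\psi_1,\psi_2$ (on possibly different spin systems) are *in the same phase* if for every good conical cover $C$ there are a spin system $\mathcal A$, states $\tilde\psi_1,\tilde\psi_2$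 on $\mathcal A$ that are (up to isomorphism of spin systems) trivial extensions of $\psi_1,\psi_2$ respectively, and a $C$-local automorphism $\alpha$ of $\mathcal A$ with $\tilde\psi_1=\tilde\psi_2\circ\alpha$. A pure state $\psi$ is *invertible* if there is a pure state $\psi'$ on some spin system such that $\psi\otimes\psi'$ is in the same phase as a trivial state. For a homeomorphism $f$ of $\mathbb R^2$, the spin system $f_*\mathcal A$ is obtained from $\mathcal A$ by replacing $\lambda$ with $f\circ\lambda$, and $f_*\psi$ is the state $\psi$ regarded as a state on $f_*\mathcal A$ (which has the same $C^*$-algebra). Let $D^2$ be the closed unit disk and let $h:\mathbb R^2\to D^2\setminus\partial D^2$, $h(x)=\tanh(|x|)\,x/|x|$, $h(0)=0$. The homeomorphism $f$ is *good* if $f=h^{-1}\circ g\circ h$ for the restriction $g$ to $D^2\setminus\partial D^2$ of a homeomorphism of $D^2$. It is *orientation-preserving* if it has local degree $1$: for every $x\in\mathbb R^2$ the image under $f$ of every counterclockwise circle centred at $x$ has winding number $1$ around $f(x)$. **Proposition.** Let $f$ be a good orientation-preserving homeomorphism of $\mathbb R^2$. Then for every invertible state $\psi$ on $\mathbb R^2$,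 the states $\psi$ and $f_*\psi$ are in the same phase. -/

import Mathlib

noncomputable section

namespace SpinPhases

/-! ### The quasi-local algebra of a family of finite-dimensional sites -/

section Algebra

variable {Λ : Type} (d : Λ → ℕ)

/-- Configurations of all sites: `Fin (d j)` labels the standard basis of `V_j = ℂ ^ (d j)`. -/
abbrev Config : Type := ∀ j : Λ, Fin (d j)

/-- Configurations of the sites in `Γ`; they label the product basis of `⨂_{j ∈ Γ} V_j`. -/
abbrev LocalConfig (Γ : Finset Λ) : Type := ∀ j : {j // j ∈ Γ}, Fin (d j)

/-- The Hilbert space `ℓ²(Config d)`, on which all the local algebras are represented faithfully. -/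
abbrev ConfigSpace : Type := lp (fun _ : Config d => ℂ) 2

variable {d}

/-- Restriction of a configuration to `Γ`. -/
def restrict (Γ : Finset Λ) (σ : Config d) : LocalConfig d Γ := fun j => σ j

open scoped Classical in
/-- Overwrite the configuration `σ` on `Γ` by `τ`. -/
def overwrite (Γ : Finset Λ) (τ : LocalConfig d Γ) (σ : Config d) : Config d :=
  fun j => if h : j ∈ Γ then τ ⟨j, h⟩ else σ j

theorem restrict_overwrite (Γ : Finset Λ) (τ : LocalConfig d Γ) (σ : Config d) :
    restrict Γ (overwrite Γ τ σ) = τ := by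
  funext j
  simp [restrict, overwrite]

theorem overwrite_overwrite (Γ : Finset Λ) (τ ρ : LocalConfig d Γ) (σ : Config d) :
    overwrite Γ τ (overwrite Γ ρ σ) = overwrite Γ τ σ := by
  funext j
  by_cases h : j ∈ Γ <;> simp [overwrite, h]

theorem overwrite_restrict (Γ : Finset Λ) (σ : Config d) :
    overwrite Γ (restrict Γ σ) σ = σ := by
  funext j
  by_cases h : j ∈ Γ <;> simp [overwrite, restrict, h]

theorem overwrite_injOn (Γ : Finset Λ) (ρ τ : LocalConfig d Γ) :
    Set.InjOn (overwrite Γ τ) {σ : Config d | restrict Γ σ = ρ} := by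
  intro σ hσ σ' hσ' h
  have h1 : overwrite Γ ρ (overwrite Γ τ σ) = overwrite Γ ρ (overwrite Γ τ σ') := by rw [h]
  rw [overwrite_overwrite, overwrite_overwrite] at h1
  have e1 : overwrite Γ ρ σ = σ := by
    rw [← (show restrict Γ σ = ρ from hσ), overwrite_restrict]
  have e2 : overwrite Γ ρ σ' = σ' := by
    rw [← (show restrict Γ σ' = ρ from hσ'), overwrite_restrict]
  rw [← e1, h1, e2]

open scoped Classical in
theorem sum_pullback_le (s : Set (Config d)) (g : Config d → Config d) (hg : Set.InjOn g s)
    (ξ : ConfigSpace d) (F : Finset (Config d)) :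
    ∑ σ ∈ F, ‖(if σ ∈ s then ξ (g σ) else 0 : ℂ)‖ ^ (2 : ENNReal).toReal
      ≤ ‖ξ‖ ^ (2 : ENNReal).toReal := by
  have h2 : (0 : ℝ) < (2 : ENNReal).toReal := by norm_num
  calc ∑ σ ∈ F, ‖(if σ ∈ s then ξ (g σ) else 0 : ℂ)‖ ^ (2 : ENNReal).toReal
      = ∑ σ ∈ F with σ ∈ s, ‖ξ (g σ)‖ ^ (2 : ENNReal).toReal := by
        rw [Finset.sum_filter]
        refine Finset.sum_congr rfl fun σ _ => ?_
        split_ifs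
        · rfl
        · simp
    _ = ∑ σ ∈ (F.filter (· ∈ s)).image g, ‖ξ σ‖ ^ (2 : ENNReal).toReal := by
        rw [Finset.sum_image]
        intro a ha b hb h
        exact hg (by simpa using (Finset.mem_filter.1 ha).2)
          (by simpa using (Finset.mem_filter.1 hb).2) h
    _ ≤ _ := lp.sum_rpow_le_norm_rpow h2 ξ _

open scoped Classical in
/-- The bounded operator `(E ξ)(σ) = ξ (g σ)` for `σ ∈ s`, and `(E ξ)(σ) = 0` otherwise. -/
def pullback (s : Set (Config d)) (g : Config d → Config d) (hg : Set.InjOn g s) :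
    ConfigSpace d →L[ℂ] ConfigSpace d :=
  LinearMap.mkContinuous
    { toFun := fun ξ => ⟨fun σ => if σ ∈ s then ξ (g σ) else 0,
        memℓp_gen' (sum_pullback_le s g hg ξ)⟩
      map_add' := by
        intro ξ η
        ext σ
        change (if σ ∈ s then (ξ + η) (g σ) else 0 : ℂ) =
          (if σ ∈ s then ξ (g σ) else 0) + (if σ ∈ s then η (g σ) else 0)
        by_cases h : σ ∈ s <;> simp [h]
      map_smul' := by
        intro c ξ
        ext σ
        by_cases h : σ ∈ s <;> simp [h] }
    1 (by
      intro ξ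
      rw [one_mul]
      exact lp.norm_le_of_forall_sum_le (by norm_num) (norm_nonneg _) (sum_pullback_le s g hg ξ))

open scoped Classical in
theorem pullback_apply (s : Set (Config d)) (g : Config d → Config d) (hg : Set.InjOn g s)
    (ξ : ConfigSpace d) (σ : Config d) :
    pullback s g hg ξ σ = if σ ∈ s then ξ (g σ) else 0 := rfl

/-- The matrix unit `|ρ⟩⟨τ|` of `End (⨂_{j ∈ Γ} V_j)`, acting on `ℓ²(Config d)`. -/
def matrixUnit (Γ : Finset Λ) (ρ τ : LocalConfig d Γ) : ConfigSpace d →L[ℂ] ConfigSpace d :=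
  pullback {σ | restrict Γ σ = ρ} (overwrite Γ τ) (overwrite_injOn Γ ρ τ)

open scoped Classical in
/-- The action on `ℓ²(Config d)` of an element of `End (⨂_{j ∈ Γ} V_j)`, given by its matrix in the
product basis. -/
def localOp (Γ : Finset Λ) (M : Matrix (LocalConfig d Γ) (LocalConfig d Γ) ℂ) :
    ConfigSpace d →L[ℂ] ConfigSpace d :=
  ∑ ρ, ∑ τ, M ρ τ • matrixUnit Γ ρ τ

open scoped Classical in
theorem localOp_apply (Γ : Finset Λ) (M : Matrix (LocalConfig d Γ) (LocalConfig d Γ) ℂ)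
    (ξ : ConfigSpace d) (σ : Config d) :
    localOp Γ M ξ σ = ∑ τ, M (restrict Γ σ) τ * ξ (overwrite Γ τ σ) := by
  have h : ∀ (ι : Type) (s : Finset ι) (T : ι → ConfigSpace d →L[ℂ] ConfigSpace d),
      (∑ i ∈ s, T i) ξ σ = ∑ i ∈ s, T i ξ σ := by
    intro ι s T
    rw [sum_apply, lp.coeFn_sum, Finset.sum_apply]
  rw [localOp, h, Finset.sum_eq_single (restrict Γ σ)]
  · rw [h]
    refine Finset.sum_congr rfl fun τ _ => ?_
    simp [matrixUnit, pullback_apply]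
  · intro ρ _ hρ
    rw [h]
    refine Finset.sum_eq_zero fun τ _ => ?_
    simp [matrixUnit, pullback_apply, Ne.symm hρ]
  · simp

theorem tsum_overwrite (Γ : Finset Λ) (ρ τ : LocalConfig d Γ) (ξ η : Config d → ℂ) :
    ∑' σ, (open scoped Classical in if restrict Γ σ = ρ then η σ * ξ (overwrite Γ τ σ) else 0)
      = ∑' σ, (open scoped Classical in if restrict Γ σ = τ then η (overwrite Γ ρ σ) * ξ σ else 0) := by
  classical
  let e : {σ : Config d | restrict Γ σ = ρ} ≃ {σ : Config d | restrict Γ σ = τ} :=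
    { toFun := fun σ => ⟨overwrite Γ τ σ, restrict_overwrite Γ τ σ⟩
      invFun := fun σ => ⟨overwrite Γ ρ σ, restrict_overwrite Γ ρ σ⟩
      left_inv := by
        rintro ⟨σ, hσ⟩
        apply Subtype.ext
        simp only [Set.mem_ofPred_eq] at hσ
        subst hσ
        simp [overwrite_overwrite, overwrite_restrict]
      right_inv := by
        rintro ⟨σ, hσ⟩
        apply Subtype.ext
        simp only [Set.mem_ofPred_eq] at hσ
        subst hσ
        simp [overwrite_overwrite, overwrite_restrict] }
  have h1 := tsum_subtype {σ : Config d | restrict Γ σ = ρ}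
    (fun σ => η σ * ξ (overwrite Γ τ σ))
  have h2 := tsum_subtype {σ : Config d | restrict Γ σ = τ}
    (fun σ => η (overwrite Γ ρ σ) * ξ σ)
  simp only [Set.indicator_apply, Set.mem_ofPred_eq] at h1 h2
  rw [← h1, ← h2, ← e.tsum_eq]
  refine tsum_congr fun σ => ?_
  obtain ⟨σ, hσ⟩ := σ
  simp only [Set.mem_ofPred_eq] at hσ
  subst hσ
  simp [e, overwrite_overwrite, overwrite_restrict]

theorem star_matrixUnit (Γ : Finset Λ) (ρ τ : LocalConfig d Γ) :
    star (matrixUnit Γ ρ τ) = matrixUnit Γ τ ρ := by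
  classical
  rw [ContinuousLinearMap.star_eq_adjoint, eq_comm, ContinuousLinearMap.eq_adjoint_iff]
  intro ξ η
  rw [lp.inner_eq_tsum, lp.inner_eq_tsum]
  have key := tsum_overwrite Γ τ ρ (fun σ => (starRingEnd ℂ) (ξ σ)) η
  have hl : ∀ σ, inner ℂ (matrixUnit Γ τ ρ ξ σ) (η σ)
      = if restrict Γ σ = τ then η σ * (starRingEnd ℂ) (ξ (overwrite Γ ρ σ)) else 0 := by
    intro σ
    simp only [matrixUnit, pullback_apply, Set.mem_ofPred_eq]
    split_ifs <;> simp
  have hr : ∀ σ, inner ℂ (ξ σ) (matrixUnit Γ ρ τ η σ)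
      = if restrict Γ σ = ρ then η (overwrite Γ τ σ) * (starRingEnd ℂ) (ξ σ) else 0 := by
    intro σ
    simp only [matrixUnit, pullback_apply, Set.mem_ofPred_eq]
    split_ifs <;> simp
  simp_rw [hl, hr]
  convert key

open scoped Classical in
/-- The representation on `ℓ²(Config d)` of the matrix algebra `A_Γ = End (⨂_{j ∈ Γ} V_j)`. -/
def localHom (Γ : Finset Λ) :
    Matrix (LocalConfig d Γ) (LocalConfig d Γ) ℂ →⋆ₐ[ℂ] (ConfigSpace d →L[ℂ] ConfigSpace d) where
  toFun := localOp Γ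
  map_one' := by
    ext ξ σ
    rw [localOp_apply]
    simp [Matrix.one_apply, overwrite_restrict]
  map_mul' M N := by
    ext ξ σ
    rw [mul_apply_eq_comp, localOp_apply, localOp_apply]
    simp_rw [localOp_apply, restrict_overwrite, overwrite_overwrite, Matrix.mul_apply,
      Finset.sum_mul, Finset.mul_sum]
    rw [Finset.sum_comm]
    simp_rw [mul_assoc]
  map_zero' := by
    ext ξ σ
    simp [localOp_apply]
  map_add' M N := by
    ext ξ σ
    change _ = localOp Γ M ξ σ + localOp Γ N ξ σ
    simp [localOp_apply, add_mul, Finset.sum_add_distrib]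
  commutes' c := by
    ext ξ σ
    rw [localOp_apply, Algebra.algebraMap_eq_smul_one, Algebra.algebraMap_eq_smul_one]
    simp [Matrix.one_apply, overwrite_restrict]
  map_star' M := by
    simp only [localOp, star_sum, star_smul, star_matrixUnit, Matrix.star_apply]
    rw [Finset.sum_comm]

variable (d) in
/-- The algebra `A_P` of observables on the sites in `P`: the norm closure of the union of the local
algebras `A_Γ`, `Γ ⊆ P` finite. -/
def observablesOn (P : Set Λ) : StarSubalgebra ℂ (ConfigSpace d →L[ℂ] ConfigSpace d) :=
  (StarAlgebra.adjoin ℂ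
    (⋃ (Γ : Finset Λ) (_ : (Γ : Set Λ) ⊆ P), Set.range (localHom (d := d) Γ))).topologicalClosure

theorem localHom_mem (Γ : Finset Λ) (P : Set Λ) (hΓ : (Γ : Set Λ) ⊆ P)
    (M : Matrix (LocalConfig d Γ) (LocalConfig d Γ) ℂ) :
    localHom Γ M ∈ observablesOn d P :=
  StarSubalgebra.le_topologicalClosure _ <| StarAlgebra.subset_adjoin ℂ _ <|
    Set.mem_iUnion₂.2 ⟨Γ, hΓ, M, rfl⟩

variable (d) in
/-- The quasi-local algebra: the completion of the union of all the local algebras. -/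
abbrev Observables : Type := observablesOn d Set.univ

/-- The elementary tensor `⨂_{j ∈ Γ} M j`, an observable on `Γ`. -/
def tensor (Γ : Finset Λ) (M : ∀ j, Matrix (Fin (d j)) (Fin (d j)) ℂ) : Observables d :=
  ⟨localHom Γ (fun σ τ => ∏ j : {j // j ∈ Γ}, M j (σ j) (τ j)),
    localHom_mem Γ Set.univ (Set.subset_univ _) _⟩

end Algebra

/-! ### States -/

section States

open scoped ComplexOrder

variable {A : Type} [Ring A] [StarRing A] [Algebra ℂ A]

/-- A state: a positive normalized linear functional. -/
def IsState (φ : A →ₗ[ℂ] ℂ) : Prop :=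
  (∀ a, 0 ≤ φ (star a * a)) ∧ φ 1 = 1

/-- A pure state: an extreme point of the convex set of states. -/
def IsPure (φ : A →ₗ[ℂ] ℂ) : Prop :=
  φ ∈ Set.extremePoints ℝ {φ : A →ₗ[ℂ] ℂ | IsState φ}

end States

/-! ### Spin systems on the plane

The plane `ℝ²` with its Euclidean norm and its standard orientation is `ℂ`. -/

/-- A spin system on the plane. Every bounded region contains the locations of only finitely many
sites; in particular the set of sites is countable. -/
structure SpinSystem where
  /-- the lattice -/
  Site : Type
  /-- the location of a site -/
  loc : Site → ℂ
  /-- the dimension of the Hilbert space of a site -/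
  dim : Site → ℕ
  locallyFinite : ∀ K : Set ℂ, IsCompact K → (loc ⁻¹' K).Finite

namespace SpinSystem

/-- The `C*`-algebra of a spin system. -/
abbrev Obs (S : SpinSystem) : Type := Observables S.dim

/-- Linear functionals on the algebra of a spin system. -/
abbrev Functional (S : SpinSystem) : Type := S.Obs →ₗ[ℂ] ℂ

/-- Linear `*`-automorphisms of the algebra of a spin system. -/
abbrev Aut (S : SpinSystem) : Type := S.Obs ≃⋆ₐ[ℂ] S.Obs

/-- The stack of two spin systems. -/
def stack (S T : SpinSystem) : SpinSystem where
  Site := S.Site ⊕ T.Site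
  loc := Sum.elim S.loc T.loc
  dim := Sum.elim S.dim T.dim
  locallyFinite K hK := by
    have h : Sum.elim S.loc T.loc ⁻¹' K = Sum.inl '' (S.loc ⁻¹' K) ∪ Sum.inr '' (T.loc ⁻¹' K) := by
      ext x
      cases x <;> simp
    rw [h]
    exact ((S.locallyFinite K hK).image _).union ((T.locallyFinite K hK).image _)

/-- The pushforward `f_* S`: the site `j` is moved from `loc j` to `f (loc j)`. -/
def push (f : ℂ ≃ₜ ℂ) (S : SpinSystem) : SpinSystem where
  Site := S.Site
  loc := f ∘ S.loc
  dim := S.dim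
  locallyFinite K hK := by
    rw [Set.preimage_comp]
    exact S.locallyFinite _ (f.isCompact_preimage.2 hK)

/-- The pushforward `f_* ψ`: the algebras of `S` and `f_* S` are the same, and so is the state. -/
def pushState (f : ℂ ≃ₜ ℂ) {S : SpinSystem} (ψ : S.Functional) : (S.push f).Functional := ψ

/-- An isomorphism of spin systems. -/
structure Iso (S T : SpinSystem) where
  /-- the bijection of lattices -/
  siteEquiv : S.Site ≃ T.Site
  loc_eq : ∀ j, S.loc j = T.loc (siteEquiv j)
  dim_eq : ∀ j, S.dim j = T.dim (siteEquiv j)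

/-- The state `ω'` on `T` corresponds to the state `ω` on `S` under the isomorphism `e`: they agree
on corresponding elementary tensors, whose linear span is dense. -/
def Iso.Transports {S T : SpinSystem} (e : S.Iso T) (ω : S.Functional) (ω' : T.Functional) : Prop :=
  IsState ω ∧ IsState ω' ∧
    ∀ (Γ : Finset S.Site) (M : ∀ k, Matrix (Fin (T.dim k)) (Fin (T.dim k)) ℂ),
      ω (tensor Γ fun j =>
          (M (e.siteEquiv j)).submatrix (Fin.cast (e.dim_eq j)) (Fin.cast (e.dim_eq j))) =
        ω' (tensor (Γ.map e.siteEquiv.toEmbedding) M)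

/-- `ω = ψ₁ ⊗ ψ₂`: the state on the stack with
`ω (x ⊗ y) = ψ₁ x * ψ₂ y` for all elementary tensors `x`, `y`. -/
def IsTensor {S₁ S₂ : SpinSystem} (ψ₁ : S₁.Functional) (ψ₂ : S₂.Functional)
    (ω : (S₁.stack S₂).Functional) : Prop :=
  IsState ψ₁ ∧ IsState ψ₂ ∧ IsState ω ∧
    ∀ (Γ₁ : Finset S₁.Site) (Γ₂ : Finset S₂.Site)
      (M : ∀ k, Matrix (Fin ((S₁.stack S₂).dim k)) (Fin ((S₁.stack S₂).dim k)) ℂ),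
      ω (tensor (Γ₁.disjSum Γ₂) M) =
        ψ₁ (tensor Γ₁ fun j => M (Sum.inl j)) * ψ₂ (tensor Γ₂ fun j => M (Sum.inr j))

/-- A product state: a tensor product of states on the algebras of the single sites. -/
def IsProduct {S : SpinSystem} (ω : S.Functional) : Prop :=
  IsState ω ∧ ∃ ρ : ∀ j, Matrix (Fin (S.dim j)) (Fin (S.dim j)) ℂ →ₗ[ℂ] ℂ,
    (∀ j, IsState (ρ j)) ∧
    ∀ (Γ : Finset S.Site) (M : ∀ j, Matrix (Fin (S.dim j)) (Fin (S.dim j)) ℂ),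
      ω (tensor Γ M) = ∏ j ∈ Γ, ρ j (M j)

/-- A trivial state: a pure product state. -/
def IsTrivial {S : SpinSystem} (ω : S.Functional) : Prop :=
  IsPure ω ∧ IsProduct ω

/-- `ω` is a trivial extension of `ψ`: up to an isomorphism of spin systems it is `ψ ⊗ τ` with a
trivial state `τ`. -/
def IsTrivialExtension {S R : SpinSystem} (ψ : S.Functional) (ω : R.Functional) : Prop :=
  ∃ (T : SpinSystem) (τ : T.Functional) (ω' : (S.stack T).Functional) (e : (S.stack T).Iso R),
    IsTrivial τ ∧ IsTensor ψ τ ω' ∧ e.Transports ω' ω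

/-- `α` is an automorphism on `U`: it acts trivially on the observables on the complement of `U`. -/
def IsAutOn {S : SpinSystem} (U : Set ℂ) (α : S.Aut) : Prop :=
  ∀ x : S.Obs, x.1 ∈ observablesOn S.dim (S.loc ⁻¹' Uᶜ) → α x = x

end SpinSystem

/-! ### Good conical covers -/

/-- An open interval of the unit circle. -/
def IsOpenInterval (I : Set Circle) : Prop :=
  ∃ l r : ℝ, l < r ∧ r ≤ l + 2 * Real.pi ∧ I = Circle.exp '' Set.Ioo l r

/-- The open cone with apex `p` and base `I`: the points `z ≠ p` whose direction `(z - p) / |z - p|`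
as seen from `p` lies in `I`. -/
def cone (p : ℂ) (I : Set Circle) : Set ℂ :=
  {z | ∃ r : ℝ, 0 < r ∧ ∃ ζ ∈ I, z = p + r * (ζ : ℂ)}

/-- A good conical cover, given by the common apex and the bases of its cones. -/
structure GoodConicalCover where
  /-- the number of cones -/
  card : ℕ
  /-- the common apex -/
  apex : ℂ
  /-- the bases of the cones -/
  base : Fin card → Set Circle
  isOpenInterval : ∀ a, IsOpenInterval (base a)
  covers : ⋃ a, base a = Set.univ
  contractible : ∀ s : Finset (Fin card), s.Nonempty →
    (⋂ a ∈ s, base a).Nonempty → ContractibleSpace ↥(⋂ a ∈ s, base a)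
  inter_ssubset : ∀ a b, a ≠ b → base a ∩ base b ⊂ base a
  /-- the cones can be divided into two families of pairwise disjoint cones -/
  twoFamilies : ∃ J₀ J₁ : Finset (Fin card), Disjoint J₀ J₁ ∧ J₀ ∪ J₁ = Finset.univ ∧
    (J₀ : Set (Fin card)).PairwiseDisjoint (fun a => cone apex (base a)) ∧
    (J₁ : Set (Fin card)).PairwiseDisjoint (fun a => cone apex (base a))

namespace SpinSystem

/-- `C`-local automorphisms: `(∏_{a ∈ J₀} α_a) (∏_{a ∈ J₁} α_a) Ad_u`. The factors of each of the two
products act on disjoint cones, hence commute; they are written in increasing order. -/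
def IsCLocal {S : SpinSystem} (C : GoodConicalCover) (α : S.Aut) : Prop :=
  ∃ J₀ J₁ : Finset (Fin C.card), Disjoint J₀ J₁ ∧ J₀ ∪ J₁ = Finset.univ ∧
    (J₀ : Set (Fin C.card)).PairwiseDisjoint (fun a => cone C.apex (C.base a)) ∧
    (J₁ : Set (Fin C.card)).PairwiseDisjoint (fun a => cone C.apex (C.base a)) ∧
    ∃ (β : Fin C.card → S.Aut) (u : unitary S.Obs),
      (∀ a, IsAutOn (cone C.apex (C.base a)) (β a)) ∧
      α = ((J₀.sort (· ≤ ·)).map β).prod * ((J₁.sort (· ≤ ·)).map β).prod *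
        Unitary.conjStarAlgAut ℂ S.Obs u

/-! ### Phases -/

/-- The pure states `ψ₁` and `ψ₂` are in the same phase. -/
def SamePhase {S₁ S₂ : SpinSystem} (ψ₁ : S₁.Functional) (ψ₂ : S₂.Functional) : Prop :=
  IsPure ψ₁ ∧ IsPure ψ₂ ∧
    ∀ C : GoodConicalCover, ∃ (R : SpinSystem) (ω₁ ω₂ : R.Functional) (α : R.Aut),
      IsTrivialExtension ψ₁ ω₁ ∧ IsTrivialExtension ψ₂ ω₂ ∧ IsCLocal C α ∧
        ∀ x, ω₁ x = ω₂ (α x)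

/-- The state `ω` is in the trivial phase, the phase of the trivial states. -/
def InTrivialPhase {S : SpinSystem} (ω : S.Functional) : Prop :=
  ∃ (T : SpinSystem) (τ : T.Functional), IsTrivial τ ∧ SamePhase ω τ

/-- The pure state `ψ` is invertible: `ψ ⊗ ψ'` is in the trivial phase for some pure state `ψ'`. -/
def IsInvertible {S : SpinSystem} (ψ : S.Functional) : Prop :=
  IsPure ψ ∧ ∃ (S' : SpinSystem) (ψ' : S'.Functional) (ω : (S.stack S').Functional),
    IsPure ψ' ∧ IsTensor ψ ψ' ω ∧ InTrivialPhase ω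

end SpinSystem

/-! ### Homeomorphisms of the plane -/

/-- The radial contraction `h z = tanh |z| * (z / |z|)` of the plane into the closed unit disk
(with `h 0 = 0`); it is a homeomorphism onto the open disk. -/
def radialContraction (z : ℂ) : Metric.closedBall (0 : ℂ) 1 :=
  ⟨(Real.tanh ‖z‖ : ℂ) * (z / (‖z‖ : ℂ)), by
    rw [mem_closedBall_zero_iff, norm_mul, norm_div, Complex.norm_real, Complex.norm_real,
      norm_norm, Real.norm_eq_abs]
    exact mul_le_one₀ (Real.abs_tanh_lt_one _).le (by positivity) (div_self_le_one _)⟩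

/-- A good homeomorphism: `f = h⁻¹ ∘ g ∘ h` with the radial contraction `h` and a homeomorphism `g`
of the closed unit disk. -/
def IsGood (f : ℂ ≃ₜ ℂ) : Prop :=
  ∃ g : Metric.closedBall (0 : ℂ) 1 ≃ₜ Metric.closedBall (0 : ℂ) 1,
    ∀ z, radialContraction (f z) = g (radialContraction z)

/-- `f` preserves the orientation: it has local degree `1` everywhere, i.e. the image of a
counterclockwise circle around `z` has winding number `1` around `f z`, where the winding number is
computed from a continuous choice `θ` of the argument. -/
def IsOrientationPreserving (f : ℂ ≃ₜ ℂ) : Prop :=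
  ∀ (z : ℂ) (r : ℝ), 0 < r → ∃ θ : ℝ → ℝ, Continuous θ ∧
    (∀ t : ℝ, f (z + r * Complex.exp (t * Complex.I)) - f z =
      ‖f (z + r * Complex.exp (t * Complex.I)) - f z‖ * Complex.exp (θ t * Complex.I)) ∧
    θ (2 * Real.pi) = θ 0 + 2 * Real.pi

end SpinPhases

end

/-!
The homeomorphism `f` has a limiting direction at infinity, which is a map of degree one of the
circle to itself and hence can be deformed to the identity in small steps. It is therefore enough to
compare an invertible state `ψ` in two positions `g₀` and `gₙ` that are connected by a chain of
positions `g₀, …, gₙ`, neighbouring ones of which are close to each other at infinity. What has to be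
controlled is the depth of the automorphism that does it: composing `n` steps would give an
automorphism that is not `C`-local, however narrow the cones of the steps are.

*Circuits.* An automorphism is called a circuit (`IsCircuit`) if it is, up to an inner automorphism, a
product of automorphisms supported in narrow cones with a common apex that are arranged in a few
layers. By sorting the gates according to the cone of `C` that contains their past light cone, a
circuit of depth four is seen to be `C`-local, if its cones are small compared to the Lebesgue number
of the bases of `C` (`IsCircuit.isCLocal`). This uses that automorphisms with disjoint supports
commute (`commute_of_disjoint_supports`), which rests on Haag duality for the algebra of observables
(`mem_observablesOn_of_commute`).

*Independence of the number of steps.* Let `ψ'` be an inverse of `ψ`. If the positions `g` and `h` are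
close at infinity, the stack of `ψ` in position `g` and `ψ'` in position `h` is trivialized by a
circuit of depth two: apply the definition of the trivial phase to a cover so fine that `g` and `h`
move all sites in each of its cones into one and the same narrow cone; moving the sites turns the
automorphism that is local for that cover into a circuit (`IsCLocal.isCircuit`,
`exists_moved_inverse`). Now stack `ψ` in position `g₀` with the trivializable pairs of `ψ` in position
`gₖ₊₁` and `ψ'` in position `gₖ`, for all `k < n` at once. The same stack consists of `ψ` in position
`gₙ` and of the trivializable pairs of `ψ` and `ψ'` both in position `gₖ`. All the pairs can be
trivialized simultaneously, so two circuits of depth two lead from `g₀` to `gₙ`, whatever `n` is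
(`StablyRelated.chain`).

*Bookkeeping.* Isomorphism classes of spin systems with a state form a commutative monoid under
stacking (`StateClass`), in which the rearrangements above are identities. Tensor products of states
exist by the Schur product theorem (`exists_isTensorState`), and stacks of trivial states are trivial
(`IsTensorState.isPure`). The finitely many sites in a compact region, on which closeness at infinity
says nothing, can be moved freely, since exchanging a site with an ancilla is an inner automorphism
(`stablyRelated_relocate`).
-/

noncomputable section

namespace SpinPhases

open scoped Classical

/-! ### Coercions of homomorphisms to functions -/

/- Shortcuts for the general instances, whose search compares the algebraic structures of
`Observables d` that come from different sources. -/
section Coercions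

variable {Λ Λ' : Type} {d : Λ → ℕ} {d' : Λ' → ℕ}

instance : CoeFun (Observables d →⋆ₐ[ℂ] Observables d') fun _ => Observables d → Observables d' :=
  ⟨fun F => F⟩

instance {n : Type} [Fintype n] [DecidableEq n] :
    CoeFun (Matrix n n ℂ →⋆ₐ[ℂ] Observables d) fun _ => Matrix n n ℂ → Observables d :=
  ⟨fun F => F⟩

instance : CoeFun (Observables d ≃⋆ₐ[ℂ] Observables d') fun _ => Observables d → Observables d' :=
  ⟨fun F => F⟩

end Coercions

/-! ### Elementary tensors -/

section Sites

variable {Λ : Type} {d : Λ → ℕ}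

/-- Configurations of a single site, as local configurations. -/
def singleEquiv (d : Λ → ℕ) (j : Λ) : LocalConfig d {j} ≃ Fin (d j) where
  toFun τ := τ ⟨j, Finset.mem_singleton_self j⟩
  invFun k := fun i => cast (by rw [Finset.mem_singleton.1 i.2]) k
  left_inv τ := by
    funext i
    obtain ⟨i, hi⟩ := i
    obtain rfl := Finset.mem_singleton.1 hi
    rfl
  right_inv k := rfl

/-- The local algebra `A_Γ` as a subalgebra of the quasi-local algebra. -/
def localObs (Γ : Finset Λ) :
    Matrix (LocalConfig d Γ) (LocalConfig d Γ) ℂ →⋆ₐ[ℂ] Observables d :=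
  (localHom Γ).codRestrict _ fun N => localHom_mem Γ _ (Set.subset_univ _) N

/-- Relabelling the basis of a matrix algebra. -/
def relabel {m n : Type} [Fintype m] [Fintype n] [DecidableEq m] [DecidableEq n] (e : m ≃ n) :
    Matrix m m ℂ →⋆ₐ[ℂ] Matrix n n ℂ :=
  { (Matrix.reindexAlgEquiv ℂ ℂ e : Matrix m m ℂ →ₐ[ℂ] Matrix n n ℂ) with
    map_star' := fun M => by
      ext i j
      simp [Matrix.star_apply] }

theorem relabel_apply {m n : Type} [Fintype m] [Fintype n] [DecidableEq m] [DecidableEq n]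
    (e : m ≃ n) (M : Matrix m m ℂ) (i j : n) : relabel e M i j = M (e.symm i) (e.symm j) := rfl

/-- The embedding of `End V_j` into the quasi-local algebra. -/
def site (j : Λ) : Matrix (Fin (d j)) (Fin (d j)) ℂ →⋆ₐ[ℂ] Observables d :=
  (localObs {j}).comp (relabel (singleEquiv d j).symm)

theorem site_apply (j : Λ) (m : Matrix (Fin (d j)) (Fin (d j)) ℂ) (ξ : ConfigSpace d)
    (σ : Config d) :
    (site j m : Observables d).1 ξ σ = ∑ k, m (σ j) k * ξ (Function.update σ j k) := by
  change localOp {j} _ ξ σ = _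
  rw [localOp_apply, ← (singleEquiv d j).sum_comp]
  refine Finset.sum_congr rfl fun τ _ => ?_
  congr 1
  refine congrArg _ (funext fun i => ?_)
  by_cases h : i = j
  · subst h
    simp [overwrite, singleEquiv]
  · simp [overwrite, h]

theorem tensor_apply (Γ : Finset Λ) (M : ∀ j, Matrix (Fin (d j)) (Fin (d j)) ℂ)
    (ξ : ConfigSpace d) (σ : Config d) :
    (tensor Γ M).1 ξ σ =
      ∑ τ : LocalConfig d Γ, (∏ j : {j // j ∈ Γ}, M j (σ j) (τ j)) * ξ (overwrite Γ τ σ) := by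
  exact localOp_apply Γ _ ξ σ

theorem tensor_empty (M : ∀ j, Matrix (Fin (d j)) (Fin (d j)) ℂ) : tensor ∅ M = 1 := by
  apply Subtype.ext
  ext ξ σ
  rw [tensor_apply]
  have : ∀ τ : LocalConfig d ∅, overwrite ∅ τ σ = σ := by
    intro τ; funext j; simp [overwrite]
  simp [this]

/-- Splitting off a site from a local configuration. -/
def insertEquiv (d : Λ → ℕ) (j : Λ) (Γ : Finset Λ) (hj : j ∉ Γ) :
    LocalConfig d (insert j Γ) ≃ Fin (d j) × LocalConfig d Γ where
  toFun τ := (τ ⟨j, Finset.mem_insert_self j Γ⟩, fun i => τ ⟨i, Finset.mem_insert_of_mem i.2⟩)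
  invFun p := fun i => if h : i.1 = j then cast (by rw [h]) p.1 else
    p.2 ⟨i, (Finset.mem_insert.1 i.2).resolve_left h⟩
  left_inv τ := by
    funext i
    obtain ⟨i, hi⟩ := i
    by_cases h : i = j
    · subst h
      simp
    · simp [h]
  right_inv p := by
    obtain ⟨k, τ⟩ := p
    refine Prod.ext ?_ ?_
    · simp
    · funext i
      have : i.1 ≠ j := fun h => hj (h ▸ i.2)
      simp [this]

theorem tensor_insert (j : Λ) (Γ : Finset Λ) (hj : j ∉ Γ)
    (M : ∀ j, Matrix (Fin (d j)) (Fin (d j)) ℂ) :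
    tensor (insert j Γ) M = site j (M j) * tensor Γ M := by
  apply Subtype.ext
  ext ξ σ
  change _ = (site j (M j) : Observables d).1 ((tensor Γ M).1 ξ) σ
  rw [tensor_apply, site_apply, ← (insertEquiv d j Γ hj).symm.sum_comp, Fintype.sum_prod_type]
  refine Finset.sum_congr rfl fun k _ => ?_
  rw [tensor_apply, Finset.mul_sum]
  refine Finset.sum_congr rfl fun τ _ => ?_
  rw [← mul_assoc]
  congr 1
  · have h : ∀ (f : ∀ i, Fin (d i)), (∏ i : {i // i ∈ insert j Γ},
        M i (σ i) ((insertEquiv d j Γ hj).symm (k, τ) i))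
        = M j (σ j) k * ∏ i : {i // i ∈ Γ}, M i (σ i) (τ i) := by
      intro f
      let F : Λ → ℂ := fun i => if h : i ∈ insert j Γ then
        M i (σ i) ((insertEquiv d j Γ hj).symm (k, τ) ⟨i, h⟩) else 1
      have h1 : ∀ i : {i // i ∈ insert j Γ},
          M i (σ i) ((insertEquiv d j Γ hj).symm (k, τ) i) = F i := by
        intro i; simp only [F, dif_pos i.2]
      have h2 : ∀ i : {i // i ∈ Γ}, M i (σ i) (τ i) = F i := by
        intro i
        have hi : i.1 ≠ j := fun h => hj (h ▸ i.2)
        simp only [F, dif_pos (Finset.mem_insert_of_mem i.2)]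
        simp [insertEquiv, hi]
      have h3 : F j = M j (σ j) k := by
        simp only [F, dif_pos (Finset.mem_insert_self j Γ)]
        simp [insertEquiv]
      simp_rw [h1, h2]
      rw [Finset.prod_coe_sort (insert j Γ) F, Finset.prod_coe_sort Γ F,
        Finset.prod_insert hj, h3]
    rw [h σ]
    congr 1
    refine Finset.prod_congr rfl fun i _ => ?_
    have hi : i.1 ≠ j := fun h => hj (h ▸ i.2)
    rw [Function.update_of_ne hi]
  · refine congrArg _ (funext fun i => ?_)
    by_cases h : i = j
    · subst h
      simp [overwrite, insertEquiv, hj]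
    · by_cases h' : i ∈ Γ <;> simp [overwrite, insertEquiv, h, h']

theorem tensor_singleton (j : Λ) (M : ∀ j, Matrix (Fin (d j)) (Fin (d j)) ℂ) :
    tensor {j} M = site j (M j) := by
  have := tensor_insert j ∅ (by simp) M
  simpa [tensor_empty] using this

theorem site_commute {i j : Λ} (h : i ≠ j) (m : Matrix (Fin (d i)) (Fin (d i)) ℂ)
    (n : Matrix (Fin (d j)) (Fin (d j)) ℂ) :
    Commute (site i m : Observables d) (site j n) := by
  apply Subtype.ext
  ext ξ σ
  change (site i m : Observables d).1 ((site j n : Observables d).1 ξ) σ =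
    (site j n : Observables d).1 ((site i m : Observables d).1 ξ) σ
  simp_rw [site_apply, Function.update_of_ne h, Function.update_of_ne h.symm, Finset.mul_sum]
  rw [Finset.sum_comm]
  refine Finset.sum_congr rfl fun k _ => Finset.sum_congr rfl fun l _ => ?_
  rw [Function.update_comm h, mul_left_comm]

theorem site_commute_tensor {j : Λ} {Γ : Finset Λ} (h : j ∉ Γ)
    (m : Matrix (Fin (d j)) (Fin (d j)) ℂ) (M : ∀ j, Matrix (Fin (d j)) (Fin (d j)) ℂ) :
    Commute (site j m : Observables d) (tensor Γ M) := by
  induction Γ using Finset.induction_on with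
  | empty => rw [tensor_empty]; exact Commute.one_right _
  | insert i Γ hi ih =>
    rw [tensor_insert i Γ hi]
    exact (site_commute (fun e => h (by rw [e]; exact Finset.mem_insert_self i Γ)) _ _).mul_right
      (ih fun hh => h (Finset.mem_insert_of_mem hh))

theorem tensor_congr {Γ : Finset Λ} {M N : ∀ j, Matrix (Fin (d j)) (Fin (d j)) ℂ}
    (h : ∀ j ∈ Γ, M j = N j) : tensor Γ M = tensor Γ N := by
  induction Γ using Finset.induction_on with
  | empty => simp [tensor_empty]
  | insert i Γ hi ih =>
    rw [tensor_insert i Γ hi, tensor_insert i Γ hi, h i (Finset.mem_insert_self i Γ),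
      ih fun j hj => h j (Finset.mem_insert_of_mem hj)]

theorem tensor_mul (Γ : Finset Λ) (M N : ∀ j, Matrix (Fin (d j)) (Fin (d j)) ℂ) :
    tensor Γ M * tensor Γ N = tensor Γ (fun j => M j * N j) := by
  induction Γ using Finset.induction_on with
  | empty => simp [tensor_empty]
  | insert i Γ hi ih =>
    rw [tensor_insert i Γ hi, tensor_insert i Γ hi, tensor_insert i Γ hi, map_mul, ← ih,
      mul_assoc, ← mul_assoc (tensor Γ M), ← (site_commute_tensor hi (N i) M).eq]
    simp only [mul_assoc]

theorem tensor_union (Γ Δ : Finset Λ) (h : Disjoint Γ Δ)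
    (M : ∀ j, Matrix (Fin (d j)) (Fin (d j)) ℂ) :
    tensor (Γ ∪ Δ) M = tensor Γ M * tensor Δ M := by
  induction Γ using Finset.induction_on with
  | empty => simp [tensor_empty]
  | insert i Γ hi ih =>
    rw [Finset.disjoint_insert_left] at h
    rw [Finset.insert_union, tensor_insert i _ (by simp [hi, h.1]), ih h.2,
      tensor_insert i Γ hi, mul_assoc]

theorem tensor_disjUnion (Γ Δ : Finset Λ) (h : Disjoint Γ Δ)
    (M : ∀ j, Matrix (Fin (d j)) (Fin (d j)) ℂ) :
    tensor (Γ.disjUnion Δ h) M = tensor Γ M * tensor Δ M := by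
  rw [← tensor_union Γ Δ h, Finset.disjUnion_eq_union]

theorem tensor_one (Γ : Finset Λ) : tensor (d := d) Γ (fun _ => 1) = 1 := by
  induction Γ using Finset.induction_on with
  | empty => simp [tensor_empty]
  | insert i Γ hi ih => rw [tensor_insert i Γ hi, ih, map_one, one_mul]

/-- Enlarging the support of an elementary tensor by sites that carry the identity. -/
theorem tensor_subset {Γ Δ : Finset Λ} (h : Γ ⊆ Δ)
    (M : ∀ j, Matrix (Fin (d j)) (Fin (d j)) ℂ) (hM : ∀ j ∈ Δ, j ∉ Γ → M j = 1) :
    tensor Δ M = tensor Γ M := by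
  rw [← Finset.union_sdiff_of_subset h, tensor_union _ _ Finset.disjoint_sdiff,
    tensor_congr (Γ := Δ \ Γ) (N := fun _ => 1), tensor_one, mul_one]
  intro j hj
  rw [Finset.mem_sdiff] at hj
  exact hM j hj.1 hj.2

/-- The family `M` on `Γ`, completed by identities. -/
def completeBy (Γ : Finset Λ) (M : ∀ j, Matrix (Fin (d j)) (Fin (d j)) ℂ) :
    ∀ j, Matrix (Fin (d j)) (Fin (d j)) ℂ := fun j => if j ∈ Γ then M j else 1

theorem tensor_completeBy {Γ Δ : Finset Λ} (h : Γ ⊆ Δ)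
    (M : ∀ j, Matrix (Fin (d j)) (Fin (d j)) ℂ) :
    tensor Δ (completeBy Γ M) = tensor Γ M := by
  rw [tensor_subset h _ (fun j _ hj => by simp [completeBy, hj])]
  exact tensor_congr fun j hj => by simp [completeBy, hj]

theorem star_tensor (Γ : Finset Λ) (M : ∀ j, Matrix (Fin (d j)) (Fin (d j)) ℂ) :
    star (tensor Γ M) = tensor Γ (fun j => star (M j)) := by
  induction Γ using Finset.induction_on with
  | empty => simp [tensor_empty]
  | insert i Γ hi ih =>
    rw [tensor_insert i Γ hi, tensor_insert i Γ hi, star_mul, ih, ← map_star,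
      (site_commute_tensor hi _ _).eq]

/-- The matrix of an elementary tensor. -/
def tensorMat (Γ : Finset Λ) (M : ∀ j, Matrix (Fin (d j)) (Fin (d j)) ℂ) :
    Matrix (LocalConfig d Γ) (LocalConfig d Γ) ℂ :=
  fun σ τ => ∏ j : {j // j ∈ Γ}, M j (σ j) (τ j)

/-- A local configuration labels a family of matrix units at the sites. -/
def unitFamily (Γ : Finset Λ) (ρ τ : LocalConfig d Γ) :
    ∀ j, Matrix (Fin (d j)) (Fin (d j)) ℂ :=
  fun j => if h : j ∈ Γ then Matrix.single (ρ ⟨j, h⟩) (τ ⟨j, h⟩) 1 else 1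

theorem tensorMat_unitFamily (Γ : Finset Λ) (ρ τ : LocalConfig d Γ) :
    tensorMat Γ (unitFamily Γ ρ τ) = Matrix.single ρ τ 1 := by
  ext σ σ'
  have h : ∀ j : {j // j ∈ Γ}, unitFamily Γ ρ τ j = Matrix.single (ρ j) (τ j) 1 := by
    intro j
    simp [unitFamily, j.2]
  simp only [tensorMat, h, Matrix.single_apply]
  rw [Fintype.prod_ite_zero]
  simp only [Finset.prod_const_one, funext_iff, forall_and]

theorem localObs_tensorMat (Γ : Finset Λ) (M : ∀ j, Matrix (Fin (d j)) (Fin (d j)) ℂ) :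
    localObs Γ (tensorMat Γ M) = tensor Γ M := rfl

theorem matrix_eq_sum_tensorMat (Γ : Finset Λ)
    (N : Matrix (LocalConfig d Γ) (LocalConfig d Γ) ℂ) :
    N = ∑ ρ, ∑ τ, N ρ τ • tensorMat Γ (unitFamily Γ ρ τ) := by
  simp_rw [tensorMat_unitFamily]
  conv_lhs => rw [Matrix.matrix_eq_sum_single N]
  simp [Matrix.smul_single]

/-- The linear span of the elementary tensors with support in `P`. -/
def tensorSpan (d : Λ → ℕ) (P : Set Λ) : Submodule ℂ (Observables d) :=
  Submodule.span ℂ (Set.range fun p : {Γ : Finset Λ // (Γ : Set Λ) ⊆ P} ×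
    (∀ j, Matrix (Fin (d j)) (Fin (d j)) ℂ) => tensor p.1.1 p.2)

theorem tensor_mem_tensorSpan {P : Set Λ} {Γ : Finset Λ} (h : (Γ : Set Λ) ⊆ P)
    (M : ∀ j, Matrix (Fin (d j)) (Fin (d j)) ℂ) : tensor Γ M ∈ tensorSpan d P :=
  Submodule.subset_span ⟨⟨⟨Γ, h⟩, M⟩, rfl⟩

theorem localObs_mem_tensorSpan {P : Set Λ} {Γ : Finset Λ} (h : (Γ : Set Λ) ⊆ P)
    (N : Matrix (LocalConfig d Γ) (LocalConfig d Γ) ℂ) : localObs Γ N ∈ tensorSpan d P := by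
  rw [matrix_eq_sum_tensorMat Γ N]
  simp only [map_sum, map_smul, localObs_tensorMat]
  exact Submodule.sum_mem _ fun ρ _ => Submodule.sum_mem _ fun τ _ =>
    Submodule.smul_mem _ _ (tensor_mem_tensorSpan h _)

theorem tensorSpan_induction {P : Set Λ} {x : Observables d} (hx : x ∈ tensorSpan d P) :
    ∃ Γ : Finset Λ, (Γ : Set Λ) ⊆ P ∧ ∀ Δ, Γ ⊆ Δ → ∃ N, x = localObs Δ N := by
  induction hx using Submodule.span_induction with
  | mem x hx =>
    obtain ⟨p, rfl⟩ := hx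
    exact ⟨p.1, p.1.2, fun Δ h => ⟨tensorMat Δ (completeBy p.1 p.2), by
      rw [localObs_tensorMat, tensor_completeBy h]⟩⟩
  | zero => exact ⟨∅, by simp, fun Δ _ => ⟨0, by simp⟩⟩
  | add x y _ _ hx hy =>
    obtain ⟨Γ, hP, hΓ⟩ := hx
    obtain ⟨Γ', hP', hΓ'⟩ := hy
    refine ⟨Γ ∪ Γ', by simp [hP, hP'], fun Δ h => ?_⟩
    obtain ⟨N, rfl⟩ := hΓ Δ (Finset.union_subset_left h)
    obtain ⟨N', rfl⟩ := hΓ' Δ (Finset.union_subset_right h)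
    exact ⟨N + N', by simp⟩
  | smul c x _ hx =>
    obtain ⟨Γ, hP, hΓ⟩ := hx
    refine ⟨Γ, hP, fun Δ h => ?_⟩
    obtain ⟨N, rfl⟩ := hΓ Δ h
    exact ⟨c • N, by simp⟩

theorem mul_mem_tensorSpan {P : Set Λ} {x y : Observables d} (hx : x ∈ tensorSpan d P)
    (hy : y ∈ tensorSpan d P) : x * y ∈ tensorSpan d P := by
  obtain ⟨Γ, hP, hΓ⟩ := tensorSpan_induction hx
  obtain ⟨Γ', hP', hΓ'⟩ := tensorSpan_induction hy
  obtain ⟨N, rfl⟩ := hΓ (Γ ∪ Γ') Finset.subset_union_left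
  obtain ⟨N', rfl⟩ := hΓ' (Γ ∪ Γ') Finset.subset_union_right
  rw [← map_mul]
  exact localObs_mem_tensorSpan (by simp [hP, hP']) _

theorem star_mem_tensorSpan {P : Set Λ} {x : Observables d} (hx : x ∈ tensorSpan d P) :
    star x ∈ tensorSpan d P := by
  obtain ⟨Γ, hP, hΓ⟩ := tensorSpan_induction hx
  obtain ⟨N, rfl⟩ := hΓ Γ subset_rfl
  rw [← map_star]
  exact localObs_mem_tensorSpan hP _

/-- The linear span of the elementary tensors on `P`, as a `*`-subalgebra. -/
def tensorAlg (d : Λ → ℕ) (P : Set Λ) : StarSubalgebra ℂ (Observables d) where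
  carrier := tensorSpan d P
  mul_mem' := mul_mem_tensorSpan
  add_mem' := Submodule.add_mem _
  algebraMap_mem' c := by
    rw [Algebra.algebraMap_eq_smul_one, ← tensor_empty fun _ => 1]
    exact Submodule.smul_mem _ _ (tensor_mem_tensorSpan (by simp) _)
  star_mem' := star_mem_tensorSpan

theorem adjoin_eq_map_tensorAlg (P : Set Λ) :
    StarAlgebra.adjoin ℂ
      (⋃ (Γ : Finset Λ) (_ : (Γ : Set Λ) ⊆ P), Set.range (localHom (d := d) Γ)) ≤
      (tensorAlg d P).map (observablesOn d Set.univ).subtype := by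
  rw [StarAlgebra.adjoin_le_iff]
  intro x hx
  obtain ⟨Γ, hΓ, N, rfl⟩ := Set.mem_iUnion₂.1 hx
  exact ⟨localObs Γ N, localObs_mem_tensorSpan hΓ N, rfl⟩

/-- The elementary tensors supported in `P` span a dense subspace of the observables on `P`. -/
theorem mem_observablesOn_iff (P : Set Λ) (x : Observables d) :
    x.1 ∈ observablesOn d P ↔ x ∈ closure (tensorSpan d P : Set (Observables d)) := by
  rw [closure_subtype]
  constructor
  · intro hx
    exact closure_mono (adjoin_eq_map_tensorAlg (d := d) P) hx
  · intro hx
    have hc : IsClosed (observablesOn d P : Set (ConfigSpace d →L[ℂ] ConfigSpace d)) :=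
      StarSubalgebra.isClosed_topologicalClosure _
    refine closure_minimal ?_ hc hx
    rintro _ ⟨y, hy, rfl⟩
    obtain ⟨Γ, hP, hΓ⟩ := tensorSpan_induction hy
    obtain ⟨N, rfl⟩ := hΓ Γ subset_rfl
    exact localHom_mem Γ P hP N

theorem dense_tensorSpan : Dense (tensorSpan d Set.univ : Set (Observables d)) := fun x =>
  (mem_observablesOn_iff Set.univ x).1 x.2

theorem tensor_mem_observablesOn {P : Set Λ} {Γ : Finset Λ} (h : (Γ : Set Λ) ⊆ P)
    (M : ∀ j, Matrix (Fin (d j)) (Fin (d j)) ℂ) : (tensor Γ M).1 ∈ observablesOn d P :=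
  (mem_observablesOn_iff P _).2 (subset_closure (tensor_mem_tensorSpan h M))

theorem site_mem_observablesOn {P : Set Λ} {j : Λ} (h : j ∈ P)
    (m : Matrix (Fin (d j)) (Fin (d j)) ℂ) : (site j m : Observables d).1 ∈ observablesOn d P := by
  have := tensor_mem_observablesOn (d := d) (P := P) (Γ := {j}) (by simpa using h)
    (Function.update (fun _ => 1) j m)
  rwa [tensor_singleton, Function.update_self] at this

end Sites

/-! ### Extension by continuity -/

section

open scoped Matrix.Norms.L2Operator

section Extension

variable {Λ : Type} {d : Λ → ℕ}

instance : CStarAlgebra (Observables d) :=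
  StarSubalgebra.cstarAlgebra _ (h_closed := StarSubalgebra.isClosed_topologicalClosure _)

instance [Nonempty (Config d)] : Nontrivial (ConfigSpace d) := by
  obtain ⟨σ⟩ := ‹Nonempty (Config d)›
  refine ⟨lp.single 2 σ (1 : ℂ), 0, fun h => ?_⟩
  have := congrArg (fun ξ : ConfigSpace d => ξ σ) h
  simp at this

instance [Nonempty (Config d)] : Nontrivial (Observables d) := by
  refine ⟨1, 0, fun h => ?_⟩
  have : (1 : ConfigSpace d →L[ℂ] ConfigSpace d) = 0 := congrArg Subtype.val h
  exact one_ne_zero this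

instance [h : Nonempty (Config d)] (Γ : Finset Λ) : Nonempty (LocalConfig d Γ) :=
  h.map (restrict Γ)

theorem starAlgHom_continuous {A B : Type} [CStarAlgebra A] [CStarAlgebra B] (F : A →⋆ₐ[ℂ] B) :
    Continuous F :=
  AddMonoidHomClass.continuous_of_bound F 1 fun x => by
    rw [one_mul]
    exact NonUnitalStarAlgHom.norm_apply_le F x

/-- The local algebras are embedded isometrically, for the operator norm of matrices. -/
theorem norm_localObs [Nonempty (Config d)] (Γ : Finset Λ)
    (N : Matrix (LocalConfig d Γ) (LocalConfig d Γ) ℂ) : ‖localObs Γ N‖ = ‖N‖ := by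
  refine NonUnitalStarAlgHom.norm_map (localObs Γ) ?_ N
  exact RingHom.injective (localObs (d := d) Γ).toAlgHom.toRingHom

theorem norm_le_norm_localObs [Nonempty (Config d)] {B : Type} [CStarAlgebra B] (Γ : Finset Λ)
    (Ψ : Matrix (LocalConfig d Γ) (LocalConfig d Γ) ℂ →⋆ₐ[ℂ] B)
    (N : Matrix (LocalConfig d Γ) (LocalConfig d Γ) ℂ) : ‖Ψ N‖ ≤ ‖localObs Γ N‖ := by
  rw [norm_localObs]
  exact NonUnitalStarAlgHom.norm_apply_le Ψ N

theorem continuousLinearMap_ext {W : Type} [NormedAddCommGroup W] [NormedSpace ℂ W]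
    {F G : Observables d →L[ℂ] W} (h : ∀ Γ M, F (tensor Γ M) = G (tensor Γ M)) : F = G := by
  refine ContinuousLinearMap.ext_on (s := (tensorSpan d Set.univ : Set (Observables d))) ?_ ?_
  · rw [Submodule.span_eq]
    exact dense_tensorSpan
  · intro x hx
    induction hx using Submodule.span_induction with
    | mem x hx => obtain ⟨p, rfl⟩ := hx; exact h _ _
    | zero => simp
    | add x y _ _ hx hy => simp [hx, hy]
    | smul c x _ hx => simp [hx]

/-- Compatible contractive linear maps on the local algebras extend to the quasi-local algebra. -/
theorem exists_extension {W : Type} [NormedAddCommGroup W] [NormedSpace ℂ W] [CompleteSpace W]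
    (Ψ : ∀ Γ : Finset Λ, Matrix (LocalConfig d Γ) (LocalConfig d Γ) ℂ →ₗ[ℂ] W)
    (bound : ∀ Γ N, ‖Ψ Γ N‖ ≤ ‖localObs Γ N‖)
    (compat : ∀ Γ Δ M, Γ ⊆ Δ →
      Ψ Δ (tensorMat Δ (completeBy Γ M)) = Ψ Γ (tensorMat Γ M)) :
    ∃ F : Observables d →L[ℂ] W, ∀ Γ N, F (localObs Γ N) = Ψ Γ N := by
  let I := Finset Λ × (∀ j, Matrix (Fin (d j)) (Fin (d j)) ℂ)
  let m : (I →₀ ℂ) →ₗ[ℂ] Observables d := Finsupp.linearCombination ℂ fun p => tensor p.1 p.2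
  let b : (I →₀ ℂ) →ₗ[ℂ] W := Finsupp.linearCombination ℂ fun p => Ψ p.1 (tensorMat p.1 p.2)
  have hm : DenseRange m := by
    refine dense_tensorSpan.mono fun x hx => ?_
    change x ∈ LinearMap.range m
    rw [Finsupp.range_linearCombination]
    refine Submodule.span_mono ?_ hx
    rintro _ ⟨p, rfl⟩
    exact ⟨(p.1.1, p.2), rfl⟩
  have hb : ∃ C, ∀ v, ‖b v‖ ≤ C * ‖m v‖ := by
    refine ⟨1, fun v => ?_⟩
    let Γ := v.support.biUnion Prod.fst
    have hΓ : ∀ p ∈ v.support, p.1 ⊆ Γ := fun p hp => Finset.subset_biUnion_of_mem Prod.fst hp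
    let N := ∑ p ∈ v.support, v p • tensorMat Γ (completeBy p.1 p.2)
    have h1 : m v = localObs Γ N := by
      simp only [N, m, map_sum, map_smul, Finsupp.linearCombination_apply, Finsupp.sum,
        localObs_tensorMat]
      exact Finset.sum_congr rfl fun p hp => by rw [tensor_completeBy (hΓ p hp)]
    have h2 : b v = Ψ Γ N := by
      simp only [N, b, map_sum, map_smul, Finsupp.linearCombination_apply, Finsupp.sum]
      exact Finset.sum_congr rfl fun p hp => by rw [compat p.1 Γ p.2 (hΓ p hp)]
    rw [h1, h2, one_mul]
    exact bound Γ N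
  refine ⟨b.extendOfNorm m, fun Γ N => ?_⟩
  rw [matrix_eq_sum_tensorMat Γ N]
  simp only [map_sum, map_smul, localObs_tensorMat]
  refine Finset.sum_congr rfl fun ρ _ => Finset.sum_congr rfl fun τ _ => ?_
  congr 1
  have := LinearMap.extendOfNorm_eq hm hb (Finsupp.single (Γ, unitFamily Γ ρ τ) 1)
  simpa [m, b] using this

/-- Compatible `*`-homomorphisms on the local algebras extend to the quasi-local algebra. -/
theorem exists_starAlgHom_extension [Nonempty (Config d)] {B : Type} [CStarAlgebra B]
    (Ψ : ∀ Γ : Finset Λ, Matrix (LocalConfig d Γ) (LocalConfig d Γ) ℂ →⋆ₐ[ℂ] B)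
    (compat : ∀ Γ Δ M, Γ ⊆ Δ →
      Ψ Δ (tensorMat Δ (completeBy Γ M)) = Ψ Γ (tensorMat Γ M)) :
    ∃ F : Observables d →⋆ₐ[ℂ] B, ∀ Γ N, F (localObs Γ N) = Ψ Γ N := by
  obtain ⟨F, hF⟩ := exists_extension (fun Γ => (Ψ Γ).toAlgHom.toLinearMap)
    (fun Γ N => norm_le_norm_localObs Γ (Ψ Γ) N) compat
  replace hF : ∀ Γ N, F (localObs Γ N) = Ψ Γ N := hF
  have h1 : F 1 = 1 := by
    have := hF ∅ 1
    rwa [map_one (localObs (d := d) ∅), map_one (Ψ ∅)] at this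
  have hmul : ∀ x y, F (x * y) = F x * F y := by
    intro x y
    refine (dense_tensorSpan (d := d)).induction (P := fun x => F (x * y) = F x * F y)
      (fun x hx => ?_) (isClosed_eq (by fun_prop) (by fun_prop)) x
    refine (dense_tensorSpan (d := d)).induction (P := fun y => F (x * y) = F x * F y)
      (fun y hy => ?_) (isClosed_eq (by fun_prop) (by fun_prop)) y
    obtain ⟨Γ, -, hΓ⟩ := tensorSpan_induction hx
    obtain ⟨Γ', -, hΓ'⟩ := tensorSpan_induction hy
    obtain ⟨N, rfl⟩ := hΓ (Γ ∪ Γ') Finset.subset_union_left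
    obtain ⟨N', rfl⟩ := hΓ' (Γ ∪ Γ') Finset.subset_union_right
    rw [← map_mul, hF, hF, hF, map_mul]
  have hstar : ∀ x, F (star x) = star (F x) := by
    intro x
    refine (dense_tensorSpan (d := d)).induction (P := fun x => F (star x) = star (F x))
      (fun x hx => ?_) (isClosed_eq (by fun_prop) (by fun_prop)) x
    obtain ⟨Γ, -, hΓ⟩ := tensorSpan_induction hx
    obtain ⟨N, rfl⟩ := hΓ Γ subset_rfl
    rw [← map_star, hF, hF, map_star]
  exact ⟨{ toFun := F
           map_one' := h1
           map_mul' := hmul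
           map_zero' := map_zero F
           map_add' := map_add F
           commutes' := fun c => by
             rw [Algebra.algebraMap_eq_smul_one, map_smul, h1, Algebra.algebraMap_eq_smul_one]
           map_star' := hstar }, hF⟩

theorem starAlgHom_tensor_eq {B : Type} [CStarAlgebra B] {F G : Observables d →⋆ₐ[ℂ] B}
    {Γ : Finset Λ} (h : ∀ j ∈ Γ, ∀ m, F (site j m) = G (site j m))
    (M : ∀ j, Matrix (Fin (d j)) (Fin (d j)) ℂ) :
    F (tensor Γ M) = G (tensor Γ M) := by
  induction Γ using Finset.induction_on with
  | empty => simp [tensor_empty]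
  | insert i Γ hi ih =>
    rw [tensor_insert i Γ hi, map_mul, map_mul, h i (Finset.mem_insert_self i Γ),
      ih fun j hj => h j (Finset.mem_insert_of_mem hj)]

/-- `*`-homomorphisms that agree on the sites in `P` agree on the observables on `P`. -/
theorem starAlgHom_eqOn {B : Type} [CStarAlgebra B] {F G : Observables d →⋆ₐ[ℂ] B} {P : Set Λ}
    (h : ∀ j ∈ P, ∀ m, F (site j m) = G (site j m)) {x : Observables d}
    (hx : x.1 ∈ observablesOn d P) : F x = G x := by
  rw [mem_observablesOn_iff] at hx
  have hF : Continuous F := starAlgHom_continuous F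
  have hG : Continuous G := starAlgHom_continuous G
  refine closure_minimal (s := (tensorSpan d P : Set (Observables d))) (t := {x | F x = G x})
    (fun x hx => ?_) (isClosed_eq hF hG) hx
  change F x = G x
  induction hx using Submodule.span_induction with
  | mem x hx =>
    obtain ⟨p, rfl⟩ := hx
    exact starAlgHom_tensor_eq (fun j hj => h j (p.1.2 hj)) p.2
  | zero => simp
  | add x y _ _ hx hy => simp [hx, hy]
  | smul c x _ hx => simp [hx]

theorem starAlgHom_ext {B : Type} [CStarAlgebra B] {F G : Observables d →⋆ₐ[ℂ] B}
    (h : ∀ j m, F (site j m) = G (site j m)) : F = G :=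
  StarAlgHom.ext fun x => starAlgHom_eqOn (P := Set.univ) (fun j _ => h j) x.2

theorem starAlgEquiv_ext {Λ' : Type} {d' : Λ' → ℕ} {F G : Observables d ≃⋆ₐ[ℂ] Observables d'}
    (h : ∀ j m, F (site j m) = G (site j m)) : F = G := by
  have := starAlgHom_ext (F := (F : Observables d →⋆ₐ[ℂ] Observables d'))
    (G := (G : Observables d →⋆ₐ[ℂ] Observables d')) h
  exact StarAlgEquiv.ext fun x => DFunLike.congr_fun this x

end Extension

end

/-! ### Haag duality -/

section Commutant

/-- A normalized sum of conjugations by partial isometries with a common initial projection and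
orthogonal ranges is contractive. -/
theorem norm_sum_conj_le {A ι : Type} [CStarAlgebra A] [Fintype ι] (a : ι → A) (q : A)
    (hq : star q * q = q) (ha : ∀ k l, star (a k) * a l = if k = l then q else 0)
    (h1 : ∑ k, a k * star (a k) = 1) (x : A) : ‖∑ k, a k * x * star (a k)‖ ≤ ‖x‖ := by
  let _ := CStarAlgebra.spectralOrder A
  have := CStarAlgebra.spectralOrderedRing A
  have hqs : star q = q := by rw [← hq, star_mul, star_star]
  have hq1 : q ≤ 1 := by
    rw [← sub_nonneg]
    have : 1 - q = star (1 - q) * (1 - q) := by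
      rw [star_sub, star_one, hqs, sub_mul, mul_sub, mul_sub]
      rw [hqs] at hq
      simp [hq]
    rw [this]
    exact star_mul_self_nonneg _
  set y := ∑ k, a k * x * star (a k) with hy
  have h2 : star y * y = ∑ k, a k * (star x * q * x) * star (a k) := by
    rw [hy, star_sum, Finset.sum_mul_sum]
    refine Finset.sum_congr rfl fun k _ => ?_
    rw [Finset.sum_eq_single k]
    · have : star (a k) * a k = q := by simpa using ha k k
      rw [← this]
      simp [mul_assoc]
    · intro l _ hl
      have : star (a k) * a l = 0 := by simpa [hl.symm] using ha k l
      calc _ = a k * star x * (star (a k) * a l) * x * star (a l) := by simp [mul_assoc]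
        _ = 0 := by simp [this]
    · simp
  have h3 : star x * q * x ≤ algebraMap ℝ A (‖x‖ ^ 2) := by
    refine (star_left_conjugate_le_conjugate hq1 x).trans ?_
    rw [mul_one]
    exact CStarAlgebra.star_mul_le_algebraMap_norm_sq
  have h4 : star y * y ≤ algebraMap ℝ A (‖x‖ ^ 2) := by
    rw [h2]
    calc _ ≤ ∑ k, a k * algebraMap ℝ A (‖x‖ ^ 2) * star (a k) :=
          Finset.sum_le_sum fun k _ => star_right_conjugate_le_conjugate h3 (a k)
      _ = algebraMap ℝ A (‖x‖ ^ 2) := by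
          simp_rw [← Algebra.commutes, mul_assoc]
          rw [← Finset.mul_sum, h1, mul_one]
  have h5 : ‖star y * y‖ ≤ ‖x‖ ^ 2 := by
    refine (CStarAlgebra.norm_le_norm_of_nonneg_of_le (star_mul_self_nonneg y) h4).trans ?_
    rcases subsingleton_or_nontrivial A with h | h
    · rw [Subsingleton.elim (algebraMap ℝ A (‖x‖ ^ 2)) 0, norm_zero]
      positivity
    · rw [norm_algebraMap']
      simp
  rw [CStarRing.norm_star_mul_self, ← sq] at h5
  exact le_of_sq_le_sq h5 (norm_nonneg x)

variable {Λ : Type} {d : Λ → ℕ}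

/-- The slice map at the site `j`, for the vector state of the basis vector `k`. -/
def slice (j : Λ) (k : Fin (d j)) : Observables d →ₗ[ℂ] Observables d where
  toFun x := ∑ l, site j (Matrix.single l k 1) * x * star (site j (Matrix.single l k 1))
  map_add' x y := by simp [mul_add, add_mul, Finset.sum_add_distrib]
  map_smul' c x := by simp [Finset.smul_sum]

theorem star_single_one {n : Type} [Fintype n] [DecidableEq n] (i j : n) :
    star (Matrix.single i j (1 : ℂ)) = Matrix.single j i 1 := by
  rw [Matrix.star_eq_conjTranspose, Matrix.conjTranspose_single, star_one]

theorem sum_single_diag {n : Type} [Fintype n] [DecidableEq n] :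
    ∑ i : n, Matrix.single i i (1 : ℂ) = 1 := by
  ext i j
  rw [Matrix.sum_apply, Matrix.one_apply, Finset.sum_eq_single i]
  · simp [Matrix.single_apply]
  · intro k _ hk
    simp [hk]
  · simp

theorem sum_site_diag (j : Λ) :
    ∑ l, site j (Matrix.single l l (1 : ℂ)) = (1 : Observables d) := by
  rw [← map_sum, sum_single_diag, map_one]

theorem norm_slice_le (j : Λ) (k : Fin (d j)) (x : Observables d) : ‖slice j k x‖ ≤ ‖x‖ := by
  refine norm_sum_conj_le _ (site j (Matrix.single k k 1)) ?_ ?_ ?_ x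
  · rw [← map_star, ← map_mul, star_single_one, Matrix.single_mul_single_same, mul_one]
  · intro l l'
    rw [← map_star, ← map_mul, star_single_one]
    split_ifs with h
    · rw [h, Matrix.single_mul_single_same, mul_one]
    · rw [Matrix.single_mul_single_of_ne _ _ _ _ h, map_zero]
  · simp_rw [← map_star, ← map_mul, star_single_one, Matrix.single_mul_single_same, mul_one]
    exact sum_site_diag j

theorem slice_mul_of_commute (j : Λ) (k : Fin (d j)) (x y : Observables d)
    (hy : ∀ m, Commute y (site j m)) : slice j k (x * y) = slice j k x * y := by
  change ∑ l : Fin (d j), _ = (∑ l : Fin (d j), _) * y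
  rw [Finset.sum_mul]
  refine Finset.sum_congr rfl fun l _ => ?_
  have h := (hy (star (Matrix.single l k 1))).eq
  rw [map_star] at h
  simp only [mul_assoc, h]

theorem slice_one (j : Λ) (k : Fin (d j)) : slice j k 1 = (1 : Observables d) := by
  change ∑ l : Fin (d j), _ = _
  simp_rw [mul_one, ← map_star, ← map_mul, star_single_one, Matrix.single_mul_single_same, mul_one]
  exact sum_site_diag j

theorem slice_of_commute (j : Λ) (k : Fin (d j)) (y : Observables d)
    (hy : ∀ m, Commute y (site j m)) : slice j k y = y := by
  simpa [slice_one] using slice_mul_of_commute j k 1 y hy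

theorem slice_site (j : Λ) (k : Fin (d j)) (m : Matrix (Fin (d j)) (Fin (d j)) ℂ) :
    slice j k (site j m) = m k k • (1 : Observables d) := by
  change ∑ l : Fin (d j), _ = _
  simp_rw [← map_star, ← map_mul, star_single_one, Matrix.single_mul_mul_single, one_mul, mul_one]
  rw [← sum_site_diag j, Finset.smul_sum]
  refine Finset.sum_congr rfl fun l _ => ?_
  rw [← map_smul, Matrix.smul_single, smul_eq_mul, mul_one]

theorem slice_mem_tensorSpan (j : Λ) (k : Fin (d j)) {P : Set Λ} {y : Observables d}
    (hy : y ∈ tensorSpan d P) : slice j k y ∈ tensorSpan d (P \ {j}) := by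
  induction hy using Submodule.span_induction with
  | mem x hx =>
    obtain ⟨⟨⟨Γ, hΓ⟩, M⟩, rfl⟩ := hx
    change slice j k (tensor Γ M) ∈ _
    by_cases hj : j ∈ Γ
    · rw [← Finset.insert_erase hj, tensor_insert j _ (Finset.notMem_erase j Γ),
        slice_mul_of_commute _ _ _ _
          fun m => (site_commute_tensor (Finset.notMem_erase j Γ) m M).symm,
        slice_site, smul_mul_assoc, one_mul]
      refine Submodule.smul_mem _ _ (tensor_mem_tensorSpan ?_ _)
      intro i hi
      rw [Finset.mem_coe, Finset.mem_erase] at hi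
      exact ⟨hΓ hi.2, hi.1⟩
    · rw [slice_of_commute _ _ _ fun m => (site_commute_tensor hj m M).symm]
      have h : (Γ : Set Λ) ⊆ P \ {j} := fun i hi => ⟨hΓ hi, by rintro rfl; exact hj hi⟩
      exact tensor_mem_tensorSpan h _
  | zero => simp
  | add x y _ _ hx hy => rw [map_add]; exact Submodule.add_mem _ hx hy
  | smul c x _ hx => rw [map_smul]; exact Submodule.smul_mem _ _ hx

/-- Approximations of an observable that commutes with the sites in `Δ` can be freed of these sites.
-/
theorem exists_approx_of_commute (x : Observables d) (hd : Nonempty (Config d)) (Δ : Finset Λ)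
    (hx : ∀ j ∈ Δ, ∀ m, Commute x (site j m)) {P : Set Λ} {y : Observables d}
    (hy : y ∈ tensorSpan d P) : ∃ z ∈ tensorSpan d (P \ Δ), ‖x - z‖ ≤ ‖x - y‖ := by
  induction Δ using Finset.induction_on with
  | empty => exact ⟨y, by simpa using hy, le_rfl⟩
  | insert i Δ hi ih =>
    obtain ⟨z, hz, hxz⟩ := ih fun j hj => hx j (Finset.mem_insert_of_mem hj)
    obtain ⟨σ⟩ := hd
    refine ⟨slice i (σ i) z, ?_, ?_⟩
    · have := slice_mem_tensorSpan i (σ i) hz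
      rwa [Set.sdiff_sdiff, Set.union_singleton, ← Finset.coe_insert] at this
    · refine le_trans ?_ hxz
      have := norm_slice_le i (σ i) (x - z)
      rwa [map_sub, slice_of_commute i (σ i) x (hx i (Finset.mem_insert_self i Δ))] at this

theorem tensorSpan_mono {P Q : Set Λ} (h : P ⊆ Q) : tensorSpan d P ≤ tensorSpan d Q := by
  refine Submodule.span_mono ?_
  rintro _ ⟨p, rfl⟩
  exact ⟨(⟨p.1.1, p.1.2.trans h⟩, p.2), rfl⟩

/-- Haag duality: an observable that commutes with the sites outside `P` is an observable on `P`.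
The slice maps at the sites outside `P` fix it, and they are contractive, so they turn local
approximations into approximations on `P`. -/
theorem mem_observablesOn_of_commute [hd : Nonempty (Config d)] {P : Set Λ} {x : Observables d}
    (hx : ∀ j ∉ P, ∀ m, Commute x (site j m)) : x.1 ∈ observablesOn d P := by
  rw [mem_observablesOn_iff, Metric.mem_closure_iff]
  intro ε hε
  obtain ⟨y, hy, hxy⟩ := Metric.mem_closure_iff.1 (dense_tensorSpan (d := d) x) ε hε
  obtain ⟨Γ, -, hΓ⟩ := tensorSpan_induction hy
  obtain ⟨N, hN⟩ := hΓ Γ subset_rfl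
  have hy' : y ∈ tensorSpan d (Γ : Set Λ) := by
    rw [hN]
    exact localObs_mem_tensorSpan subset_rfl N
  obtain ⟨z, hz, hxz⟩ := exists_approx_of_commute x hd (Γ.filter (· ∉ P))
    (fun j hj => hx j (Finset.mem_filter.1 hj).2) hy'
  refine ⟨z, tensorSpan_mono ?_ hz, ?_⟩
  · intro i hi
    by_contra h
    exact hi.2 (by simpa using ⟨hi.1, h⟩)
  · rw [dist_eq_norm] at hxy ⊢
    exact hxz.trans_lt hxy

/-- Automorphisms with disjoint supports commute. -/
theorem commute_of_disjoint_supports [Nonempty (Config d)] {P Q : Set Λ} (hPQ : Disjoint P Q)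
    {α β : Observables d ≃⋆ₐ[ℂ] Observables d} (hα : ∀ j ∉ P, ∀ m, α (site j m) = site j m)
    (hβ : ∀ j ∉ Q, ∀ m, β (site j m) = site j m) : Commute α β := by
  have key : ∀ {P Q : Set Λ} {α β : Observables d ≃⋆ₐ[ℂ] Observables d}, Disjoint P Q →
      (∀ j ∉ P, ∀ m, α (site j m) = site j m) → (∀ j ∉ Q, ∀ m, β (site j m) = site j m) →
      ∀ j ∈ P, ∀ m, α (β (site j m)) = β (α (site j m)) := by
    intro P Q α β hPQ hα hβ j hj m
    rw [hβ j (Set.disjoint_left.1 hPQ hj)]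
    have h1 : (α (site j m)).1 ∈ observablesOn d P := by
      refine mem_observablesOn_of_commute fun i hi n => ?_
      have h : Commute (site j m : Observables d) (site i n) :=
        site_commute (fun e => hi (by rwa [← e])) m n
      have := h.map α
      rwa [hα i hi] at this
    have h2 := starAlgHom_eqOn (F := (β : Observables d →⋆ₐ[ℂ] Observables d))
      (G := StarAlgHom.id ℂ (Observables d)) (P := P)
      (fun i hi n => hβ i (Set.disjoint_left.1 hPQ hi) n) h1
    exact h2.symm
  refine starAlgEquiv_ext fun j m => ?_
  change α (β (site j m)) = β (α (site j m))
  by_cases hj : j ∈ P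
  · exact key hPQ hα hβ j hj m
  by_cases hj' : j ∈ Q
  · exact (key hPQ.symm hβ hα j hj' m).symm
  · rw [hα j hj, hβ j hj', hα j hj]

end Commutant

/-! ### Embeddings of lattices, and stacks -/

section Functoriality

variable {Λ Λ' : Type} {d' : Λ' → ℕ}

/-- The bijection of a finite set with its image under an embedding. -/
def finsetMapEquiv (e : Λ ↪ Λ') (Γ : Finset Λ) : {j // j ∈ Γ} ≃ {k // k ∈ Γ.map e} :=
  Equiv.ofBijective (fun j => ⟨e j, Finset.mem_map_of_mem e j.2⟩)
    ⟨fun _ _ h => Subtype.ext (e.injective (congrArg Subtype.val h)), fun ⟨k, hk⟩ => by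
      obtain ⟨j, hj, rfl⟩ := Finset.mem_map.1 hk
      exact ⟨⟨j, hj⟩, rfl⟩⟩

/-- Local configurations on the image of `Γ` under an embedding of sites. -/
def mapEquiv (e : Λ ↪ Λ') (d' : Λ' → ℕ) (Γ : Finset Λ) :
    LocalConfig (d' ∘ e) Γ ≃ LocalConfig d' (Γ.map e) :=
  Equiv.piCongrLeft (fun k : {k // k ∈ Γ.map e} => Fin (d' k)) (finsetMapEquiv e Γ)

theorem relabel_tensorMat (e : Λ ↪ Λ') (Γ : Finset Λ)
    (M' : ∀ k, Matrix (Fin (d' k)) (Fin (d' k)) ℂ) :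
    relabel (mapEquiv e d' Γ) (tensorMat (d := d' ∘ e) Γ fun j => M' (e j)) =
      tensorMat (Γ.map e) M' := by
  ext ρ τ
  rw [relabel_apply]
  exact Fintype.prod_equiv (finsetMapEquiv e Γ) _ (fun k => M' k.1 (ρ k) (τ k)) fun j => rfl

theorem exists_family (e : Λ ↪ Λ') (M : ∀ j, Matrix (Fin (d' (e j))) (Fin (d' (e j))) ℂ) :
    ∃ M' : ∀ k, Matrix (Fin (d' k)) (Fin (d' k)) ℂ, ∀ j, M' (e j) = M j := by
  refine ⟨fun k => if h : ∃ j, e j = k then h.choose_spec ▸ M h.choose else 1, fun j => ?_⟩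
  have h : ∃ i, e i = e j := ⟨j, rfl⟩
  refine (dif_pos h).trans ?_
  have key : ∀ i (hi : e i = e j), hi ▸ M i = M j := by
    intro i hi
    obtain rfl := e.injective hi
    rfl
  exact key _ h.choose_spec

theorem exists_mapHom [Nonempty (Config d')] (e : Λ ↪ Λ') :
    ∃ F : Observables (d' ∘ e) →⋆ₐ[ℂ] Observables d',
      ∀ Γ (M' : ∀ k, Matrix (Fin (d' k)) (Fin (d' k)) ℂ),
        F (tensor Γ fun j => M' (e j)) = tensor (Γ.map e) M' := by
  have : Nonempty (Config (d' ∘ e)) := ⟨fun j => Classical.arbitrary (Config d') (e j)⟩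
  obtain ⟨F, hF⟩ := exists_starAlgHom_extension (d := d' ∘ e)
    (fun Γ => (localObs (Γ.map e)).comp (relabel (mapEquiv e d' Γ))) (by
      intro Γ Δ M h
      obtain ⟨M', hM'⟩ := exists_family e M
      obtain rfl : (fun j => M' (e j)) = M := funext hM'
      have hc : completeBy (d := d' ∘ e) Γ (fun j => M' (e j)) =
          fun j => completeBy (Γ.map e) M' (e j) := by
        funext j
        simp [completeBy]
      rw [hc]
      change localObs _ (relabel _ _) = localObs _ (relabel _ _)
      rw [relabel_tensorMat, relabel_tensorMat, localObs_tensorMat, localObs_tensorMat,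
        tensor_completeBy (Finset.map_subset_map.2 h)])
  refine ⟨F, fun Γ M' => ?_⟩
  rw [← localObs_tensorMat, hF]
  change localObs _ (relabel _ _) = _
  rw [relabel_tensorMat, localObs_tensorMat]

/-- The homomorphism of quasi-local algebras induced by an embedding of the sets of sites. -/
def mapHom [Nonempty (Config d')] (e : Λ ↪ Λ') : Observables (d' ∘ e) →⋆ₐ[ℂ] Observables d' :=
  (exists_mapHom e).choose

theorem mapHom_tensor [Nonempty (Config d')] (e : Λ ↪ Λ') (Γ : Finset Λ)
    (M' : ∀ k, Matrix (Fin (d' k)) (Fin (d' k)) ℂ) :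
    mapHom e (tensor Γ fun j => M' (e j)) = tensor (Γ.map e) M' :=
  (exists_mapHom e).choose_spec Γ M'

theorem mapHom_site [Nonempty (Config d')] (e : Λ ↪ Λ') (j : Λ)
    (m : Matrix (Fin (d' (e j))) (Fin (d' (e j))) ℂ) :
    mapHom e (site j m) = site (e j) m := by
  have := mapHom_tensor e {j} (Function.update (fun _ => 1) (e j) m)
  rwa [Finset.map_singleton, tensor_singleton, tensor_singleton, Function.update_self] at this

end Functoriality

theorem tensor_eq_sum {Λ : Type} {d : Λ → ℕ} (Γ : Finset Λ)
    (M : ∀ j, Matrix (Fin (d j)) (Fin (d j)) ℂ) :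
    tensor Γ M = ∑ ρ, ∑ τ, tensorMat Γ M ρ τ • localObs Γ (Matrix.single ρ τ 1) := by
  rw [← localObs_tensorMat]
  conv_lhs => rw [matrix_eq_sum_tensorMat Γ (tensorMat Γ M)]
  simp only [map_sum, map_smul, tensorMat_unitFamily]

section MatrixUnits

variable {n B : Type} [Fintype n] [DecidableEq n] [Ring B] [StarRing B] [Algebra ℂ B]
  [StarModule ℂ B]

/-- A system of matrix units is a representation of the matrix algebra. -/
def matrixUnitHom (E : n → n → B) (hmul : ∀ i j k l, E i j * E k l = if j = k then E i l else 0)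
    (hstar : ∀ i j, star (E i j) = E j i) (hone : ∑ i, E i i = 1) :
    Matrix n n ℂ →⋆ₐ[ℂ] B where
  toFun N := ∑ i, ∑ j, N i j • E i j
  map_one' := by
    simp [Matrix.one_apply, ite_smul, hone]
  map_mul' M N := by
    simp_rw [Finset.sum_mul_sum, smul_mul_smul_comm, hmul, Matrix.mul_apply, Finset.sum_smul]
    refine Finset.sum_congr rfl fun i _ => ?_
    symm
    calc ∑ k, ∑ j, ∑ l, (M i j * N k l) • (if j = k then E i l else 0)
        = ∑ j, ∑ k, ∑ l, (M i j * N k l) • (if j = k then E i l else 0) := Finset.sum_comm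
      _ = ∑ j, ∑ l, (M i j * N j l) • E i l := by
          refine Finset.sum_congr rfl fun j _ => ?_
          rw [Finset.sum_eq_single j]
          · simp
          · intro k _ hk
            simp [hk.symm]
          · simp
      _ = _ := Finset.sum_comm
  map_zero' := by simp
  map_add' M N := by simp [add_smul, Finset.sum_add_distrib]
  commutes' c := by
    simp [Matrix.algebraMap_matrix_apply, ite_smul, Algebra.algebraMap_eq_smul_one, ← hone,
      Finset.smul_sum]
  map_star' M := by
    simp only [star_sum, star_smul, hstar, Matrix.star_apply]
    rw [Finset.sum_comm]

end MatrixUnits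

section Stack

variable {Λ Λ' : Type} {d : Λ → ℕ} {d' : Λ' → ℕ}

local instance : DecidableEq (Λ ⊕ Λ') := fun a b => Classical.propDecidable (a = b)

/-- The part of a family of matrices on a stack that belongs to the first layer. -/
def leftFamily (M : ∀ x, Matrix (Fin (Sum.elim d d' x)) (Fin (Sum.elim d d' x)) ℂ) :
    ∀ j, Matrix (Fin (d j)) (Fin (d j)) ℂ := fun j => M (Sum.inl j)

/-- The part of a family of matrices on a stack that belongs to the second layer. -/
def rightFamily (M : ∀ x, Matrix (Fin (Sum.elim d d' x)) (Fin (Sum.elim d d' x)) ℂ) :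
    ∀ j, Matrix (Fin (d' j)) (Fin (d' j)) ℂ := fun j => M (Sum.inr j)

/-- The family of matrices on a stack with the given parts. -/
def sumFamily (M : ∀ j, Matrix (Fin (d j)) (Fin (d j)) ℂ)
    (M' : ∀ j, Matrix (Fin (d' j)) (Fin (d' j)) ℂ) :
    ∀ x, Matrix (Fin (Sum.elim d d' x)) (Fin (Sum.elim d d' x)) ℂ := fun x =>
  match x with
  | Sum.inl j => M j
  | Sum.inr j => M' j

/-- Local configurations of a stack. -/
def stackEquiv (d : Λ → ℕ) (d' : Λ' → ℕ) (Γ : Finset (Λ ⊕ Λ')) :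
    LocalConfig (Sum.elim d d') Γ ≃ LocalConfig d Γ.toLeft × LocalConfig d' Γ.toRight where
  toFun ρ := (fun j => ρ ⟨Sum.inl j, Finset.mem_toLeft.1 j.2⟩,
    fun j => ρ ⟨Sum.inr j, Finset.mem_toRight.1 j.2⟩)
  invFun p := fun x => match x with
    | ⟨Sum.inl j, h⟩ => p.1 ⟨j, Finset.mem_toLeft.2 h⟩
    | ⟨Sum.inr j, h⟩ => p.2 ⟨j, Finset.mem_toRight.2 h⟩
  left_inv ρ := by
    funext x
    obtain ⟨x | x, h⟩ := x <;> rfl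
  right_inv p := rfl

theorem tensorMat_stack (Γ : Finset (Λ ⊕ Λ'))
    (M : ∀ x, Matrix (Fin (Sum.elim d d' x)) (Fin (Sum.elim d d' x)) ℂ)
    (ρ τ : LocalConfig (Sum.elim d d') Γ) :
    tensorMat Γ M ρ τ =
      tensorMat Γ.toLeft (leftFamily M) (stackEquiv d d' Γ ρ).1
        (stackEquiv d d' Γ τ).1 *
      tensorMat (d := d') Γ.toRight (rightFamily M) (stackEquiv d d' Γ ρ).2
        (stackEquiv d d' Γ τ).2 := by
  let F : Λ ⊕ Λ' → ℂ := fun x => if h : x ∈ Γ then M x (ρ ⟨x, h⟩) (τ ⟨x, h⟩) else 1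
  have h1 : tensorMat Γ M ρ τ = ∏ x ∈ Γ, F x := by
    rw [← Finset.prod_coe_sort]
    exact Finset.prod_congr rfl fun x _ => by simp only [F, dif_pos x.2]
  have h2 : tensorMat Γ.toLeft (leftFamily M) (stackEquiv d d' Γ ρ).1
      (stackEquiv d d' Γ τ).1 = ∏ j ∈ Γ.toLeft, F (Sum.inl j) := by
    rw [← Finset.prod_coe_sort]
    exact Finset.prod_congr rfl fun x _ => by
      simp only [F, dif_pos (Finset.mem_toLeft.1 x.2)]
      rfl
  have h3 : tensorMat (d := d') Γ.toRight (rightFamily M) (stackEquiv d d' Γ ρ).2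
      (stackEquiv d d' Γ τ).2 = ∏ j ∈ Γ.toRight, F (Sum.inr j) := by
    rw [← Finset.prod_coe_sort]
    exact Finset.prod_congr rfl fun x _ => by
      simp only [F, dif_pos (Finset.mem_toRight.1 x.2)]
      rfl
  rw [h1, h2, h3, ← Finset.prod_disjSum, Finset.toLeft_disjSum_toRight]

variable {W : Type} [AddCommGroup W] [Module ℂ W]

/-- The restriction to `A_Γ` of the linear map on a stack defined by a bilinear map. -/
def localBilin (b : Observables d →ₗ[ℂ] Observables d' →ₗ[ℂ] W) (Γ : Finset (Λ ⊕ Λ')) :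
    Matrix (LocalConfig (Sum.elim d d') Γ) (LocalConfig (Sum.elim d d') Γ) ℂ →ₗ[ℂ] W :=
  ∑ ρ, ∑ τ, (Matrix.entryLinearMap ℂ ℂ ρ τ).smulRight
    (b (localObs Γ.toLeft (Matrix.single (stackEquiv d d' Γ ρ).1 (stackEquiv d d' Γ τ).1 1))
      (localObs Γ.toRight (Matrix.single (stackEquiv d d' Γ ρ).2 (stackEquiv d d' Γ τ).2 1)))

theorem localBilin_apply (b : Observables d →ₗ[ℂ] Observables d' →ₗ[ℂ] W) (Γ : Finset (Λ ⊕ Λ'))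
    (N : Matrix (LocalConfig (Sum.elim d d') Γ) (LocalConfig (Sum.elim d d') Γ) ℂ) :
    localBilin b Γ N = ∑ ρ, ∑ τ, N ρ τ •
      b (localObs Γ.toLeft (Matrix.single (stackEquiv d d' Γ ρ).1 (stackEquiv d d' Γ τ).1 1))
      (localObs Γ.toRight (Matrix.single (stackEquiv d d' Γ ρ).2 (stackEquiv d d' Γ τ).2 1)) := by
  simp [localBilin, LinearMap.sum_apply]

theorem localBilin_tensorMat (b : Observables d →ₗ[ℂ] Observables d' →ₗ[ℂ] W)
    (Γ : Finset (Λ ⊕ Λ'))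
    (M : ∀ x, Matrix (Fin (Sum.elim d d' x)) (Fin (Sum.elim d d' x)) ℂ) :
    localBilin b Γ (tensorMat Γ M) =
      b (tensor Γ.toLeft (leftFamily M)) (tensor Γ.toRight (rightFamily M)) := by
  rw [localBilin_apply]
  set L := tensorMat Γ.toLeft (leftFamily M) with hL
  set R := tensorMat Γ.toRight (rightFamily M) with hR
  rw [tensor_eq_sum (d := d), tensor_eq_sum (d := d'), ← hL, ← hR]
  simp only [map_sum, map_smul, LinearMap.sum_apply, LinearMap.smul_apply, Finset.smul_sum,
    smul_smul]
  rw [← (stackEquiv d d' Γ).symm.sum_comp, Fintype.sum_prod_type]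
  have h3 : ∀ p q, tensorMat Γ M ((stackEquiv d d' Γ).symm p) ((stackEquiv d d' Γ).symm q) =
      L p.1 q.1 * R p.2 q.2 := by
    intro p q
    rw [tensorMat_stack, Equiv.apply_symm_apply, Equiv.apply_symm_apply]
  calc _ = ∑ ρ, ∑ ρ', ∑ τ, ∑ τ', (L ρ τ * R ρ' τ') •
        b (localObs Γ.toLeft (Matrix.single ρ τ 1)) (localObs Γ.toRight (Matrix.single ρ' τ' 1)) := by
        refine Finset.sum_congr rfl fun ρ _ => Finset.sum_congr rfl fun ρ' _ => ?_
        rw [← (stackEquiv d d' Γ).symm.sum_comp, Fintype.sum_prod_type]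
        refine Finset.sum_congr rfl fun τ _ => Finset.sum_congr rfl fun τ' _ => ?_
        rw [h3, Equiv.apply_symm_apply, Equiv.apply_symm_apply]
    _ = _ := by
        simp_rw [mul_comm (R _ _)]
        calc _ = ∑ ρ', ∑ ρ, ∑ τ, ∑ τ', (L ρ τ * R ρ' τ') •
              b (localObs Γ.toLeft (Matrix.single ρ τ 1))
                (localObs Γ.toRight (Matrix.single ρ' τ' 1)) := Finset.sum_comm
          _ = _ := by
            refine Finset.sum_congr rfl fun ρ' _ => ?_
            rw [Finset.sum_comm (s := Finset.univ (α := LocalConfig d' Γ.toRight))]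
            exact Finset.sum_congr rfl fun ρ _ => Finset.sum_comm

theorem completeBy_left (Γ : Finset (Λ ⊕ Λ'))
    (M : ∀ x, Matrix (Fin (Sum.elim d d' x)) (Fin (Sum.elim d d' x)) ℂ) :
    leftFamily (completeBy Γ M) = completeBy Γ.toLeft (leftFamily M) := by
  funext j
  by_cases h : Sum.inl j ∈ Γ <;> simp [leftFamily, completeBy, h] <;> rfl

theorem completeBy_right (Γ : Finset (Λ ⊕ Λ'))
    (M : ∀ x, Matrix (Fin (Sum.elim d d' x)) (Fin (Sum.elim d d' x)) ℂ) :
    rightFamily (completeBy Γ M) = completeBy Γ.toRight (rightFamily M) := by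
  funext j
  by_cases h : Sum.inr j ∈ Γ <;> simp [rightFamily, completeBy, h] <;> rfl

theorem localBilin_compat (b : Observables d →ₗ[ℂ] Observables d' →ₗ[ℂ] W)
    (Γ Δ : Finset (Λ ⊕ Λ'))
    (M : ∀ x, Matrix (Fin (Sum.elim d d' x)) (Fin (Sum.elim d d' x)) ℂ) (h : Γ ⊆ Δ) :
    localBilin b Δ (tensorMat Δ (completeBy Γ M)) = localBilin b Γ (tensorMat Γ M) := by
  rw [localBilin_tensorMat, localBilin_tensorMat, completeBy_left, completeBy_right,
    tensor_completeBy (Finset.toLeft_subset_toLeft h),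
    tensor_completeBy (Finset.toRight_subset_toRight h)]

variable {B : Type} [CStarAlgebra B]

/-- The matrix units of a stack, in a commuting pair of representations of the layers. -/
def stackUnit (φ : Observables d →⋆ₐ[ℂ] B) (χ : Observables d' →⋆ₐ[ℂ] B) (Γ : Finset (Λ ⊕ Λ'))
    (ρ τ : LocalConfig (Sum.elim d d') Γ) : B :=
  φ (localObs Γ.toLeft (Matrix.single (stackEquiv d d' Γ ρ).1 (stackEquiv d d' Γ τ).1 1)) *
    χ (localObs Γ.toRight (Matrix.single (stackEquiv d d' Γ ρ).2 (stackEquiv d d' Γ τ).2 1))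

/-- A commuting pair of representations of the layers represents the local algebras of a stack. -/
def localStackHom (φ : Observables d →⋆ₐ[ℂ] B) (χ : Observables d' →⋆ₐ[ℂ] B)
    (hc : ∀ x y, Commute (φ x) (χ y)) (Γ : Finset (Λ ⊕ Λ')) :
    Matrix (LocalConfig (Sum.elim d d') Γ) (LocalConfig (Sum.elim d d') Γ) ℂ →⋆ₐ[ℂ] B :=
  matrixUnitHom (stackUnit φ χ Γ)
    (by
      intro ρ τ ρ' τ'
      simp only [stackUnit]
      rw [mul_assoc, ← mul_assoc (χ _), ← (hc _ _).eq, mul_assoc, ← mul_assoc, ← map_mul, ← map_mul,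
        ← map_mul, ← map_mul]
      by_cases h1 : (stackEquiv d d' Γ τ).1 = (stackEquiv d d' Γ ρ').1
      · by_cases h2 : (stackEquiv d d' Γ τ).2 = (stackEquiv d d' Γ ρ').2
        · have h : τ = ρ' := (stackEquiv d d' Γ).injective (Prod.ext h1 h2)
          rw [if_pos h, h1, h2, Matrix.single_mul_single_same, Matrix.single_mul_single_same,
            mul_one]
        · have h : τ ≠ ρ' := by rintro rfl; exact h2 rfl
          rw [if_neg h, Matrix.single_mul_single_of_ne _ _ _ _ h2]
          simp
      · have h : τ ≠ ρ' := by rintro rfl; exact h1 rfl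
        rw [if_neg h, Matrix.single_mul_single_of_ne _ _ _ _ h1]
        simp)
    (by
      intro ρ τ
      simp only [stackUnit]
      rw [star_mul, ← map_star, ← map_star, ← map_star, ← map_star, star_single_one,
        star_single_one, (hc _ _).eq])
    (by
      simp only [stackUnit]
      rw [← (stackEquiv d d' Γ).symm.sum_comp, Fintype.sum_prod_type]
      simp only [Equiv.apply_symm_apply]
      simp_rw [← Finset.mul_sum, ← Finset.sum_mul, ← map_sum, sum_single_diag, map_one, one_mul])

/-- The universal property of a stack: a commuting pair of representations of the layers is a
representation of the stack. -/
theorem exists_stackHom [Nonempty (Config (Sum.elim d d'))] (φ : Observables d →⋆ₐ[ℂ] B)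
    (χ : Observables d' →⋆ₐ[ℂ] B) (hc : ∀ x y, Commute (φ x) (χ y)) :
    ∃ F : Observables (Sum.elim d d') →⋆ₐ[ℂ] B, ∀ Γ M,
      F (tensor Γ M) = φ (tensor Γ.toLeft (leftFamily M)) *
        χ (tensor Γ.toRight (rightFamily M)) := by
  let b : Observables d →ₗ[ℂ] Observables d' →ₗ[ℂ] B :=
    (LinearMap.mul ℂ B).compl₁₂ φ.toAlgHom.toLinearMap χ.toAlgHom.toLinearMap
  have hb : ∀ Γ N, localStackHom φ χ hc Γ N = localBilin b Γ N := fun Γ N => by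
    rw [localBilin_apply]
    rfl
  obtain ⟨F, hF⟩ := exists_starAlgHom_extension (d := Sum.elim d d')
    (localStackHom φ χ hc) fun Γ Δ M h => by
    rw [hb, hb, localBilin_compat b Γ Δ M h]
  refine ⟨F, fun Γ M => ?_⟩
  rw [← localObs_tensorMat, hF, hb, localBilin_tensorMat]
  rfl

/-- The representation of a stack defined by a commuting pair of representations of the layers. -/
def stackHom [Nonempty (Config (Sum.elim d d'))] (φ : Observables d →⋆ₐ[ℂ] B)
    (χ : Observables d' →⋆ₐ[ℂ] B) (hc : ∀ x y, Commute (φ x) (χ y)) :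
    Observables (Sum.elim d d') →⋆ₐ[ℂ] B := (exists_stackHom φ χ hc).choose

/-- The observables at a site of the first layer of a stack. -/
def siteL (d' : Λ' → ℕ) (j : Λ) : Matrix (Fin (d j)) (Fin (d j)) ℂ →⋆ₐ[ℂ] Observables (Sum.elim d d') :=
  site (d := Sum.elim d d') (Sum.inl j)

/-- The observables at a site of the second layer of a stack. -/
def siteR (d : Λ → ℕ) (j : Λ') :
    Matrix (Fin (d' j)) (Fin (d' j)) ℂ →⋆ₐ[ℂ] Observables (Sum.elim d d') :=
  site (d := Sum.elim d d') (Sum.inr j)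

/-- `*`-homomorphisms on a stack that agree on the sites of both layers are equal. -/
theorem stack_ext {F G : Observables (Sum.elim d d') →⋆ₐ[ℂ] B}
    (hl : ∀ j m, F (siteL d' j m) = G (siteL d' j m))
    (hr : ∀ j m, F (siteR d j m) = G (siteR d j m)) : F = G :=
  starAlgHom_ext fun x => match x with
    | Sum.inl j => hl j
    | Sum.inr j => hr j

variable [Nonempty (Config (Sum.elim d d'))]

theorem stackHom_tensor (φ : Observables d →⋆ₐ[ℂ] B)
    (χ : Observables d' →⋆ₐ[ℂ] B) (hc : ∀ x y, Commute (φ x) (χ y)) (Γ : Finset (Λ ⊕ Λ'))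
    (M : ∀ x, Matrix (Fin (Sum.elim d d' x)) (Fin (Sum.elim d d' x)) ℂ) :
    stackHom φ χ hc (tensor Γ M) = φ (tensor Γ.toLeft (leftFamily M)) *
        χ (tensor Γ.toRight (rightFamily M)) :=
  (exists_stackHom φ χ hc).choose_spec Γ M

variable (d d') in
/-- The inclusion of the first layer of a stack. -/
def inlHom : Observables d →⋆ₐ[ℂ] Observables (Sum.elim d d') :=
  mapHom (d' := Sum.elim d d') Function.Embedding.inl

variable (d d') in
/-- The inclusion of the second layer of a stack. -/
def inrHom : Observables d' →⋆ₐ[ℂ] Observables (Sum.elim d d') :=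
  mapHom (d' := Sum.elim d d') Function.Embedding.inr

theorem inlHom_site (j : Λ) (m : Matrix (Fin (d j)) (Fin (d j)) ℂ) :
    inlHom d d' (site j m) = siteL d' j m :=
  mapHom_site (d' := Sum.elim d d') Function.Embedding.inl j m

theorem inrHom_site (j : Λ') (m : Matrix (Fin (d' j)) (Fin (d' j)) ℂ) :
    inrHom d d' (site j m) = siteR d j m :=
  mapHom_site (d' := Sum.elim d d') Function.Embedding.inr j m

theorem inlHom_tensor (Γ : Finset Λ)
    (M : ∀ x, Matrix (Fin (Sum.elim d d' x)) (Fin (Sum.elim d d' x)) ℂ) :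
    inlHom d d' (tensor Γ (leftFamily M)) = tensor (Γ.map Function.Embedding.inl) M :=
  mapHom_tensor (d' := Sum.elim d d') Function.Embedding.inl Γ M

theorem inrHom_tensor (Γ : Finset Λ')
    (M : ∀ x, Matrix (Fin (Sum.elim d d' x)) (Fin (Sum.elim d d' x)) ℂ) :
    inrHom d d' (tensor Γ (rightFamily M)) = tensor (Γ.map Function.Embedding.inr) M :=
  mapHom_tensor (d' := Sum.elim d d') Function.Embedding.inr Γ M

theorem tensor_stack (Γ : Finset (Λ ⊕ Λ'))
    (M : ∀ x, Matrix (Fin (Sum.elim d d' x)) (Fin (Sum.elim d d' x)) ℂ) :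
    tensor Γ M = inlHom d d' (tensor Γ.toLeft (leftFamily M)) *
      inrHom d d' (tensor Γ.toRight (rightFamily M)) := by
  rw [inlHom_tensor, inrHom_tensor]
  rw [← tensor_disjUnion _ _ (Finset.disjoint_map_inl_map_inr Γ.toLeft Γ.toRight)]
  conv_lhs => rw [← Γ.toLeft_disjSum_toRight]
  rfl

/-- The layers of a stack commute. -/
theorem commute_inlHom_inrHom (x : Observables d) (y : Observables d') :
    Commute (inlHom d d' x) (inrHom d d' y) := by
  have hl := starAlgHom_continuous (inlHom d d')
  have hr := starAlgHom_continuous (inrHom d d')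
  refine (dense_tensorSpan (d := d)).induction
    (P := fun x => Commute (inlHom d d' x) (inrHom d d' y)) (fun x hx => ?_)
    (isClosed_eq (by fun_prop) (by fun_prop)) x
  refine (dense_tensorSpan (d := d')).induction
    (P := fun y => Commute (inlHom d d' x) (inrHom d d' y)) (fun y hy => ?_)
    (isClosed_eq (by fun_prop) (by fun_prop)) y
  induction hx using Submodule.span_induction with
  | mem x hx =>
    obtain ⟨p, rfl⟩ := hx
    induction hy using Submodule.span_induction with
    | mem y hy =>
      obtain ⟨q, rfl⟩ := hy
      change Commute (inlHom d d' (tensor p.1.1 (leftFamily (sumFamily p.2 q.2))))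
        (inrHom d d' (tensor q.1.1 (rightFamily (sumFamily p.2 q.2))))
      rw [inlHom_tensor, inrHom_tensor]
      have h := Finset.disjoint_map_inl_map_inr p.1.1 q.1.1
      rw [Commute, SemiconjBy, ← tensor_disjUnion _ _ h, ← tensor_disjUnion _ _ h.symm,
        Finset.disjUnion_comm]
    | zero => rw [map_zero]; exact Commute.zero_right _
    | add x y _ _ hx hy => rw [map_add]; exact hx.add_right hy
    | smul c x _ hx => rw [map_smul]; exact hx.smul_right c
  | zero => rw [map_zero]; exact Commute.zero_left _
  | add x y _ _ hx hy => rw [map_add]; exact hx.add_left hy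
  | smul c x _ hx => rw [map_smul]; exact hx.smul_left c

theorem stackHom_siteL (φ : Observables d →⋆ₐ[ℂ] B)
    (χ : Observables d' →⋆ₐ[ℂ] B) (hc : ∀ x y, Commute (φ x) (χ y)) (j : Λ)
    (m : Matrix (Fin (d j)) (Fin (d j)) ℂ) : stackHom φ χ hc (siteL d' j m) = φ (site j m) := by
  obtain ⟨A, hA⟩ : ∃ A : ∀ j, Matrix (Fin (d j)) (Fin (d j)) ℂ, A j = m :=
    ⟨Function.update (fun _ => 1) j m, Function.update_self ..⟩
  have h := stackHom_tensor φ χ hc {Sum.inl j} (sumFamily A fun _ => 1)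
  have h1 : ({Sum.inl j} : Finset (Λ ⊕ Λ')).toLeft = {j} := by ext; simp
  have h2 : ({Sum.inl j} : Finset (Λ ⊕ Λ')).toRight = ∅ := by ext; simp
  have h3 : tensor {Sum.inl j} (sumFamily A fun _ => 1) = siteL d' j (A j) :=
    tensor_singleton (d := Sum.elim d d') _ _
  have h4 : leftFamily (d' := d') (sumFamily A fun _ => 1) = A := rfl
  rw [h1, h2, h3, h4, tensor_empty, map_one, mul_one, tensor_singleton, hA] at h
  exact h

theorem stackHom_siteR (φ : Observables d →⋆ₐ[ℂ] B)
    (χ : Observables d' →⋆ₐ[ℂ] B) (hc : ∀ x y, Commute (φ x) (χ y)) (j : Λ')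
    (m : Matrix (Fin (d' j)) (Fin (d' j)) ℂ) : stackHom φ χ hc (siteR d j m) = χ (site j m) := by
  obtain ⟨A, hA⟩ : ∃ A : ∀ j, Matrix (Fin (d' j)) (Fin (d' j)) ℂ, A j = m :=
    ⟨Function.update (fun _ => 1) j m, Function.update_self ..⟩
  have h := stackHom_tensor φ χ hc {Sum.inr j} (sumFamily (fun _ => 1) A)
  have h1 : ({Sum.inr j} : Finset (Λ ⊕ Λ')).toLeft = ∅ := by ext; simp
  have h2 : ({Sum.inr j} : Finset (Λ ⊕ Λ')).toRight = {j} := by ext; simp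
  have h3 : tensor {Sum.inr j} (sumFamily (fun _ => 1) A) = siteR d j (A j) :=
    tensor_singleton (d := Sum.elim d d') _ _
  have h4 : rightFamily (d := d) (sumFamily (fun _ => 1) A) = A := rfl
  rw [h1, h2, h3, h4, tensor_empty, map_one, one_mul, tensor_singleton, hA] at h
  exact h

end Stack

/-! ### States -/

section

open scoped ComplexOrder Matrix.Norms.L2Operator

section PositiveFunctionals

variable {A : Type} [CStarAlgebra A] {φ : A →ₗ[ℂ] ℂ}

/-- The Cauchy–Schwarz inequality for a positive functional. -/
theorem norm_apply_star_mul_le (h : ∀ a, 0 ≤ φ (star a * a)) (a b : A) :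
    ‖φ (star a * b)‖ ^ 2 ≤ (φ (star a * a)).re * (φ (star b * b)).re := by
  let _ := CStarAlgebra.spectralOrder A
  have := CStarAlgebra.spectralOrderedRing A
  let f : A →ₚ[ℂ] ℂ := PositiveLinearMap.mk₀ φ fun x hx => by
    obtain ⟨y, rfl⟩ := CStarAlgebra.nonneg_iff_eq_star_mul_self.1 hx
    exact h y
  have key := norm_inner_le_norm (𝕜 := ℂ) (f.toPreGNS a) (f.toPreGNS b)
  rw [PositiveLinearMap.preGNS_inner_def, PositiveLinearMap.preGNS_norm_def,
    PositiveLinearMap.preGNS_norm_def] at key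
  simp only [PositiveLinearMap.ofPreGNS_toPreGNS] at key
  change ‖φ (star a * b)‖ ≤ √(φ (star a * a)).re * √(φ (star b * b)).re at key
  have ha := (Complex.nonneg_iff.1 (h a)).1
  have hb := (Complex.nonneg_iff.1 (h b)).1
  calc ‖φ (star a * b)‖ ^ 2 ≤ (√(φ (star a * a)).re * √(φ (star b * b)).re) ^ 2 := by gcongr
    _ = _ := by rw [mul_pow, Real.sq_sqrt ha, Real.sq_sqrt hb]

theorem apply_star (h : ∀ a, 0 ≤ φ (star a * a)) (x : A) : φ (star x) = star (φ x) := by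
  let _ := CStarAlgebra.spectralOrder A
  have := CStarAlgebra.spectralOrderedRing A
  let f : A →ₚ[ℂ] ℂ := PositiveLinearMap.mk₀ φ fun x hx => by
    obtain ⟨y, rfl⟩ := CStarAlgebra.nonneg_iff_eq_star_mul_self.1 hx
    exact h y
  exact map_star f x

theorem apply_star_mul_self_le (h : ∀ a, 0 ≤ φ (star a * a)) (x : A) :
    (φ (star x * x)).re ≤ ‖x‖ ^ 2 * (φ 1).re := by
  let _ := CStarAlgebra.spectralOrder A
  have := CStarAlgebra.spectralOrderedRing A
  have h1 := CStarAlgebra.star_mul_le_algebraMap_norm_sq (a := x)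
  obtain ⟨y, hy⟩ := CStarAlgebra.nonneg_iff_eq_star_mul_self.1 (sub_nonneg.2 h1)
  have h2 := (Complex.nonneg_iff.1 (h y)).1
  rw [← hy, map_sub, Complex.sub_re, Algebra.algebraMap_eq_smul_one, ← Complex.coe_smul, map_smul,
    smul_eq_mul, Complex.re_ofReal_mul] at h2
  linarith

/-- A positive functional that vanishes at `1` is zero. -/
theorem eq_zero_of_apply_one (h : ∀ a, 0 ≤ φ (star a * a)) (h1 : φ 1 = 0) : φ = 0 := by
  ext x
  have := norm_apply_star_mul_le h 1 x
  rw [star_one, one_mul, one_mul, h1, Complex.zero_re, zero_mul] at this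
  simpa using this

namespace IsState

theorem norm_apply_le (h : IsState φ) (x : A) : ‖φ x‖ ≤ ‖x‖ := by
  have h1 := norm_apply_star_mul_le h.1 1 x
  rw [star_one, one_mul, one_mul, h.2, Complex.one_re, one_mul] at h1
  have h2 := apply_star_mul_self_le h.1 x
  rw [h.2, Complex.one_re, mul_one] at h2
  exact (pow_le_pow_iff_left₀ (norm_nonneg _) (norm_nonneg _) two_ne_zero).1 (h1.trans h2)

/-- A state as a continuous functional. -/
def toCLM (h : IsState φ) : A →L[ℂ] ℂ :=
  φ.mkContinuous 1 fun x => by simpa using h.norm_apply_le x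

theorem continuous (h : IsState φ) : Continuous φ := h.toCLM.continuous

theorem comp {B : Type} [CStarAlgebra B] (h : IsState φ) (F : B →⋆ₐ[ℂ] A) :
    IsState (φ ∘ₗ F.toAlgHom.toLinearMap) :=
  ⟨fun b => by
    change 0 ≤ φ (F (star b * b))
    rw [map_mul, map_star]
    exact h.1 _, by
    change φ (F 1) = 1
    rw [map_one, h.2]⟩

end IsState

end PositiveFunctionals

section StatesOnObservables

variable {Λ : Type} {d : Λ → ℕ}

theorem IsState.nonempty_config {φ : Observables d →ₗ[ℂ] ℂ} (h : IsState φ) :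
    Nonempty (Config d) := by
  by_contra hne
  rw [not_nonempty_iff] at hne
  have : Subsingleton (ConfigSpace d) := ⟨fun ξ η => by ext σ; exact isEmptyElim σ⟩
  have h1 : (1 : Observables d) = 0 := Subtype.ext (Subsingleton.elim _ _)
  have := h.2
  rw [h1, map_zero] at this
  exact zero_ne_one this

theorem IsState.ext_tensor {φ χ : Observables d →ₗ[ℂ] ℂ} (hφ : IsState φ) (hχ : IsState χ)
    (h : ∀ Γ M, φ (tensor Γ M) = χ (tensor Γ M)) : φ = χ := by
  have := continuousLinearMap_ext (F := hφ.toCLM) (G := hχ.toCLM) h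
  ext x
  exact DFunLike.congr_fun this x

/-- Positivity of a continuous functional may be checked on local observables. -/
theorem nonneg_of_localObs (F : Observables d →L[ℂ] ℂ)
    (h : ∀ (Γ : Finset Λ) (N : Matrix (LocalConfig d Γ) (LocalConfig d Γ) ℂ),
      0 ≤ F (localObs Γ (star N * N))) (x : Observables d) : 0 ≤ F (star x * x) := by
  refine (dense_tensorSpan (d := d)).induction (P := fun x => 0 ≤ F (star x * x)) ?_ ?_ x
  · intro x hx
    obtain ⟨Γ, -, hΓ⟩ := tensorSpan_induction hx
    obtain ⟨N, rfl⟩ := hΓ Γ subset_rfl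
    rw [← map_star, ← map_mul]
    exact h Γ N
  · exact isClosed_le continuous_const (by fun_prop)

theorem gram_posSemidef {A ι : Type} [CStarAlgebra A] [Fintype ι] {φ : A →ₗ[ℂ] ℂ}
    (h : ∀ a, 0 ≤ φ (star a * a)) (E : ι → A) :
    (Matrix.of fun i j => φ (star (E i) * E j)).PosSemidef := by
  refine .of_dotProduct_mulVec_nonneg ?_ fun v => ?_
  · ext i j
    rw [Matrix.conjTranspose_apply, Matrix.of_apply, Matrix.of_apply, ← apply_star h]
    simp
  · have := h (∑ i, v i • E i)
    rw [star_sum, Finset.sum_mul, map_sum] at this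
    refine this.trans_eq ?_
    rw [dotProduct]
    refine Finset.sum_congr rfl fun i _ => ?_
    rw [Finset.mul_sum, map_sum, Matrix.mulVec, dotProduct, Finset.mul_sum]
    refine Finset.sum_congr rfl fun j _ => ?_
    simp only [star_smul, smul_mul_assoc, mul_smul_comm, map_smul, smul_eq_mul, Matrix.of_apply,
      Pi.star_apply]
    ring

theorem sum_star_mul_self_nonneg {n : Type} [Fintype n] [DecidableEq n] {K : Matrix n n ℂ}
    (hK : K.PosSemidef) (N : Matrix n n ℂ) : 0 ≤ ∑ ρ, ∑ τ, (star N * N) ρ τ • K ρ τ := by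
  have h : ∑ ρ, ∑ τ, (star N * N) ρ τ • K ρ τ = ∑ κ, ∑ ρ, ∑ τ, star (N κ ρ) * (K ρ τ * N κ τ) := by
    symm
    rw [Finset.sum_comm]
    refine Finset.sum_congr rfl fun ρ _ => ?_
    rw [Finset.sum_comm]
    refine Finset.sum_congr rfl fun τ _ => ?_
    rw [Matrix.mul_apply, Finset.sum_smul]
    refine Finset.sum_congr rfl fun κ _ => ?_
    rw [Matrix.star_apply, smul_eq_mul]
    ring
  rw [h]
  refine Finset.sum_nonneg fun κ _ => (hK.dotProduct_mulVec_nonneg (N κ)).trans_eq ?_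
  simp_rw [dotProduct, Matrix.mulVec, dotProduct, Finset.mul_sum]
  rfl

variable {Λ' : Type} {d' : Λ' → ℕ}

local instance : DecidableEq (Λ ⊕ Λ') := fun a b => Classical.propDecidable (a = b)

/-- `ω = ψ ⊗ χ` as states on a stack. -/
def IsTensorState (ψ : Observables d →ₗ[ℂ] ℂ) (χ : Observables d' →ₗ[ℂ] ℂ)
    (ω : Observables (Sum.elim d d') →ₗ[ℂ] ℂ) : Prop :=
  ∀ Γ M, ω (tensor Γ M) = ψ (tensor Γ.toLeft (leftFamily M)) * χ (tensor Γ.toRight (rightFamily M))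

theorem single_eq_star_mul {n : Type} [Fintype n] [DecidableEq n] (κ ρ τ : n) :
    Matrix.single ρ τ (1 : ℂ) = star (Matrix.single κ ρ 1) * Matrix.single κ τ 1 := by
  rw [star_single_one, Matrix.single_mul_single_same, mul_one]

/-- On local algebras, positivity of the tensor product of two states is the Schur product
theorem. -/
theorem localBilin_nonneg {ψ : Observables d →ₗ[ℂ] ℂ} {χ : Observables d' →ₗ[ℂ] ℂ}
    (hψ : IsState ψ) (hχ : IsState χ) (Γ : Finset (Λ ⊕ Λ'))
    (N : Matrix (LocalConfig (Sum.elim d d') Γ) (LocalConfig (Sum.elim d d') Γ) ℂ) :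
    0 ≤ localBilin ((LinearMap.mul ℂ ℂ).compl₁₂ ψ χ) Γ (star N * N) := by
  rw [localBilin_apply]
  rcases isEmpty_or_nonempty (LocalConfig (Sum.elim d d') Γ) with h | ⟨⟨κ⟩⟩
  · simp
  have hA := gram_posSemidef hψ.1 fun ρ : LocalConfig (Sum.elim d d') Γ =>
    localObs Γ.toLeft (Matrix.single (stackEquiv d d' Γ κ).1 (stackEquiv d d' Γ ρ).1 1)
  have hB := gram_posSemidef hχ.1 fun ρ : LocalConfig (Sum.elim d d') Γ =>
    localObs Γ.toRight (Matrix.single (stackEquiv d d' Γ κ).2 (stackEquiv d d' Γ ρ).2 1)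
  refine (sum_star_mul_self_nonneg (hA.hadamard hB) N).trans_eq ?_
  refine Finset.sum_congr rfl fun ρ _ => Finset.sum_congr rfl fun τ _ => congrArg _ ?_
  rw [Matrix.hadamard_apply, Matrix.of_apply, Matrix.of_apply, ← map_star, ← map_mul, ← map_star,
    ← map_mul, ← single_eq_star_mul, ← single_eq_star_mul]
  rfl

theorem exists_isTensorState {ψ : Observables d →ₗ[ℂ] ℂ} {χ : Observables d' →ₗ[ℂ] ℂ}
    (hψ : IsState ψ) (hχ : IsState χ) : ∃ ω, IsState ω ∧ IsTensorState ψ χ ω := by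
  obtain ⟨σ⟩ := hψ.nonempty_config
  obtain ⟨σ'⟩ := hχ.nonempty_config
  have : Nonempty (Config (Sum.elim d d')) := ⟨fun x => match x with
    | Sum.inl j => σ j
    | Sum.inr j => σ' j⟩
  set b := (LinearMap.mul ℂ ℂ).compl₁₂ ψ χ with hb
  have hone : ∀ Γ, localBilin b Γ 1 = 1 := fun Γ => by
    have := localBilin_tensorMat b Γ fun _ => 1
    have e1 : tensorMat (d := Sum.elim d d') Γ (fun _ => 1) = 1 := by
      have h := localObs_tensorMat (d := Sum.elim d d') Γ fun _ => 1
      rw [tensor_one, ← map_one (localObs (d := Sum.elim d d') Γ)] at h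
      exact RingHom.injective (localObs (d := Sum.elim d d') Γ).toAlgHom.toRingHom h
    rw [e1] at this
    rw [this]
    have e2 : tensor (d := d) Γ.toLeft (leftFamily (d' := d') fun _ => 1) = 1 := tensor_one _
    have e3 : tensor (d := d') Γ.toRight (rightFamily (d := d) fun _ => 1) = 1 := tensor_one _
    rw [e2, e3]
    simp [hb, hψ.2, hχ.2]
  have hstate : ∀ Γ, IsState (localBilin b Γ) := fun Γ => ⟨localBilin_nonneg hψ hχ Γ, hone Γ⟩
  obtain ⟨F, hF⟩ := exists_extension (fun Γ => localBilin b Γ)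
    (fun Γ N => by
      rw [norm_localObs]
      exact (hstate Γ).norm_apply_le N)
    (fun Γ Δ M h => localBilin_compat b Γ Δ M h)
  refine ⟨F, ⟨nonneg_of_localObs F fun Γ N => ?_, ?_⟩, fun Γ M => ?_⟩
  · rw [hF]
    exact localBilin_nonneg hψ hχ Γ N
  · change F 1 = 1
    rw [← map_one (localObs ∅), hF, hone]
  · change F _ = _
    rw [← localObs_tensorMat, hF, localBilin_tensorMat]
    rfl

end StatesOnObservables

end

/-! ### Pure states and product states -/

section

open scoped ComplexOrder

section PureStates

variable {A B C : Type} [CStarAlgebra A] [CStarAlgebra B] [CStarAlgebra C]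

theorem IsPure.isState {φ : A →ₗ[ℂ] ℂ} (h : IsPure φ) : IsState φ := h.1

theorem isPure_iff {φ : A →ₗ[ℂ] ℂ} : IsPure φ ↔ IsState φ ∧
    ∀ F G : A →ₗ[ℂ] ℂ, IsState F → IsState G → ∀ a b : ℝ, 0 < a → 0 < b → a + b = 1 →
      (∀ x, φ x = a * F x + b * G x) → F = φ := by
  rw [IsPure, mem_extremePoints_iff_left]
  refine and_congr Iff.rfl ⟨fun h F G hF hG a b ha hb hab hφ => ?_, fun h F hF G hG hφ => ?_⟩
  · refine h F hF G hG ⟨a, b, ha, hb, hab, ?_⟩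
    ext x
    rw [hφ x]
    simp
  · obtain ⟨a, b, ha, hb, hab, rfl⟩ := hφ
    exact h F G hF hG a b ha hb hab fun x => by simp

/-- A pure state is not a sum of two positive functionals that are not proportional to it. -/
theorem IsPure.eq_smul_of_add {φ F G : A →ₗ[ℂ] ℂ} (h : IsPure φ) (hF : ∀ a, 0 ≤ F (star a * a))
    (hG : ∀ a, 0 ≤ G (star a * a)) (hφ : ∀ x, φ x = F x + G x) (x : A) : F x = F 1 * φ x := by
  have h1 := hφ 1
  rw [h.isState.2] at h1
  obtain ⟨s, hs⟩ : ∃ s : ℝ, F 1 = s := ⟨(F 1).re, by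
    have := Complex.nonneg_iff.1 (hF 1)
    rw [star_one, one_mul] at this
    exact Complex.ext rfl this.2.symm⟩
  obtain ⟨t, ht⟩ : ∃ t : ℝ, G 1 = t := ⟨(G 1).re, by
    have := Complex.nonneg_iff.1 (hG 1)
    rw [star_one, one_mul] at this
    exact Complex.ext rfl this.2.symm⟩
  have hs0 : 0 ≤ s := by
    have := hF 1
    rw [star_one, one_mul, hs] at this
    exact_mod_cast this
  have ht0 : 0 ≤ t := by
    have := hG 1
    rw [star_one, one_mul, ht] at this
    exact_mod_cast this
  have hst : s + t = 1 := by
    rw [hs, ht] at h1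
    exact_mod_cast h1.symm
  rcases hs0.eq_or_lt with rfl | hs0
  · rw [eq_zero_of_apply_one hF (by simpa using hs)]
    simp
  rcases ht0.eq_or_lt with rfl | ht0
  · have hG0 := eq_zero_of_apply_one hG (by simpa using ht)
    rw [hs, hφ x, hG0, show s = 1 by linarith]
    simp
  have hnorm : ∀ (F : A →ₗ[ℂ] ℂ) (s : ℝ), (∀ a, 0 ≤ F (star a * a)) → F 1 = s → 0 < s →
      IsState ((s⁻¹ : ℂ) • F) := fun F s hF hs hs0 => ⟨fun a => by
    rw [LinearMap.smul_apply, smul_eq_mul, ← Complex.ofReal_inv]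
    exact mul_nonneg (by exact_mod_cast (inv_pos.2 hs0).le) (hF a), by
    rw [LinearMap.smul_apply, hs, smul_eq_mul, inv_mul_cancel₀]
    exact_mod_cast hs0.ne'⟩
  have key := (isPure_iff.1 h).2 _ _ (hnorm F s hF hs hs0) (hnorm G t hG ht ht0) s t hs0 ht0 hst
    fun x => by
      have e1 : (s : ℂ) ≠ 0 := by exact_mod_cast hs0.ne'
      have e2 : (t : ℂ) ≠ 0 := by exact_mod_cast ht0.ne'
      simp only [LinearMap.smul_apply, smul_eq_mul]
      rw [mul_inv_cancel_left₀ e1, mul_inv_cancel_left₀ e2, hφ]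
  have e1 : (s : ℂ) ≠ 0 := by exact_mod_cast hs0.ne'
  rw [hs, ← key, LinearMap.smul_apply, smul_eq_mul, mul_inv_cancel_left₀ e1]

/-- A state whose restriction to a subalgebra is pure is uncorrelated with the commutant of that
subalgebra. -/
theorem IsPure.apply_mul_of_commute {F : C →ₗ[ℂ] ℂ} (hF : IsState F) (ι : A →⋆ₐ[ℂ] C)
    (κ : B →⋆ₐ[ℂ] C) (hc : ∀ x y, Commute (ι x) (κ y)) {φ : A →ₗ[ℂ] ℂ} (h : IsPure φ)
    (hφ : ∀ x, F (ι x) = φ x) (x : A) (y : B) : F (ι x * κ y) = φ x * F (κ y) := by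
  let _ := CStarAlgebra.spectralOrder B
  have := CStarAlgebra.spectralOrderedRing B
  have hy : y ∈ Submodule.span ℂ ({x : B | 0 ≤ x} ∩ Metric.closedBall 0 1) := by
    rw [CStarAlgebra.span_nonneg_inter_unitClosedBall]
    trivial
  induction hy using Submodule.span_induction with
  | mem y hy =>
    obtain ⟨hy0, hy1⟩ := hy
    replace hy0 : 0 ≤ y := hy0
    have hy2 : y ≤ 1 := (CStarAlgebra.norm_le_one_iff_of_nonneg y hy0).1 (by simpa using hy1)
    obtain ⟨w, hw⟩ := CStarAlgebra.nonneg_iff_eq_star_mul_self.1 hy0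
    obtain ⟨v, hv⟩ := CStarAlgebra.nonneg_iff_eq_star_mul_self.1 (sub_nonneg.2 hy2)
    let P : B → A →ₗ[ℂ] ℂ := fun z =>
      F ∘ₗ (LinearMap.mulRight ℂ (κ z)) ∘ₗ ι.toAlgHom.toLinearMap
    have hP : ∀ z x, P z x = F (ι x * κ z) := fun z x => rfl
    have hpos : ∀ w a, 0 ≤ P (star w * w) (star a * a) := fun w a => by
      rw [hP]
      have e : ι (star a * a) * κ (star w * w) = star (ι a * κ w) * (ι a * κ w) := by
        rw [map_mul, map_mul, map_star, map_star, star_mul, ← map_star κ, ← map_star ι]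
        have h1 := (hc (star a * a) (star w)).eq
        rw [map_mul] at h1
        rw [← mul_assoc, h1, mul_assoc, mul_assoc, mul_assoc]
      rw [e]
      exact hF.1 _
    have key := h.eq_smul_of_add (F := P y) (G := P (1 - y)) (by rw [hw]; exact hpos w)
      (by rw [hv]; exact hpos v) (fun x => by
        rw [hP, hP, map_sub, map_one, ← map_add, ← mul_add, add_sub_cancel, mul_one, hφ]) x
    rw [hP, hP, map_one, one_mul] at key
    rw [key, mul_comm]
  | zero => simp
  | add y z _ _ hy hz => rw [map_add, mul_add, map_add, map_add, hy, hz, mul_add]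
  | smul c y _ hy => rw [map_smul, mul_smul_comm, map_smul, map_smul, hy, smul_eq_mul, smul_eq_mul,
      mul_left_comm]

end PureStates

section StackStates

variable {Λ Λ' : Type} {d : Λ → ℕ} {d' : Λ' → ℕ}

theorem observables_induction {p : Observables d → Prop} (ht : ∀ Γ M, p (tensor Γ M)) (h0 : p 0)
    (ha : ∀ x y, p x → p y → p (x + y)) (hs : ∀ (c : ℂ) x, p x → p (c • x))
    (hc : IsClosed {x | p x}) (x : Observables d) : p x := by
  refine (dense_tensorSpan (d := d)).induction (P := p) (fun x hx => ?_) hc x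
  induction hx using Submodule.span_induction with
  | mem x hx =>
    obtain ⟨q, rfl⟩ := hx
    exact ht _ _
  | zero => exact h0
  | add x y _ _ hx hy => exact ha x y hx hy
  | smul c x _ hx => exact hs c x hx

theorem inlHom_mul_inrHom_tensor [Nonempty (Config (Sum.elim d d'))] (Γ : Finset Λ) (Γ' : Finset Λ')
    (M : ∀ j, Matrix (Fin (d j)) (Fin (d j)) ℂ) (M' : ∀ j, Matrix (Fin (d' j)) (Fin (d' j)) ℂ) :
    inlHom d d' (tensor Γ M) * inrHom d d' (tensor Γ' M') =
      tensor (Γ.disjSum Γ') (sumFamily M M') := by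
  rw [tensor_stack, Finset.toLeft_disjSum, Finset.toRight_disjSum]
  rfl

variable {ψ : Observables d →ₗ[ℂ] ℂ} {χ : Observables d' →ₗ[ℂ] ℂ}
  {ω : Observables (Sum.elim d d') →ₗ[ℂ] ℂ}

theorem IsTensorState.apply [Nonempty (Config (Sum.elim d d'))] (hψ : IsState ψ) (hχ : IsState χ) (hω : IsState ω)
    (h : IsTensorState ψ χ ω) (x : Observables d) (y : Observables d') :
    ω (inlHom d d' x * inrHom d d' y) = ψ x * χ y := by
  have hl := starAlgHom_continuous (inlHom d d')
  have hr := starAlgHom_continuous (inrHom d d')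
  have := hω.continuous
  have := hψ.continuous
  have := hχ.continuous
  induction x using observables_induction with
  | ht Γ M =>
    induction y using observables_induction with
    | ht Γ' M' =>
      rw [inlHom_mul_inrHom_tensor, h, Finset.toLeft_disjSum, Finset.toRight_disjSum]
      rfl
    | h0 => simp
    | ha x y hx hy => simp only [map_add, mul_add, hx, hy]
    | hs c x hx => simp only [map_smul, mul_smul_comm, hx]
    | hc => exact isClosed_eq (by fun_prop) (by fun_prop)
  | h0 => simp
  | ha x y hx hy => simp only [map_add, add_mul, hx, hy]
  | hs c x hx => simp only [map_smul, smul_mul_assoc, hx]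
  | hc => exact isClosed_eq (by fun_prop) (by fun_prop)

theorem IsTensorState.isPure (hψ : IsPure ψ) (hχ : IsPure χ) (hω : IsState ω)
    (h : IsTensorState ψ χ ω) : IsPure ω := by
  have := hω.nonempty_config
  refine isPure_iff.2 ⟨hω, fun F G hF hG a b ha hb hab hφ => ?_⟩
  have h1 := (isPure_iff.1 hψ).2 _ _ (hF.comp (inlHom d d')) (hG.comp (inlHom d d')) a b ha hb hab
    fun x => by
      have := h.apply hψ.isState hχ.isState hω x 1
      rw [map_one, mul_one, hχ.isState.2, mul_one] at this
      rw [← this]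
      exact hφ _
  have h2 := (isPure_iff.1 hχ).2 _ _ (hF.comp (inrHom d d')) (hG.comp (inrHom d d')) a b ha hb hab
    fun x => by
      have := h.apply hψ.isState hχ.isState hω 1 x
      rw [map_one, one_mul, hψ.isState.2, one_mul] at this
      rw [← this]
      exact hφ _
  refine hF.ext_tensor hω fun Γ M => ?_
  rw [h, tensor_stack, IsPure.apply_mul_of_commute hF (inlHom d d') (inrHom d d')
    commute_inlHom_inrHom hψ (fun x => LinearMap.congr_fun h1 x)]
  exact congrArg _ (LinearMap.congr_fun h2 _)

/-- A product state on the observables of a family of sites. -/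
def IsProductState (ω : Observables d →ₗ[ℂ] ℂ) : Prop :=
  IsState ω ∧ ∃ ρ : ∀ j, Matrix (Fin (d j)) (Fin (d j)) ℂ →ₗ[ℂ] ℂ,
    (∀ j, IsState (ρ j)) ∧ ∀ Γ M, ω (tensor Γ M) = ∏ j ∈ Γ, ρ j (M j)

theorem IsTensorState.isProductState (hψ : IsProductState ψ) (hχ : IsProductState χ)
    (hω : IsState ω) (h : IsTensorState ψ χ ω) : IsProductState ω := by
  obtain ⟨-, ρ, hρ, hψ⟩ := hψ
  obtain ⟨-, ρ', hρ', hχ⟩ := hχ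
  refine ⟨hω, fun x => match x with
    | Sum.inl j => ρ j
    | Sum.inr j => ρ' j, fun x => match x with
    | Sum.inl j => hρ j
    | Sum.inr j => hρ' j, fun Γ M => ?_⟩
  rw [h, hψ, hχ]
  conv_rhs => rw [← Finset.toLeft_disjSum_toRight (u := Γ), Finset.prod_disjSum]
  rfl

end StackStates

end

/-! ### Basis states -/

section

open scoped ComplexOrder Matrix.Norms.L2Operator

section BasisStates

variable {Λ : Type} {d : Λ → ℕ}

/-- The vector state of a product basis vector. -/
def basisState (σ : Config d) : Observables d →ₗ[ℂ] ℂ where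
  toFun x := x.1 (lp.single 2 σ 1) σ
  map_add' _ _ := rfl
  map_smul' _ _ := rfl

theorem isState_basisState (σ : Config d) : IsState (basisState σ) := by
  refine ⟨fun x => ?_, ?_⟩
  · have h : ∀ f : ConfigSpace d, f σ = inner ℂ (lp.single 2 σ (1 : ℂ)) f := fun f => by
      rw [lp.inner_single_left]
      simp
    change 0 ≤ (star x.1 (x.1 (lp.single 2 σ 1)) : ConfigSpace d) σ
    rw [h, ContinuousLinearMap.star_eq_adjoint, ContinuousLinearMap.adjoint_inner_right]
    rw [inner_self_eq_norm_sq_to_K]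
    positivity
  · change (lp.single 2 σ (1 : ℂ) : ConfigSpace d) σ = 1
    simp

theorem basisState_localObs (σ : Config d) (Γ : Finset Λ)
    (N : Matrix (LocalConfig d Γ) (LocalConfig d Γ) ℂ) :
    basisState σ (localObs Γ N) = N (restrict Γ σ) (restrict Γ σ) := by
  change localOp Γ N (lp.single 2 σ 1) σ = _
  rw [localOp_apply, Finset.sum_eq_single (restrict Γ σ)]
  · simp [overwrite_restrict]
  · intro τ _ hτ
    have : overwrite Γ τ σ ≠ σ := fun h => hτ (by rw [← restrict_overwrite Γ τ σ, h])
    simp [this]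
  · simp

theorem basisState_tensor (σ : Config d) (Γ : Finset Λ)
    (M : ∀ j, Matrix (Fin (d j)) (Fin (d j)) ℂ) :
    basisState σ (tensor Γ M) = ∏ j ∈ Γ, M j (σ j) (σ j) := by
  rw [← localObs_tensorMat, basisState_localObs, ← Finset.prod_coe_sort]
  rfl

theorem isState_diag {n : ℕ} (i : Fin n) :
    IsState (Matrix.entryLinearMap ℂ ℂ i i : Matrix (Fin n) (Fin n) ℂ →ₗ[ℂ] ℂ) := by
  refine ⟨fun a => ?_, by simp⟩
  rw [Matrix.entryLinearMap_apply, Matrix.mul_apply]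
  exact Finset.sum_nonneg fun j _ => star_mul_self_nonneg (a j i)

theorem isProductState_basisState (σ : Config d) : IsProductState (basisState σ) :=
  ⟨isState_basisState σ, fun j => Matrix.entryLinearMap ℂ ℂ (σ j) (σ j),
    fun j => isState_diag (σ j), basisState_tensor σ⟩

theorem IsState.apply_eq_of_projection {A : Type} [CStarAlgebra A] {F : A →ₗ[ℂ] ℂ}
    (hF : IsState F) {p : A} (hs : star p = p) (hp : p * p = p) (h1 : F p = 1) (x : A) :
    F (p * x * p) = F x := by
  have hq : star (1 - p) * (1 - p) = 1 - p := by
    rw [star_sub, star_one, hs, mul_sub, sub_mul, sub_mul, hp]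
    simp
  have hq0 : F (star (1 - p) * (1 - p)) = 0 := by rw [hq, map_sub, hF.2, h1, sub_self]
  have key : ∀ y, F (star (1 - p) * y) = 0 := fun y => by
    have := norm_apply_star_mul_le hF.1 (1 - p) y
    rw [hq0, Complex.zero_re, zero_mul] at this
    simpa using this
  have key' : ∀ y, F (y * (1 - p)) = 0 := fun y => by
    have := apply_star hF.1 (star (1 - p) * star y)
    rw [key, star_zero, star_mul, star_star, star_star] at this
    exact this
  have e1 := key (x * p)
  have e2 := key' x
  rw [star_sub, star_one, hs, sub_mul, one_mul, map_sub, sub_eq_zero, ← mul_assoc] at e1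
  rw [mul_sub, mul_one, map_sub, sub_eq_zero] at e2
  rw [e2, e1]

theorem isPure_basisState (σ : Config d) : IsPure (basisState σ) := by
  refine isPure_iff.2 ⟨isState_basisState σ, fun F G hF hG a b ha hb hab hφ => ?_⟩
  refine hF.ext_tensor (isState_basisState σ) fun Γ M => ?_
  set p : Observables d := tensor Γ fun j => Matrix.single (σ j) (σ j) 1 with hp
  have hs : star p = p := by
    rw [hp, star_tensor]
    simp_rw [star_single_one]
  have hpp : p * p = p := by
    rw [hp, tensor_mul]
    simp_rw [Matrix.single_mul_single_same, mul_one]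
  have h1 : basisState σ p = 1 := by
    rw [hp, basisState_tensor]
    simp
  have hle : ∀ {F : Observables d →ₗ[ℂ] ℂ}, IsState F → (F p).im = 0 ∧ (F p).re ≤ 1 :=
    fun {F} hF => by
      have e1 := Complex.nonneg_iff.1 (hF.1 p)
      have e2 := Complex.nonneg_iff.1 (hF.1 (1 - p))
      have hq : star (1 - p) * (1 - p) = 1 - p := by
        rw [star_sub, star_one, hs, mul_sub, sub_mul, sub_mul, hpp]
        simp
      rw [hs, hpp] at e1
      rw [hq, map_sub, hF.2, Complex.sub_re, Complex.one_re] at e2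
      exact ⟨e1.2.symm, by linarith [e2.1]⟩
  have hFp : F p = 1 := by
    have h2 := congrArg Complex.re (hφ p)
    rw [h1, Complex.one_re, Complex.add_re, Complex.re_ofReal_mul, Complex.re_ofReal_mul] at h2
    refine Complex.ext ?_ (hle hF).1
    rw [Complex.one_re]
    refine le_antisymm (hle hF).2 ?_
    nlinarith [(hle hF).2, (hle hG).2]
  have hcompress : p * tensor Γ M * p = basisState σ (tensor Γ M) • p := by
    rw [basisState_tensor, hp]
    clear hp hs hpp h1 hle hFp
    clear p
    rw [tensor_mul, tensor_mul]
    simp_rw [Matrix.single_mul_mul_single, one_mul, mul_one]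
    induction Γ using Finset.induction_on with
    | empty => simp [tensor_empty]
    | insert i Γ hi ih =>
      rw [tensor_insert i Γ hi, tensor_insert i Γ hi, ih, Finset.prod_insert hi]
      have : Matrix.single (σ i) (σ i) (M i (σ i) (σ i)) =
          M i (σ i) (σ i) • Matrix.single (σ i) (σ i) (1 : ℂ) := by simp
      rw [this, map_smul, smul_mul_smul_comm]
  rw [← hF.apply_eq_of_projection hs hpp hFp, hcompress, map_smul, hFp, smul_eq_mul, mul_one]

end BasisStates

/-! ### Relabelling of sites -/

section Relabelling

variable {Λ Λ' Λ'' : Type} {d : Λ → ℕ} {d' : Λ' → ℕ} {d'' : Λ'' → ℕ}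

/-- A matrix at the site `e j`, regarded as a matrix at the site `j` of the same dimension. -/
def castMat {n n' : ℕ} (h : n = n') (m : Matrix (Fin n') (Fin n') ℂ) : Matrix (Fin n) (Fin n) ℂ :=
  m.submatrix (Fin.cast h) (Fin.cast h)

/-- Pull back of a family of matrices along a dimension-preserving map of sites. -/
def castFamily (e : Λ → Λ') (hd : ∀ j, d j = d' (e j))
    (M : ∀ k, Matrix (Fin (d' k)) (Fin (d' k)) ℂ) : ∀ j, Matrix (Fin (d j)) (Fin (d j)) ℂ :=
  fun j => castMat (hd j) (M (e j))

theorem exists_relabelling [Nonempty (Config d')] (e : Λ ≃ Λ') (hd : ∀ j, d j = d' (e j)) :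
    ∃ F : Observables d ≃⋆ₐ[ℂ] Observables d',
      (∀ Γ M, F (tensor Γ (castFamily e hd M)) = tensor (Γ.map e.toEmbedding) M) ∧
      ∀ j m, F (site j (castMat (hd j) m)) = site (e j) m := by
  obtain rfl : d = d' ∘ e := funext hd
  have hne : Nonempty (Config (d' ∘ e)) := ⟨fun j => Classical.arbitrary (Config d') (e j)⟩
  let F := mapHom (d' := d') e.toEmbedding
  have hF : ∀ j (m : Matrix (Fin (d' (e j))) (Fin (d' (e j))) ℂ),
      F (site (d := d' ∘ e) j m) = site (e j) m := fun j m =>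
    mapHom_site (d' := d') e.toEmbedding j m
  -- Matrix algebras are simple, so `F` is isometric on local observables.
  have hnorm : ∀ x, ‖F x‖ = ‖x‖ := fun x => by
    have hFc := starAlgHom_continuous F
    refine (dense_tensorSpan (d := d' ∘ e)).induction (P := fun x => ‖F x‖ = ‖x‖)
      (fun x hx => ?_) (isClosed_eq (by fun_prop) (by fun_prop)) x
    obtain ⟨Γ, -, hΓ⟩ := tensorSpan_induction hx
    obtain ⟨N, rfl⟩ := hΓ Γ subset_rfl
    rw [norm_localObs]
    refine NonUnitalStarAlgHom.norm_map (F.comp (localObs Γ)) ?_ N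
    exact RingHom.injective (F.comp (localObs (d := d' ∘ e) Γ)).toAlgHom.toRingHom
  have hiso : Isometry F := AddMonoidHomClass.isometry_of_norm F hnorm
  have hinj := hiso.injective
  have hsurj : Function.Surjective F := by
    intro y
    have hcl : IsClosed (Set.range F) := hiso.isClosedEmbedding.isClosed_range
    refine observables_induction (p := fun y => y ∈ Set.range F) (fun Γ M => ?_) ⟨0, map_zero F⟩ ?_
      ?_ hcl y
    · refine ⟨tensor (d := d' ∘ e) (Γ.map e.symm.toEmbedding) fun j => M (e j), ?_⟩
      have := mapHom_tensor (d' := d') e.toEmbedding (Γ.map e.symm.toEmbedding) M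
      rw [Finset.map_map] at this
      refine this.trans (congrArg (fun Γ => tensor Γ M) ?_)
      ext j
      simp
    · rintro _ _ ⟨x, rfl⟩ ⟨y, rfl⟩
      exact ⟨x + y, map_add F x y⟩
    · rintro c _ ⟨x, rfl⟩
      exact ⟨c • x, map_smul F c x⟩
  refine ⟨StarAlgEquiv.ofBijective F ⟨hinj, hsurj⟩, fun Γ M => ?_, fun j m => ?_⟩
  · exact mapHom_tensor (d' := d') e.toEmbedding Γ M
  · exact hF j m

/-- The functional `ω` corresponds to `ω'` under a bijection of sites. -/
def TransportsTo (e : Λ ≃ Λ') (hd : ∀ j, d j = d' (e j)) (ω : Observables d →ₗ[ℂ] ℂ)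
    (ω' : Observables d' →ₗ[ℂ] ℂ) : Prop :=
  ∀ Γ M, ω (tensor Γ (castFamily e hd M)) = ω' (tensor (Γ.map e.toEmbedding) M)

theorem TransportsTo.eq_comp {e : Λ ≃ Λ'} {hd : ∀ j, d j = d' (e j)} {ω : Observables d →ₗ[ℂ] ℂ}
    {ω' : Observables d' →ₗ[ℂ] ℂ} (h : TransportsTo e hd ω ω') (hω : IsState ω) (hω' : IsState ω')
    (F : Observables d ≃⋆ₐ[ℂ] Observables d')
    (hF : ∀ Γ M, F (tensor Γ (castFamily e hd M)) = tensor (Γ.map e.toEmbedding) M)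
    (x : Observables d) : ω x = ω' (F x) := by
  have hstate := hω'.comp (F : Observables d →⋆ₐ[ℂ] Observables d')
  have := hω.ext_tensor hstate fun Γ M => by
    obtain ⟨M', rfl⟩ : ∃ M', M = castFamily e hd M' := by
      obtain rfl : d = d' ∘ e := funext hd
      obtain ⟨M', hM'⟩ := exists_family (d' := d') e.toEmbedding M
      exact ⟨M', funext fun j => (hM' j).symm⟩
    rw [h]
    exact congrArg ω' (hF Γ M').symm
  exact LinearMap.congr_fun this x

end Relabelling

end

/-! ### The monoid of isomorphism classes of spin systems with a state -/

section

section Cast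

variable {Λ Λ' Λ'' : Type} {d : Λ → ℕ} {d' : Λ' → ℕ} {d'' : Λ'' → ℕ}

theorem castMat_family (M : ∀ k, Matrix (Fin (d k)) (Fin (d k)) ℂ) {j k : Λ} (h : j = k)
    (hd : d j = d k) : castMat hd (M k) = M j := by
  subst h
  rfl

theorem exists_castFamily (e : Λ ≃ Λ') (hd : ∀ j, d j = d' (e j))
    (M : ∀ j, Matrix (Fin (d j)) (Fin (d j)) ℂ) : ∃ M', M = castFamily e hd M' := by
  obtain rfl : d = d' ∘ e := funext hd
  obtain ⟨M', hM'⟩ := exists_family (d' := d') e.toEmbedding M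
  exact ⟨M', funext fun j => (hM' j).symm⟩

end Cast

section FinsetSum

variable {α β γ α' β' : Type}

theorem toLeft_map_sumCongr (e : α ≃ α') (e' : β ≃ β') (Γ : Finset (α ⊕ β)) :
    Γ.toLeft.map e.toEmbedding = (Γ.map (Equiv.sumCongr e e').toEmbedding).toLeft := by
  ext j
  simp

theorem toRight_map_sumCongr (e : α ≃ α') (e' : β ≃ β') (Γ : Finset (α ⊕ β)) :
    Γ.toRight.map e'.toEmbedding = (Γ.map (Equiv.sumCongr e e').toEmbedding).toRight := by
  ext j
  simp

theorem toLeft_map_sumComm (Γ : Finset (α ⊕ β)) :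
    Γ.toRight = (Γ.map (Equiv.sumComm α β).toEmbedding).toLeft := by
  ext j
  simp

theorem toRight_map_sumComm (Γ : Finset (α ⊕ β)) :
    Γ.toLeft = (Γ.map (Equiv.sumComm α β).toEmbedding).toRight := by
  ext j
  simp

theorem toLeft_map_sumAssoc (Γ : Finset ((α ⊕ β) ⊕ γ)) :
    Γ.toLeft.toLeft = (Γ.map (Equiv.sumAssoc α β γ).toEmbedding).toLeft := by
  ext j
  simp

theorem toRight_toLeft_map_sumAssoc (Γ : Finset ((α ⊕ β) ⊕ γ)) :
    Γ.toLeft.toRight = (Γ.map (Equiv.sumAssoc α β γ).toEmbedding).toRight.toLeft := by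
  ext j
  simp

theorem toRight_toRight_map_sumAssoc (Γ : Finset ((α ⊕ β) ⊕ γ)) :
    Γ.toRight = (Γ.map (Equiv.sumAssoc α β γ).toEmbedding).toRight.toRight := by
  ext j
  simp

theorem toRight_eq_map_emptySum (Γ : Finset (Empty ⊕ α)) :
    Γ.toRight = Γ.map (Equiv.emptySum Empty α).toEmbedding := by
  ext j
  simp

end FinsetSum

/-- A spin system together with a state on it. -/
structure LocatedState where
  /-- the spin system -/
  sys : SpinSystem
  /-- the state -/
  state : sys.Functional
  isState : IsState state

namespace LocatedState

/-- Isomorphism of spin systems with a state. -/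
def Equivalent (X Y : LocatedState) : Prop :=
  ∃ e : X.sys.Iso Y.sys, TransportsTo e.siteEquiv e.dim_eq X.state Y.state

theorem Equivalent.refl (X : LocatedState) : X.Equivalent X :=
  ⟨⟨Equiv.refl _, fun _ => rfl, fun _ => rfl⟩, fun Γ M => by
    rw [show Γ.map (Equiv.refl X.sys.Site).toEmbedding = Γ from Finset.map_refl]
    rfl⟩

theorem Equivalent.symm {X Y : LocatedState} (h : X.Equivalent Y) : Y.Equivalent X := by
  obtain ⟨e, he⟩ := h
  refine ⟨⟨e.siteEquiv.symm, fun j => ?_, fun j => ?_⟩, fun Γ M => ?_⟩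
  · rw [e.loc_eq, Equiv.apply_symm_apply]
  · rw [e.dim_eq, Equiv.apply_symm_apply]
  · obtain ⟨M', rfl⟩ := exists_castFamily e.siteEquiv e.dim_eq M
    rw [he, Finset.map_map]
    have h1 : Γ.map (e.siteEquiv.symm.toEmbedding.trans e.siteEquiv.toEmbedding) = Γ := by
      ext j
      simp
    rw [h1]
    refine congrArg (fun M => Y.state (tensor Γ M)) (funext fun k => ?_)
    exact castMat_family M' (e.siteEquiv.apply_symm_apply k).symm
      (congrArg Y.sys.dim (e.siteEquiv.apply_symm_apply k).symm)

theorem Equivalent.trans {X Y Z : LocatedState} (h : X.Equivalent Y) (h' : Y.Equivalent Z) :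
    X.Equivalent Z := by
  obtain ⟨e, he⟩ := h
  obtain ⟨e', he'⟩ := h'
  refine ⟨⟨e.siteEquiv.trans e'.siteEquiv, fun j => (e.loc_eq j).trans (e'.loc_eq _),
    fun j => (e.dim_eq j).trans (e'.dim_eq _)⟩, fun Γ M => ?_⟩
  refine (he Γ (castFamily e'.siteEquiv e'.dim_eq M)).trans ((he' _ M).trans ?_)
  rw [Finset.map_map]
  rfl

/-- The stack of two spin systems with the tensor product of two states. -/
def mul (X Y : LocatedState) : LocatedState where
  sys := X.sys.stack Y.sys
  state := (exists_isTensorState X.isState Y.isState).choose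
  isState := (exists_isTensorState X.isState Y.isState).choose_spec.1

theorem isTensorState_mul (X Y : LocatedState) :
    IsTensorState X.state Y.state (X.mul Y).state :=
  (exists_isTensorState X.isState Y.isState).choose_spec.2

/-- The spin system without sites. -/
def one : LocatedState where
  sys := ⟨Empty, Empty.elim, Empty.elim, fun _ _ => Set.toFinite _⟩
  state := basisState fun j => j.elim
  isState := isState_basisState _

theorem Equivalent.mul {X X' Y Y' : LocatedState} (h : X.Equivalent X') (h' : Y.Equivalent Y') :
    (X.mul Y).Equivalent (X'.mul Y') := by
  obtain ⟨e, he⟩ := h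
  obtain ⟨e', he'⟩ := h'
  refine ⟨⟨Equiv.sumCongr e.siteEquiv e'.siteEquiv, ?_, ?_⟩, fun Γ M => ?_⟩
  · rintro (j | j)
    exacts [e.loc_eq j, e'.loc_eq j]
  · rintro (j | j)
    exacts [e.dim_eq j, e'.dim_eq j]
  refine (isTensorState_mul X Y Γ _).trans (Eq.trans ?_ (isTensorState_mul X' Y' _ M).symm)
  exact congrArg₂ (· * ·)
    ((he _ (leftFamily M)).trans (congrArg (fun Γ => X'.state (tensor Γ (leftFamily M)))
      (toLeft_map_sumCongr _ _ Γ)))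
    ((he' _ (rightFamily M)).trans (congrArg (fun Γ => Y'.state (tensor Γ (rightFamily M)))
      (toRight_map_sumCongr _ _ Γ)))

theorem mul_comm_equivalent (X Y : LocatedState) : (X.mul Y).Equivalent (Y.mul X) := by
  refine ⟨⟨Equiv.sumComm _ _, ?_, ?_⟩, fun Γ M => ?_⟩
  · rintro (j | j) <;> rfl
  · rintro (j | j) <;> rfl
  refine (isTensorState_mul X Y Γ _).trans (Eq.trans ?_ (isTensorState_mul Y X _ M).symm)
  rw [mul_comm]
  exact congrArg₂ (· * ·)
    (congrArg (fun Γ => Y.state (tensor Γ (leftFamily M))) (toLeft_map_sumComm Γ))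
    (congrArg (fun Γ => X.state (tensor Γ (rightFamily M))) (toRight_map_sumComm Γ))

theorem mul_assoc_equivalent (X Y Z : LocatedState) :
    ((X.mul Y).mul Z).Equivalent (X.mul (Y.mul Z)) := by
  refine ⟨⟨Equiv.sumAssoc _ _ _, ?_, ?_⟩, fun Γ M => ?_⟩
  · rintro ((j | j) | j) <;> rfl
  · rintro ((j | j) | j) <;> rfl
  refine (isTensorState_mul (X.mul Y) Z Γ _).trans
    (Eq.trans ?_ (isTensorState_mul X (Y.mul Z) _ M).symm)
  refine (congrArg (· * _) (isTensorState_mul X Y _ _)).trans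
    (Eq.trans ?_ (congrArg (_ * ·) (isTensorState_mul Y Z _ _)).symm)
  rw [mul_assoc]
  exact congrArg₂ (· * ·)
    (congrArg (fun Γ => X.state (tensor Γ (leftFamily M))) (toLeft_map_sumAssoc Γ))
    (congrArg₂ (· * ·)
      (congrArg (fun Γ => Y.state (tensor Γ (leftFamily (rightFamily M))))
        (toRight_toLeft_map_sumAssoc Γ))
      (congrArg (fun Γ => Z.state (tensor Γ (rightFamily (rightFamily M))))
        (toRight_toRight_map_sumAssoc Γ)))

theorem one_mul_equivalent (X : LocatedState) : (one.mul X).Equivalent X := by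
  refine ⟨⟨Equiv.emptySum Empty _, ?_, ?_⟩, fun Γ M => ?_⟩
  · rintro (j | j)
    exacts [j.elim, rfl]
  · rintro (j | j)
    exacts [j.elim, rfl]
  refine (isTensorState_mul one X Γ _).trans ?_
  have h1 : ∀ M, one.state (tensor (d := one.sys.dim) Γ.toLeft M) = 1 := fun M => by
    refine (basisState_tensor (d := one.sys.dim) _ _ _).trans (Finset.prod_eq_one ?_)
    rintro ⟨⟩
  refine (congrArg (· * _) (h1 _)).trans ((one_mul _).trans ?_)
  exact congrArg (fun Γ => X.state (tensor Γ M)) (toRight_eq_map_emptySum Γ)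

instance setoid : Setoid LocatedState :=
  ⟨Equivalent, Equivalent.refl, Equivalent.symm, Equivalent.trans⟩

end LocatedState

/-- Isomorphism classes of spin systems with a state. -/
def StateClass : Type 1 := Quotient LocatedState.setoid

/-- The class of a state on a spin system. -/
def stateClass (S : SpinSystem) (ψ : S.Functional) (h : IsState ψ) : StateClass :=
  Quotient.mk _ ⟨S, ψ, h⟩

theorem exists_stateClass (q : StateClass) : ∃ S ψ h, q = stateClass S ψ h := by
  induction q using Quotient.inductionOn with
  | h X => exact ⟨X.sys, X.state, X.isState, rfl⟩

instance : CommMonoid StateClass where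
  mul := Quotient.map₂ LocatedState.mul fun _ _ h _ _ h' => LocatedState.Equivalent.mul h h'
  one := Quotient.mk _ LocatedState.one
  mul_assoc := by
    rintro ⟨X⟩ ⟨Y⟩ ⟨Z⟩
    exact Quotient.sound (LocatedState.mul_assoc_equivalent X Y Z)
  mul_comm := by
    rintro ⟨X⟩ ⟨Y⟩
    exact Quotient.sound (LocatedState.mul_comm_equivalent X Y)
  one_mul := by
    rintro ⟨X⟩
    exact Quotient.sound (LocatedState.one_mul_equivalent X)
  mul_one := by
    rintro ⟨X⟩
    exact Quotient.sound ((LocatedState.mul_comm_equivalent X _).trans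
      (LocatedState.one_mul_equivalent X))

open SpinSystem

theorem isTensorState_iff {S T : SpinSystem} {ψ : S.Functional} {χ : T.Functional}
    {ω : (S.stack T).Functional} (hψ : IsState ψ) (hχ : IsState χ) (hω : IsState ω) :
    IsTensorState ψ χ ω ↔ IsTensor ψ χ ω := by
  constructor
  · intro h
    refine ⟨hψ, hχ, hω, fun Γ₁ Γ₂ M => (h (Γ₁.disjSum Γ₂) M).trans ?_⟩
    rw [Finset.toLeft_disjSum, Finset.toRight_disjSum]
    rfl
  · intro h Γ M
    have := h.2.2.2 Γ.toLeft Γ.toRight M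
    rw [Finset.toLeft_disjSum_toRight] at this
    exact this

theorem stateClass_mul {S T : SpinSystem} {ψ : S.Functional} {χ : T.Functional}
    {ω : (S.stack T).Functional} (hψ : IsState ψ) (hχ : IsState χ) (hω : IsState ω)
    (h : IsTensorState ψ χ ω) :
    stateClass (S.stack T) ω hω = stateClass S ψ hψ * stateClass T χ hχ := by
  have h' := LocatedState.isTensorState_mul ⟨S, ψ, hψ⟩ ⟨T, χ, hχ⟩
  have : ω = ((LocatedState.mk S ψ hψ).mul ⟨T, χ, hχ⟩).state :=
    hω.ext_tensor (LocatedState.isState _) fun Γ M => (h Γ M).trans (h' Γ M).symm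
  subst this
  rfl

theorem stateClass_eq_iff {S T : SpinSystem} {ψ : S.Functional} {χ : T.Functional}
    (hψ : IsState ψ) (hχ : IsState χ) :
    stateClass S ψ hψ = stateClass T χ hχ ↔ ∃ e : S.Iso T, e.Transports ψ χ :=
  Quotient.eq.trans ⟨fun ⟨e, he⟩ => ⟨e, hψ, hχ, he⟩, fun ⟨e, he⟩ => ⟨e, he.2.2⟩⟩

/-- The class of a trivial state. -/
def IsTrivialClass (q : StateClass) : Prop :=
  ∃ (S : SpinSystem) (τ : S.Functional) (h : IsState τ), IsTrivial τ ∧ q = stateClass S τ h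

theorem isTrivial_basisState {S : SpinSystem} (σ : Config S.dim) :
    IsTrivial (S := S) (basisState σ) :=
  ⟨isPure_basisState σ, isProductState_basisState σ⟩

theorem isTrivialClass_one : IsTrivialClass 1 :=
  ⟨LocatedState.one.sys, LocatedState.one.state, LocatedState.one.isState,
    isTrivial_basisState _, rfl⟩

theorem IsTrivialClass.mul {q q' : StateClass} (h : IsTrivialClass q) (h' : IsTrivialClass q') :
    IsTrivialClass (q * q') := by
  obtain ⟨S, τ, hτ, ht, rfl⟩ := h
  obtain ⟨T, τ', hτ', ht', rfl⟩ := h'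
  obtain ⟨ω, hω, h⟩ := exists_isTensorState hτ hτ'
  exact ⟨S.stack T, ω, hω, ⟨h.isPure ht.1 ht'.1 hω, h.isProductState ht.2 ht'.2 hω⟩,
    (stateClass_mul hτ hτ' hω h).symm⟩

theorem isTrivialExtension_iff {S R : SpinSystem} {ψ : S.Functional} {ω : R.Functional}
    (hψ : IsState ψ) (hω : IsState ω) :
    IsTrivialExtension ψ ω ↔
      ∃ q, IsTrivialClass q ∧ stateClass R ω hω = stateClass S ψ hψ * q := by
  constructor
  · rintro ⟨T, τ, ω', e, hτ, ht, he⟩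
    refine ⟨stateClass T τ ht.2.1, ⟨T, τ, _, hτ, rfl⟩, ?_⟩
    rw [← stateClass_mul hψ ht.2.1 ht.2.2.1 ((isTensorState_iff hψ ht.2.1 ht.2.2.1).2 ht)]
    exact ((stateClass_eq_iff _ _).2 ⟨e, he⟩).symm
  · rintro ⟨_, ⟨T, τ, hτ, ht, rfl⟩, hq⟩
    obtain ⟨ω', hω', h⟩ := exists_isTensorState hψ hτ
    rw [← stateClass_mul hψ hτ hω' h] at hq
    obtain ⟨e, he⟩ := (stateClass_eq_iff hω' hω).1 hq.symm
    exact ⟨T, τ, ω', e, ht, (isTensorState_iff hψ hτ hω').1 h, he⟩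

theorem IsTrivialExtension.isState {S R : SpinSystem} {ψ : S.Functional} {ω : R.Functional}
    (h : IsTrivialExtension ψ ω) : IsState ω := by
  obtain ⟨T, τ, ω', e, hτ, ht, he⟩ := h
  exact he.2.1

end

/-! ### Automorphisms -/

section Automorphisms

variable {Λ Λ' : Type} {d : Λ → ℕ} {d' : Λ' → ℕ}

/-- The automorphism `α` acts trivially on all the sites outside `P`. -/
def SupportedOn (P : Set Λ) (α : Observables d ≃⋆ₐ[ℂ] Observables d) : Prop :=
  ∀ j ∉ P, ∀ m, α (site j m) = site j m

theorem SupportedOn.mono {P Q : Set Λ} (h : P ⊆ Q) {α : Observables d ≃⋆ₐ[ℂ] Observables d}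
    (hα : SupportedOn P α) : SupportedOn Q α := fun j hj => hα j fun hP => hj (h hP)

theorem SupportedOn.one (P : Set Λ) :
    SupportedOn P (1 : Observables d ≃⋆ₐ[ℂ] Observables d) := fun _ _ _ => rfl

theorem SupportedOn.mul {P : Set Λ} {α β : Observables d ≃⋆ₐ[ℂ] Observables d}
    (hα : SupportedOn P α) (hβ : SupportedOn P β) : SupportedOn P (α * β) := fun j hj m => by
  rw [StarAlgEquiv.mul_apply, hβ j hj, hα j hj]

theorem SupportedOn.inv {P : Set Λ} {α : Observables d ≃⋆ₐ[ℂ] Observables d}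
    (hα : SupportedOn P α) : SupportedOn P α⁻¹ := fun j hj m => by
  conv_lhs => rw [← hα j hj m]
  exact α.symm_apply_apply _

theorem SupportedOn.list_prod {P : Set Λ} {L : List (Observables d ≃⋆ₐ[ℂ] Observables d)}
    (h : ∀ α ∈ L, SupportedOn P α) : SupportedOn P L.prod := by
  induction L with
  | nil => exact SupportedOn.one P
  | cons α L ih =>
    rw [List.prod_cons]
    exact (h α (by simp)).mul (ih fun β hβ => h β (by simp [hβ]))

theorem SupportedOn.commute [Nonempty (Config d)] {P Q : Set Λ} (h : Disjoint P Q)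
    {α β : Observables d ≃⋆ₐ[ℂ] Observables d} (hα : SupportedOn P α) (hβ : SupportedOn Q β) :
    Commute α β := commute_of_disjoint_supports h hα hβ

/-- Conjugation by a unitary observable. -/
def innerAut (u : unitary (Observables d)) : Observables d ≃⋆ₐ[ℂ] Observables d :=
  Unitary.conjStarAlgAut ℂ (Observables d) u

theorem innerAut_apply (u : unitary (Observables d)) (x : Observables d) :
    innerAut u x = u * x * star (u : Observables d) := rfl

theorem innerAut_mul (u v : unitary (Observables d)) : innerAut (u * v) = innerAut u * innerAut v :=
  map_mul (Unitary.conjStarAlgAut ℂ (Observables d)) u v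

theorem innerAut_one : innerAut (1 : unitary (Observables d)) = 1 :=
  map_one (Unitary.conjStarAlgAut ℂ (Observables d))

theorem innerAut_inv (u : unitary (Observables d)) : (innerAut u)⁻¹ = innerAut u⁻¹ :=
  (map_inv (Unitary.conjStarAlgAut ℂ (Observables d)) u).symm

/-- The image of a unitary under a `*`-homomorphism. -/
def unitaryMap {A B : Type} [CStarAlgebra A] [CStarAlgebra B] (F : A →⋆ₐ[ℂ] B) (u : unitary A) :
    unitary B :=
  ⟨F u, by
    rw [Unitary.mem_iff, ← map_star, ← map_mul, ← map_mul, Unitary.star_mul_self_of_mem u.2,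
      Unitary.mul_star_self_of_mem u.2, map_one]
    exact ⟨rfl, rfl⟩⟩

/-- Inner automorphisms form a normal subgroup. -/
theorem innerAut_mul_comm (α : Observables d ≃⋆ₐ[ℂ] Observables d) (u : unitary (Observables d)) :
    ∃ v, innerAut u * α = α * innerAut v := by
  let F : Observables d →⋆ₐ[ℂ] Observables d := (α⁻¹ : Observables d ≃⋆ₐ[ℂ] Observables d)
  have hF : ∀ x, α (F x) = x := fun x => α.apply_symm_apply x
  refine ⟨unitaryMap F u, StarAlgEquiv.ext fun x => ?_⟩
  change (u : Observables d) * α x * star (u : Observables d) = α (F u * x * star (F u))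
  rw [map_mul, map_mul, ← map_star, hF, hF]

variable [Nonempty (Config (Sum.elim d d'))]

/-- The homomorphism `α ⊗ β` of a stack. -/
def stackMapHom (α : Observables d →⋆ₐ[ℂ] Observables d)
    (β : Observables d' →⋆ₐ[ℂ] Observables d') :
    Observables (Sum.elim d d') →⋆ₐ[ℂ] Observables (Sum.elim d d') :=
  stackHom ((inlHom d d').comp α) ((inrHom d d').comp β) fun x y => commute_inlHom_inrHom (α x) (β y)

theorem stackMapHom_inlHom (α : Observables d →⋆ₐ[ℂ] Observables d)
    (β : Observables d' →⋆ₐ[ℂ] Observables d') (x : Observables d) :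
    stackMapHom α β (inlHom d d' x) = inlHom d d' (α x) := by
  have : (stackMapHom α β).comp (inlHom d d') = (inlHom d d').comp α :=
    starAlgHom_ext fun j m => by
      change stackMapHom α β (inlHom d d' (site j m)) = inlHom d d' (α (site j m))
      rw [inlHom_site]
      exact stackHom_siteL _ _ _ j m
  exact DFunLike.congr_fun this x

theorem stackMapHom_inrHom (α : Observables d →⋆ₐ[ℂ] Observables d)
    (β : Observables d' →⋆ₐ[ℂ] Observables d') (x : Observables d') :
    stackMapHom α β (inrHom d d' x) = inrHom d d' (β x) := by
  have : (stackMapHom α β).comp (inrHom d d') = (inrHom d d').comp β :=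
    starAlgHom_ext fun j m => by
      change stackMapHom α β (inrHom d d' (site j m)) = inrHom d d' (β (site j m))
      rw [inrHom_site]
      exact stackHom_siteR _ _ _ j m
  exact DFunLike.congr_fun this x

theorem stack_ext' {B : Type} [CStarAlgebra B] {F G : Observables (Sum.elim d d') →⋆ₐ[ℂ] B}
    (hl : ∀ x, F (inlHom d d' x) = G (inlHom d d' x))
    (hr : ∀ x, F (inrHom d d' x) = G (inrHom d d' x)) : F = G :=
  stack_ext (fun j m => by rw [← inlHom_site, hl]) fun j m => by rw [← inrHom_site, hr]

theorem stackMapHom_comp (α α' : Observables d →⋆ₐ[ℂ] Observables d)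
    (β β' : Observables d' →⋆ₐ[ℂ] Observables d') :
    (stackMapHom α β).comp (stackMapHom α' β') = stackMapHom (α.comp α') (β.comp β') := by
  refine stack_ext' (fun x => ?_) fun x => ?_
  · change stackMapHom α β (stackMapHom α' β' _) = _
    rw [stackMapHom_inlHom, stackMapHom_inlHom, stackMapHom_inlHom]
    rfl
  · change stackMapHom α β (stackMapHom α' β' _) = _
    rw [stackMapHom_inrHom, stackMapHom_inrHom, stackMapHom_inrHom]
    rfl

theorem stackMapHom_id :
    stackMapHom (StarAlgHom.id ℂ (Observables d)) (StarAlgHom.id ℂ (Observables d')) =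
      StarAlgHom.id ℂ _ :=
  stack_ext' (fun x => stackMapHom_inlHom _ _ x) fun x => stackMapHom_inrHom _ _ x

variable (d d') in
/-- The automorphism `α ⊗ β` of a stack. -/
def stackAut : (Observables d ≃⋆ₐ[ℂ] Observables d) × (Observables d' ≃⋆ₐ[ℂ] Observables d') →*
    (Observables (Sum.elim d d') ≃⋆ₐ[ℂ] Observables (Sum.elim d d')) where
  toFun p := StarAlgEquiv.ofStarAlgHom
    (stackMapHom (p.1 : Observables d →⋆ₐ[ℂ] Observables d)
      (p.2 : Observables d' →⋆ₐ[ℂ] Observables d'))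
    (stackMapHom (p.1.symm : Observables d →⋆ₐ[ℂ] Observables d)
      (p.2.symm : Observables d' →⋆ₐ[ℂ] Observables d'))
    (by
      rw [stackMapHom_comp, ← stackMapHom_id]
      exact congrArg₂ _ (StarAlgHom.ext fun x => p.1.symm_apply_apply x)
        (StarAlgHom.ext fun x => p.2.symm_apply_apply x))
    (by
      rw [stackMapHom_comp, ← stackMapHom_id]
      exact congrArg₂ _ (StarAlgHom.ext fun x => p.1.apply_symm_apply x)
        (StarAlgHom.ext fun x => p.2.apply_symm_apply x))
  map_one' := StarAlgEquiv.ext fun x =>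
    DFunLike.congr_fun (stackMapHom_id (d := d) (d' := d')) x
  map_mul' p q := StarAlgEquiv.ext fun x => DFunLike.congr_fun
    (stackMapHom_comp (p.1 : Observables d →⋆ₐ[ℂ] Observables d)
      (q.1 : Observables d →⋆ₐ[ℂ] Observables d) (p.2 : Observables d' →⋆ₐ[ℂ] Observables d')
      (q.2 : Observables d' →⋆ₐ[ℂ] Observables d')).symm x

theorem stackAut_inlHom (p : (Observables d ≃⋆ₐ[ℂ] Observables d) ×
    (Observables d' ≃⋆ₐ[ℂ] Observables d')) (x : Observables d) :
    stackAut d d' p (inlHom d d' x) = inlHom d d' (p.1 x) := stackMapHom_inlHom _ _ x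

theorem stackAut_inrHom (p : (Observables d ≃⋆ₐ[ℂ] Observables d) ×
    (Observables d' ≃⋆ₐ[ℂ] Observables d')) (x : Observables d') :
    stackAut d d' p (inrHom d d' x) = inrHom d d' (p.2 x) := stackMapHom_inrHom _ _ x

theorem stackAut_innerAut (u : unitary (Observables d)) (v : unitary (Observables d')) :
    stackAut d d' (innerAut u, innerAut v) =
      innerAut (unitaryMap (inlHom d d') u * unitaryMap (inrHom d d') v) := by
  have hl : ∀ x, innerAut (unitaryMap (inlHom d d') u) (inlHom d d' x) =
      inlHom d d' (innerAut u x) := fun x => by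
    rw [innerAut_apply, innerAut_apply, map_mul, map_mul, map_star]
    rfl
  have hr : ∀ x, innerAut (unitaryMap (inrHom d d') v) (inrHom d d' x) =
      inrHom d d' (innerAut v x) := fun x => by
    rw [innerAut_apply, innerAut_apply, map_mul, map_mul, map_star]
    rfl
  have hlr : ∀ x, innerAut (unitaryMap (inlHom d d') u) (inrHom d d' x) = inrHom d d' x :=
    fun x => by
    rw [innerAut_apply]
    change inlHom d d' (u : Observables d) * _ * star (inlHom d d' (u : Observables d)) = _
    rw [(commute_inlHom_inrHom _ _).eq, mul_assoc, ← map_star, ← map_mul,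
      Unitary.mul_star_self_of_mem u.2, map_one, mul_one]
  have hrl : ∀ x, innerAut (unitaryMap (inrHom d d') v) (inlHom d d' x) = inlHom d d' x :=
    fun x => by
    rw [innerAut_apply]
    change inrHom d d' (v : Observables d') * _ * star (inrHom d d' (v : Observables d')) = _
    rw [(commute_inlHom_inrHom _ _).symm.eq, mul_assoc, ← map_star, ← map_mul,
      Unitary.mul_star_self_of_mem v.2, map_one, mul_one]
  have key : ∀ F G : Observables (Sum.elim d d') ≃⋆ₐ[ℂ] Observables (Sum.elim d d'),
      (∀ x, F (inlHom d d' x) = G (inlHom d d' x)) →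
      (∀ x, F (inrHom d d' x) = G (inrHom d d' x)) → F = G := fun F G h1 h2 =>
    StarAlgEquiv.ext fun x => DFunLike.congr_fun (stack_ext'
      (F := (F : Observables (Sum.elim d d') →⋆ₐ[ℂ] Observables (Sum.elim d d')))
      (G := (G : Observables (Sum.elim d d') →⋆ₐ[ℂ] Observables (Sum.elim d d'))) h1 h2) x
  refine key _ _ (fun x => ?_) fun x => ?_
  · rw [stackAut_inlHom, innerAut_mul, StarAlgEquiv.mul_apply, hrl, hl]
  · rw [stackAut_inrHom, innerAut_mul, StarAlgEquiv.mul_apply, hr, hlr]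

theorem stackAut_supportedOn {P : Set Λ} {Q : Set Λ'} {α : Observables d ≃⋆ₐ[ℂ] Observables d}
    {β : Observables d' ≃⋆ₐ[ℂ] Observables d'} (hα : SupportedOn P α) (hβ : SupportedOn Q β)
    {T : Set (Λ ⊕ Λ')} (hP : ∀ j ∈ P, Sum.inl j ∈ T) (hQ : ∀ j ∈ Q, Sum.inr j ∈ T) :
    SupportedOn T (stackAut d d' (α, β)) := by
  rintro (j | j) hj m
  · have h : ∀ m, stackAut d d' (α, β) (siteL d' j m) = siteL d' j m := fun m => by
      rw [← inlHom_site, stackAut_inlHom]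
      exact congrArg _ (hα j (fun h => hj (hP j h)) m)
    exact h m
  · have h : ∀ m, stackAut d d' (α, β) (siteR d j m) = siteR d j m := fun m => by
      rw [← inrHom_site, stackAut_inrHom]
      exact congrArg _ (hβ j (fun h => hj (hQ j h)) m)
    exact h m

end Automorphisms

/-! ### Circuits -/

section ListProducts

variable {ι κ M : Type} [Monoid M]

theorem commute_list_prod {L : List ι} {f : ι → M} {a : M} (h : ∀ i ∈ L, Commute a (f i)) :
    Commute a (L.map f).prod :=
  Commute.list_prod_right _ _ (by simpa using h)

/-- The factors that satisfy `P` can be moved to the front if they commute with those factors before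
them that do not. -/
theorem prod_eq_filter_mul_filter (P : ι → Prop) (f : ι → M) (L : List ι)
    (h : L.Pairwise fun i j => ¬ P i → P j → Commute (f i) (f j)) :
    (L.map f).prod = ((L.filter (P ·)).map f).prod * ((L.filter (¬ P ·)).map f).prod := by
  induction L with
  | nil => simp
  | cons i L ih =>
    rw [List.pairwise_cons] at h
    rw [List.map_cons, List.prod_cons, ih h.2]
    by_cases hi : P i
    · rw [List.filter_cons_of_pos (by simpa using hi), List.filter_cons_of_neg (by simpa using hi),
        List.map_cons, List.prod_cons, mul_assoc]
    · rw [List.filter_cons_of_neg (by simpa using hi), List.filter_cons_of_pos (by simpa using hi),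
        List.map_cons, List.prod_cons, ← mul_assoc, ← mul_assoc]
      congr 1
      refine (commute_list_prod fun j hj => ?_).eq
      rw [List.mem_filter] at hj
      exact h.1 j hj.1 hi (by simpa using hj.2)

/-- A product of factors that commute unless they carry the same label can be sorted by labels. -/
theorem prod_eq_prod_labels (label : ι → κ) (f : ι → M) (ks : List κ) (hk : ks.Nodup) (L : List ι)
    (hmem : ∀ i ∈ L, label i ∈ ks)
    (h : L.Pairwise fun i j => label i ≠ label j → Commute (f i) (f j)) :
    (L.map f).prod = (ks.map fun k => ((L.filter (label · = k)).map f).prod).prod := by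
  induction ks generalizing L with
  | nil =>
    obtain rfl : L = [] := List.eq_nil_iff_forall_not_mem.2 fun i hi => by simpa using hmem i hi
    simp
  | cons k ks ih =>
    rw [List.nodup_cons] at hk
    rw [prod_eq_filter_mul_filter (label · = k) f L (h.imp fun {i j} hij hi hj => hij fun e => hi
      (e.trans hj)), List.map_cons, List.prod_cons]
    congr 1
    rw [ih hk.2 (L.filter (¬ label · = k)) (fun i hi => ?_) (h.filter _)]
    · refine congrArg List.prod (List.map_congr_left fun k' hk' => ?_)
      rw [List.filter_filter]
      refine congrArg (fun L => (List.map f L).prod) (List.filter_congr fun i _ => ?_)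
      have : k' ≠ k := fun e => hk.1 (e ▸ hk')
      by_cases hi : label i = k'
      · simp [hi, this]
      · simp [hi]
    · rw [List.mem_filter] at hi
      exact (List.mem_cons.1 (hmem i hi.1)).resolve_left (by simpa using hi.2)

end ListProducts

theorem cone_mono {p : ℂ} {I J : Set Circle} (h : I ⊆ J) : cone p I ⊆ cone p J := by
  rintro _ ⟨r, hr, ζ, hζ, rfl⟩
  exact ⟨r, hr, ζ, h hζ, rfl⟩

theorem cone_disjoint {p : ℂ} {I J : Set Circle} (h : Disjoint I J) :
    Disjoint (cone p I) (cone p J) := by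
  rw [Set.disjoint_left] at h ⊢
  rintro _ ⟨r, hr, ζ, hζ, rfl⟩ ⟨r', hr', ζ', hζ', e⟩
  have e1 : (r : ℂ) * ζ = r' * ζ' := add_left_cancel e
  have e2 := congrArg norm e1
  rw [norm_mul, norm_mul, Circle.norm_coe, Circle.norm_coe, mul_one, mul_one, Complex.norm_real,
    Complex.norm_real, Real.norm_of_nonneg hr.le, Real.norm_of_nonneg hr'.le] at e2
  subst e2
  have : ζ = ζ' := Subtype.ext (mul_left_cancel₀ (by exact_mod_cast hr.ne') e1)
  exact h hζ (this ▸ hζ')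

/-- A gate of a circuit: an automorphism, together with the layer it belongs to and the direction
around which it is supported. -/
structure Gate (S : SpinSystem) where
  /-- the layer -/
  layer : ℕ
  /-- the direction -/
  center : Circle
  /-- the automorphism -/
  aut : S.Aut

/-- The automorphism `α` is, up to an inner automorphism, a product of gates supported in cones with
apex `p` whose bases are balls of radius `ε`. The gates form `m` layers, and gates in the wrong order
commute. -/
def IsCircuit {S : SpinSystem} (p : ℂ) (ε : ℝ) (m : ℕ) (α : S.Aut) : Prop :=
  ∃ (L : List (Gate S)) (u : unitary S.Obs),
    (∀ g ∈ L, g.layer < m ∧ SupportedOn (S.loc ⁻¹' cone p (Metric.ball g.center ε)) g.aut) ∧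
    L.Pairwise (fun g g' => g.layer < g'.layer ∨ Commute g.aut g'.aut) ∧
    α = (L.map Gate.aut).prod * innerAut u

namespace IsCircuit

variable {S T : SpinSystem} {p : ℂ} {ε : ℝ} {m m' : ℕ}

theorem inner (u : unitary S.Obs) (m : ℕ) : IsCircuit p ε m (innerAut u : S.Aut) :=
  ⟨[], u, by simp, List.Pairwise.nil, by simp⟩

theorem one (m : ℕ) : IsCircuit p ε m (1 : S.Aut) := by
  rw [← innerAut_one]
  exact inner 1 m

theorem mul {α β : S.Aut} (hα : IsCircuit p ε m α) (hβ : IsCircuit p ε m' β) :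
    IsCircuit p ε (m + m') (α * β) := by
  obtain ⟨L, u, hL, hP, rfl⟩ := hα
  obtain ⟨L', u', hL', hP', rfl⟩ := hβ
  obtain ⟨v, hv⟩ := innerAut_mul_comm (L'.map Gate.aut).prod u
  refine ⟨L ++ L'.map fun g => ⟨m + g.layer, g.center, g.aut⟩, v * u', ?_, ?_, ?_⟩
  · intro g hg
    rcases List.mem_append.1 hg with hg | hg
    · exact ⟨(hL g hg).1.trans_le (by omega), (hL g hg).2⟩
    · obtain ⟨k, hk, rfl⟩ := List.mem_map.1 hg
      exact ⟨by simpa using (hL' k hk).1, (hL' k hk).2⟩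
  · rw [List.pairwise_append]
    refine ⟨hP, ?_, fun g hg g' hg' => ?_⟩
    · rw [List.pairwise_map]
      exact hP'.imp fun h => h.imp_left fun h => by simpa using h
    · obtain ⟨g', hg', rfl⟩ := List.mem_map.1 hg'
      exact Or.inl ((hL g hg).1.trans_le (by simp))
  · rw [List.map_append, List.prod_append, List.map_map]
    change _ = _ * (L'.map Gate.aut).prod * _
    rw [innerAut_mul, mul_assoc, ← mul_assoc (innerAut u), hv]
    simp only [mul_assoc]

theorem inv {α : S.Aut} (hα : IsCircuit p ε m α) : IsCircuit p ε m α⁻¹ := by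
  obtain ⟨L, u, hL, hP, rfl⟩ := hα
  obtain ⟨v, hv⟩ := innerAut_mul_comm (L.map Gate.aut).prod⁻¹ u⁻¹
  refine ⟨(L.map fun g => ⟨m - 1 - g.layer, g.center, g.aut⁻¹⟩).reverse, v, ?_, ?_, ?_⟩
  · intro g hg
    rw [List.mem_reverse] at hg
    obtain ⟨k, hk, rfl⟩ := List.mem_map.1 hg
    have := (hL k hk).1
    exact ⟨by change m - 1 - k.layer < m; omega, (hL k hk).2.inv⟩
  · rw [List.pairwise_reverse, List.pairwise_map]
    refine List.Pairwise.imp_of_mem (fun {g g'} hg hg' h => ?_) hP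
    have h1 := (hL g hg).1
    have h2 := (hL g' hg').1
    rcases h with h | h
    · left
      change m - 1 - g'.layer < m - 1 - g.layer
      omega
    · right
      exact h.symm.inv_inv
  · rw [mul_inv_rev, innerAut_inv, hv, List.prod_inv_reverse, List.map_reverse, List.map_map,
      List.map_map]
    rfl

/-- Circuits on two commuting subalgebras can be run simultaneously. -/
theorem map_mul_map {R : SpinSystem} {α : S.Aut} {β : T.Aut} (hα : IsCircuit p ε m α)
    (hβ : IsCircuit p ε m β) (Φ : S.Aut →* R.Aut) (Ψ : T.Aut →* R.Aut)
    (hc : ∀ α β, Commute (Φ α) (Ψ β))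
    (hΦu : ∀ u, ∃ v, Φ (innerAut u) = innerAut v) (hΨu : ∀ u, ∃ v, Ψ (innerAut u) = innerAut v)
    (hΦ : ∀ U α, SupportedOn (S.loc ⁻¹' U) α → SupportedOn (R.loc ⁻¹' U) (Φ α))
    (hΨ : ∀ U α, SupportedOn (T.loc ⁻¹' U) α → SupportedOn (R.loc ⁻¹' U) (Ψ α)) :
    IsCircuit p ε m (Φ α * Ψ β) := by
  obtain ⟨L, u, hL, hP, rfl⟩ := hα
  obtain ⟨L', u', hL', hP', rfl⟩ := hβ
  obtain ⟨v, hv⟩ := hΦu u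
  obtain ⟨v', hv'⟩ := hΨu u'
  refine ⟨(L.map fun g => ⟨g.layer, g.center, Φ g.aut⟩) ++
    L'.map fun g => ⟨g.layer, g.center, Ψ g.aut⟩, v * v', ?_, ?_, ?_⟩
  · intro g hg
    rcases List.mem_append.1 hg with hg | hg
    · obtain ⟨k, hk, rfl⟩ := List.mem_map.1 hg
      exact ⟨(hL k hk).1, hΦ _ _ (hL k hk).2⟩
    · obtain ⟨k, hk, rfl⟩ := List.mem_map.1 hg
      exact ⟨(hL' k hk).1, hΨ _ _ (hL' k hk).2⟩
  · rw [List.pairwise_append, List.pairwise_map, List.pairwise_map]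
    refine ⟨hP.imp fun h => h.imp_right fun h => h.map Φ,
      hP'.imp fun h => h.imp_right fun h => h.map Ψ, fun g hg g' hg' => ?_⟩
    obtain ⟨k, -, rfl⟩ := List.mem_map.1 hg
    obtain ⟨k', -, rfl⟩ := List.mem_map.1 hg'
    exact Or.inr (hc _ _)
  · have h1 : (Gate.aut ∘ fun g : Gate S => (⟨g.layer, g.center, Φ g.aut⟩ : Gate R)) =
        Φ ∘ Gate.aut := rfl
    have h2 : (Gate.aut ∘ fun g : Gate T => (⟨g.layer, g.center, Ψ g.aut⟩ : Gate R)) =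
        Ψ ∘ Gate.aut := rfl
    have h3 := (hc (innerAut u) (L'.map Gate.aut).prod).eq
    rw [List.map_append, List.prod_append, List.map_map, List.map_map, h1, h2, innerAut_mul, ← hv,
      ← hv', map_mul, map_mul, ← List.map_map, ← List.map_map, ← map_list_prod, ← map_list_prod]
    rw [mul_assoc, ← mul_assoc (Φ (innerAut u)), h3]
    simp only [mul_assoc]

theorem map {α : S.Aut} (hα : IsCircuit p ε m α) (Φ : S.Aut →* T.Aut)
    (hu : ∀ u, ∃ v, Φ (innerAut u) = innerAut v)
    (hs : ∀ U α, SupportedOn (S.loc ⁻¹' U) α → SupportedOn (T.loc ⁻¹' U) (Φ α)) :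
    IsCircuit p ε m (Φ α) := by
  have := hα.map_mul_map (one (S := S) m) Φ 1 (fun _ _ => Commute.one_right _) hu
    (fun _ => ⟨1, innerAut_one.symm⟩) hs fun _ _ _ => SupportedOn.one _
  rwa [MonoidHom.one_apply, mul_one] at this

/-- Circuits on the two layers of a stack can be run simultaneously. -/
theorem stack [Nonempty (Config (Sum.elim S.dim T.dim))] {α : S.Aut} {β : T.Aut}
    (hα : IsCircuit p ε m α) (hβ : IsCircuit p ε m β) :
    IsCircuit (S := S.stack T) p ε m (stackAut S.dim T.dim (α, β)) := by
  have key := hα.map_mul_map (R := S.stack T) hβ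
    ((stackAut S.dim T.dim).comp (MonoidHom.inl _ _))
    ((stackAut S.dim T.dim).comp (MonoidHom.inr _ _))
    (fun α β => (Prod.commute_iff.2 ⟨Commute.one_right _, Commute.one_left _⟩ :
      Commute ((α, 1) : S.Aut × T.Aut) (1, β)).map (stackAut S.dim T.dim))
    (fun u => ⟨_, (congrArg (fun β => stackAut S.dim T.dim (innerAut u, β)) innerAut_one.symm).trans
      (stackAut_innerAut u 1)⟩)
    (fun u => ⟨_, (congrArg (fun α => stackAut S.dim T.dim (α, innerAut u)) innerAut_one.symm).trans
      (stackAut_innerAut 1 u)⟩)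
    (fun U α h => stackAut_supportedOn h (SupportedOn.one ∅) (fun j hj => hj) fun j hj => hj.elim)
    (fun U α h => stackAut_supportedOn (SupportedOn.one ∅) h (fun j hj => hj.elim) fun j hj => hj)
  have e : stackAut S.dim T.dim (α, 1) * stackAut S.dim T.dim (1, β) =
      stackAut S.dim T.dim (α, β) := by
    rw [← map_mul, Prod.mk_mul_mk, mul_one, one_mul]
  rw [← e]
  exact key

end IsCircuit

/-! ### Circuits and conical covers -/

section

open SpinSystem

theorem isAutOn_iff {S : SpinSystem} {U : Set ℂ} {α : S.Aut} :
    IsAutOn U α ↔ SupportedOn (S.loc ⁻¹' U) α := by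
  constructor
  · exact fun h j hj m => h _ (site_mem_observablesOn hj m)
  · intro h x hx
    exact starAlgHom_eqOn (F := (α : S.Obs →⋆ₐ[ℂ] S.Obs)) (G := StarAlgHom.id ℂ S.Obs) h hx

/-- A circuit with four layers is `C`-local, if its gates are small in comparison with the Lebesgue
number of the cover `C`: gates are sorted into the first family if their past light cone lies in a
single cone of that family. -/
theorem IsCircuit.isCLocal {S : SpinSystem} [Nonempty (Config S.dim)] {C : GoodConicalCover} {ε : ℝ}
    (hε : 0 < ε) (hC : ∀ z, ∃ a, Metric.ball z (9 * ε) ⊆ C.base a) {α : S.Aut}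
    (hα : IsCircuit C.apex ε 4 α) : IsCLocal C α := by
  obtain ⟨J₀, J₁, hJ, hU, h0, h1⟩ := C.twoFamilies
  obtain ⟨L, u, hL, hP, rfl⟩ := hα
  let A : Gate S → Prop := fun g =>
    ∃ a ∈ J₀, Metric.ball g.center ((2 * g.layer + 1) * ε) ⊆ C.base a
  let label : Gate S → Fin C.card := fun g =>
    if h : A g then h.choose else (hC g.center).choose
  have hA : ∀ g, A g → label g ∈ J₀ ∧
      Metric.ball g.center ((2 * g.layer + 1) * ε) ⊆ C.base (label g) := fun g h => by
    simp only [label, dif_pos h]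
    exact h.choose_spec
  have hA' : ∀ g ∈ L, ¬ A g → label g ∈ J₁ ∧
      Metric.ball g.center (9 * ε) ⊆ C.base (label g) := fun g hg h => by
    have h3 : (g.layer : ℝ) ≤ 3 := by exact_mod_cast Nat.le_of_lt_succ (hL g hg).1
    simp only [label, dif_neg h]
    have hs := (hC g.center).choose_spec
    refine ⟨?_, hs⟩
    have := Finset.mem_univ (hC g.center).choose
    rw [← hU, Finset.mem_union] at this
    refine this.resolve_left fun hmem => h ⟨_, hmem, (Metric.ball_subset_ball ?_).trans hs⟩
    nlinarith
  have hsupp : ∀ g ∈ L, SupportedOn (S.loc ⁻¹' cone C.apex (C.base (label g))) g.aut := by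
    intro g hg
    refine (hL g hg).2.mono (Set.preimage_mono (cone_mono ?_))
    by_cases h : A g
    · refine (Metric.ball_subset_ball ?_).trans (hA g h).2
      nlinarith [(Nat.cast_nonneg g.layer : (0 : ℝ) ≤ g.layer)]
    · refine (Metric.ball_subset_ball ?_).trans (hA' g hg h).2
      linarith
  have hlabel : ∀ g ∈ L, A g ↔ label g ∈ J₀ := fun g hg => ⟨fun h => (hA g h).1, fun h => by
    by_contra hn
    exact Finset.disjoint_left.1 hJ h (hA' g hg hn).1⟩
  refine ⟨J₀, J₁, hJ, hU, h0, h1,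
    fun a => ((L.filter (label · = a)).map Gate.aut).prod, u, fun a => ?_, ?_⟩
  · rw [isAutOn_iff]
    refine SupportedOn.list_prod fun γ hγ => ?_
    obtain ⟨g, hg, rfl⟩ := List.mem_map.1 hγ
    rw [List.mem_filter] at hg
    have := hsupp g hg.1
    rwa [of_decide_eq_true hg.2] at this
  have hdisj : ∀ J : Finset (Fin C.card),
      (J : Set (Fin C.card)).PairwiseDisjoint (fun a => cone C.apex (C.base a)) →
      ∀ g ∈ L, ∀ g' ∈ L, label g ∈ J → label g' ∈ J → label g ≠ label g' →
        Commute g.aut g'.aut := fun J hJ g hg g' hg' hl hl' hne =>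
    (hsupp g hg).commute ((hJ hl hl' hne).preimage _) (hsupp g' hg')
  have key : ∀ (J : Finset (Fin C.card)) (B : Gate S → Prop),
      (J : Set (Fin C.card)).PairwiseDisjoint (fun a => cone C.apex (C.base a)) →
      (∀ g ∈ L, B g ↔ label g ∈ J) →
      ((L.filter (B ·)).map Gate.aut).prod =
        ((J.sort (· ≤ ·)).map fun a => ((L.filter (label · = a)).map Gate.aut).prod).prod := by
    intro J B hJ hB
    rw [prod_eq_prod_labels label Gate.aut (J.sort (· ≤ ·)) (Finset.sort_nodup _ _)]
    · refine congrArg List.prod (List.map_congr_left fun a ha => ?_)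
      rw [Finset.mem_sort] at ha
      rw [List.filter_filter]
      refine congrArg (fun L => (List.map Gate.aut L).prod) (List.filter_congr fun g hg => ?_)
      by_cases hga : label g = a
      · simp [hga, (hB g hg).2 (hga ▸ ha)]
      · simp [hga]
    · intro g hg
      rw [List.mem_filter] at hg
      rw [Finset.mem_sort]
      exact (hB g hg.1).1 (of_decide_eq_true hg.2)
    · refine (hP.filter _).imp_of_mem fun {g g'} hg hg' _ hne => ?_
      rw [List.mem_filter] at hg hg'
      exact hdisj J hJ g hg.1 g' hg'.1 ((hB g hg.1).1 (of_decide_eq_true hg.2))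
        ((hB g' hg'.1).1 (of_decide_eq_true hg'.2)) hne
  have hlabel' : ∀ g ∈ L, ¬ A g ↔ label g ∈ J₁ := fun g hg =>
    ⟨fun h => (hA' g hg h).1, fun h hn => Finset.disjoint_left.1 hJ (hA g hn).1 h⟩
  have hsplit : L.Pairwise fun g g' => ¬ A g → A g' → Commute g.aut g'.aut := by
    refine List.Pairwise.imp_of_mem ?_ hP
    intro g g' hg hg' h hn hp
    refine h.elim (fun hlt => ?_) id
    -- If the supports met, the past light cone of `g'` would contain that of `g`.
    refine (hL g hg).2.commute ((cone_disjoint ?_).preimage _) (hL g' hg').2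
    rw [Set.disjoint_left]
    intro z hz hz'
    obtain ⟨a, ha, hsub⟩ := hp
    refine hn ⟨a, ha, fun w hw => hsub ?_⟩
    rw [Metric.mem_ball] at hz hz' hw ⊢
    have hlt' : (g.layer : ℝ) + 1 ≤ g'.layer := by exact_mod_cast hlt
    have t1 := dist_triangle w g.center g'.center
    have t2 := dist_triangle g.center z g'.center
    rw [dist_comm g.center z] at t2
    nlinarith
  change _ = _ * innerAut u
  rw [← key J₀ A h0 hlabel, ← key J₁ (¬ A ·) h1 hlabel', prod_eq_filter_mul_filter A _ L hsplit]
  congr!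

/-- The spin system `S` with its sites moved to the locations `l`. -/
def SpinSystem.relocate (S : SpinSystem) (l : S.Site → ℂ)
    (h : ∀ K : Set ℂ, IsCompact K → (l ⁻¹' K).Finite) : SpinSystem where
  Site := S.Site
  loc := l
  dim := S.dim
  locallyFinite := h

/-- A `C`-local automorphism becomes a circuit with two layers when the sites are moved so that the
sites in each cone of `C` end up in a narrow cone. -/
theorem IsCLocal.isCircuit {S : SpinSystem} [Nonempty (Config S.dim)] {C : GoodConicalCover}
    {α : S.Aut} (hα : IsCLocal C α) {l : S.Site → ℂ}
    (h : ∀ K : Set ℂ, IsCompact K → (l ⁻¹' K).Finite) {p : ℂ} {ε : ℝ} (z : Fin C.card → Circle)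
    (hl : ∀ a j, S.loc j ∈ cone C.apex (C.base a) → l j ∈ cone p (Metric.ball (z a) ε)) :
    IsCircuit (S := S.relocate l h) p ε 2 α := by
  obtain ⟨J₀, J₁, -, -, h0, h1, β, u, hβ, rfl⟩ := hα
  simp_rw [isAutOn_iff] at hβ
  have hpw : ∀ (J : Finset (Fin C.card)) (i : ℕ),
      (J : Set (Fin C.card)).PairwiseDisjoint (fun a => cone C.apex (C.base a)) →
      ((J.sort (· ≤ ·)).map fun a => (⟨i, z a, β a⟩ : Gate (S.relocate l h))).Pairwise
        fun g g' => g.layer < g'.layer ∨ Commute g.aut g'.aut := fun J i hJ => by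
    rw [List.pairwise_map]
    refine List.Pairwise.imp_of_mem (fun {a b} ha hb hab => ?_) (Finset.sort_nodup J (· ≤ ·))
    rw [Finset.mem_sort] at ha hb
    exact Or.inr ((hβ a).commute ((hJ ha hb hab).preimage _) (hβ b))
  refine ⟨((J₀.sort (· ≤ ·)).map fun a => ⟨0, z a, β a⟩) ++
    (J₁.sort (· ≤ ·)).map fun a => ⟨1, z a, β a⟩, u, fun g hg => ?_, ?_, ?_⟩
  · rcases List.mem_append.1 hg with hg | hg
    · obtain ⟨a, -, rfl⟩ := List.mem_map.1 hg
      exact ⟨by simp, (hβ a).mono fun j hj => hl a j hj⟩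
    · obtain ⟨a, -, rfl⟩ := List.mem_map.1 hg
      exact ⟨by simp, (hβ a).mono fun j hj => hl a j hj⟩
  · rw [List.pairwise_append]
    refine ⟨hpw J₀ 0 h0, hpw J₁ 1 h1, fun g hg g' hg' => ?_⟩
    obtain ⟨a, -, rfl⟩ := List.mem_map.1 hg
    obtain ⟨b, -, rfl⟩ := List.mem_map.1 hg'
    exact Or.inl (by simp)
  · rw [List.map_append, List.prod_append, List.map_map, List.map_map]
    rfl

end

/-! ### The swap of two sites -/

section

open SpinSystem

section Swap

variable {A n : Type} [CStarAlgebra A] [Fintype n] [DecidableEq n]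
  (φ χ : Matrix n n ℂ →⋆ₐ[ℂ] A)

/-- The operator that exchanges two copies of a matrix algebra. -/
def swapOp : A := ∑ k, ∑ l, φ (Matrix.single k l 1) * χ (Matrix.single l k 1)

variable {φ χ}

theorem star_swapOp (hc : ∀ x y, Commute (φ x) (χ y)) : star (swapOp φ χ) = swapOp φ χ := by
  have h : ∀ i j : n, star (φ (Matrix.single i j 1) * χ (Matrix.single j i 1)) =
      φ (Matrix.single j i 1) * χ (Matrix.single i j 1) := fun i j => by
    rw [star_mul, ← map_star, ← map_star, star_single_one, star_single_one, (hc _ _).eq]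
  rw [swapOp, star_sum]
  simp_rw [star_sum, h]
  rw [Finset.sum_comm]

theorem swapOp_mul_swapOp (hc : ∀ x y, Commute (φ x) (χ y)) : swapOp φ χ * swapOp φ χ = 1 := by
  have h : ∀ k l, φ (Matrix.single k l 1) * χ (Matrix.single l k 1) * swapOp φ χ =
      φ (Matrix.single k k 1) * χ (Matrix.single l l 1) := fun k l => by
    have e : ∀ a b, φ (Matrix.single k l 1) * χ (Matrix.single l k 1) *
        (φ (Matrix.single a b 1) * χ (Matrix.single b a 1)) =
        if a = l then (if b = k then φ (Matrix.single k k 1) * χ (Matrix.single l l 1) else 0)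
          else 0 := fun a b => by
      rw [mul_assoc, ← mul_assoc (χ _), ← (hc _ _).eq, mul_assoc, ← map_mul, ← mul_assoc, ← map_mul]
      by_cases ha : a = l
      · subst ha
        by_cases hb : b = k
        · subst hb
          rw [Matrix.single_mul_single_same, Matrix.single_mul_single_same, mul_one]
          simp
        · rw [Matrix.single_mul_single_of_ne _ _ _ _ (Ne.symm hb)]
          simp [hb]
      · rw [Matrix.single_mul_single_of_ne _ _ _ _ (Ne.symm ha)]
        simp [ha]
    rw [swapOp, Finset.mul_sum]
    simp_rw [Finset.mul_sum, e]
    simp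
  conv_lhs => enter [1]; rw [swapOp]
  rw [Finset.sum_mul]
  simp_rw [Finset.sum_mul, h, ← Finset.mul_sum, ← map_sum, sum_single_diag, map_one, mul_one,
    ← map_sum, sum_single_diag, map_one]

theorem swapOp_mul (hc : ∀ x y, Commute (φ x) (χ y)) (m : Matrix n n ℂ) :
    swapOp φ χ * φ m = χ m * swapOp φ χ := by
  have h : ∀ i j, swapOp φ χ * φ (Matrix.single i j 1) = χ (Matrix.single i j 1) * swapOp φ χ := by
    intro i j
    have e1 : swapOp φ χ * φ (Matrix.single i j 1) =
        ∑ k, φ (Matrix.single k j 1) * χ (Matrix.single i k 1) := by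
      rw [swapOp, Finset.sum_mul]
      refine Finset.sum_congr rfl fun k _ => ?_
      rw [Finset.sum_mul, Finset.sum_eq_single i]
      · rw [mul_assoc, ← (hc _ _).eq, ← mul_assoc, ← map_mul, Matrix.single_mul_single_same, mul_one]
      · intro l _ hl
        rw [mul_assoc, ← (hc _ _).eq, ← mul_assoc, ← map_mul,
          Matrix.single_mul_single_of_ne _ _ _ _ hl, map_zero, zero_mul]
      · simp
    have e2 : χ (Matrix.single i j 1) * swapOp φ χ =
        ∑ k, φ (Matrix.single k j 1) * χ (Matrix.single i k 1) := by
      rw [swapOp, Finset.mul_sum]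
      refine Finset.sum_congr rfl fun k _ => ?_
      rw [Finset.mul_sum, Finset.sum_eq_single j]
      · rw [← mul_assoc, ← (hc _ _).eq, mul_assoc, ← map_mul, Matrix.single_mul_single_same, mul_one]
      · intro l _ hl
        rw [← mul_assoc, ← (hc _ _).eq, mul_assoc, ← map_mul,
          Matrix.single_mul_single_of_ne _ _ _ _ hl.symm, map_zero, mul_zero]
      · simp
    rw [e1, e2]
  rw [Matrix.matrix_eq_sum_single m]
  simp_rw [map_sum, Finset.mul_sum, Finset.sum_mul]
  refine Finset.sum_congr rfl fun i _ => Finset.sum_congr rfl fun j _ => ?_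
  have : Matrix.single i j (m i j) = m i j • Matrix.single i j (1 : ℂ) := by simp
  rw [this, map_smul, map_smul, mul_smul_comm, smul_mul_assoc, h]

theorem swapOp_comm (hc : ∀ x y, Commute (φ x) (χ y)) : swapOp χ φ = swapOp φ χ := by
  rw [swapOp, swapOp, Finset.sum_comm]
  exact Finset.sum_congr rfl fun k _ => Finset.sum_congr rfl fun l _ => (hc _ _).symm.eq

theorem exists_swap_unitary (hc : ∀ x y, Commute (φ x) (χ y)) : ∃ u : unitary A,
    (∀ m, u * φ m * star (u : A) = χ m) ∧ (∀ m, u * χ m * star (u : A) = φ m) ∧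
    ∀ x, (∀ m, Commute (φ m) x) → (∀ m, Commute (χ m) x) → u * x * star (u : A) = x := by
  have hsq := swapOp_mul_swapOp hc
  have hstar := star_swapOp hc
  have hmem : swapOp φ χ ∈ unitary A := by
    rw [Unitary.mem_iff, hstar]
    exact ⟨hsq, hsq⟩
  refine ⟨⟨swapOp φ χ, hmem⟩, fun m => ?_, fun m => ?_, fun x hx hx' => ?_⟩
  · change swapOp φ χ * φ m * star (swapOp φ χ) = χ m
    rw [hstar, swapOp_mul hc, mul_assoc, hsq, mul_one]
  · change swapOp φ χ * χ m * star (swapOp φ χ) = φ m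
    rw [hstar, ← swapOp_comm hc, swapOp_mul fun x y => (hc y x).symm, swapOp_comm hc, mul_assoc,
      hsq, mul_one]
  · have : Commute (swapOp φ χ) x := Commute.sum_left _ _ _ fun k _ => Commute.sum_left _ _ _
      fun l _ => (hx _).mul_left (hx' _)
    change swapOp φ χ * x * star (swapOp φ χ) = x
    rw [hstar, this.eq, mul_assoc, hsq, mul_one]

end Swap

section SwapSites

variable {Λ : Type} {d : Λ → ℕ}

theorem site_castMat {k k' : Λ} (h : k = k') (hd : d k = d k')
    (m : Matrix (Fin (d k')) (Fin (d k')) ℂ) :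
    site k (castMat hd m) = (site k' m : Observables d) := by
  subst h
  rfl

/-- The exchange of two sites is an inner automorphism. -/
theorem exists_swap [Nonempty (Config d)] {i j : Λ} (hij : i ≠ j) (π : Equiv.Perm Λ) (hi : π i = j)
    (hj : π j = i) (hk : ∀ k, k ≠ i → k ≠ j → π k = k) (hd : ∀ k, d k = d (π k)) :
    ∃ u : unitary (Observables d), ∀ Γ M,
      innerAut u (tensor Γ (castFamily π hd M)) = tensor (Γ.map π.toEmbedding) M := by
  have hji : d j = d i := (hd j).trans (congrArg d hj)
  obtain ⟨χ, hχ⟩ : ∃ χ : Matrix (Fin (d i)) (Fin (d i)) ℂ →⋆ₐ[ℂ] Observables d,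
      ∀ m, χ m = site j (castMat hji m) :=
    ⟨(site j).comp (relabel (finCongr hji.symm)), fun m => rfl⟩
  obtain ⟨u, h1, h2, h3⟩ := exists_swap_unitary (φ := (site i : _ →⋆ₐ[ℂ] Observables d)) (χ := χ)
    fun x y => by
      rw [hχ]
      exact site_commute hij _ _
  obtain ⟨F, hF, hFs⟩ := exists_relabelling π hd
  have key : innerAut u = F := by
    refine starAlgEquiv_ext fun k m => ?_
    obtain ⟨m, rfl⟩ : ∃ m', m = castMat (hd k) m' := ⟨castMat (hd k).symm m, rfl⟩
    rw [hFs, innerAut_apply]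
    by_cases hki : k = i
    · subst hki
      rw [h1, hχ]
      exact site_castMat hi.symm (congrArg d hi.symm) m
    by_cases hkj : k = j
    · subst hkj
      have := h2 (castMat (hji.symm.trans (hd k)) m)
      rw [hχ] at this
      exact this.trans (site_castMat hj.symm _ m)
    · rw [h3]
      · exact site_castMat (hk k hki hkj).symm _ m
      · exact fun m' => site_commute (Ne.symm hki) _ _
      · intro m'
        rw [hχ]
        exact site_commute (Ne.symm hkj) _ _
  exact ⟨u, fun Γ M => key ▸ hF Γ M⟩

end SwapSites

end

/-! ### States related by circuits -/

section

open SpinSystem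

/-- Transport of automorphisms along an isomorphism of algebras. -/
def autConj {Λ Λ' : Type} {d : Λ → ℕ} {d' : Λ' → ℕ} (F : Observables d ≃⋆ₐ[ℂ] Observables d') :
    (Observables d' ≃⋆ₐ[ℂ] Observables d') →* (Observables d ≃⋆ₐ[ℂ] Observables d) where
  toFun β := (F.trans β).trans F.symm
  map_one' := StarAlgEquiv.ext fun x => F.symm_apply_apply x
  map_mul' α β := StarAlgEquiv.ext fun x => by
    change F.symm (α (β (F x))) = F.symm (α (F (F.symm (β (F x)))))
    rw [F.apply_symm_apply]

theorem autConj_innerAut {Λ Λ' : Type} {d : Λ → ℕ} {d' : Λ' → ℕ}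
    (F : Observables d ≃⋆ₐ[ℂ] Observables d') (u : unitary (Observables d')) :
    ∃ v, autConj F (innerAut u) = innerAut v := by
  refine ⟨unitaryMap (F.symm : Observables d' →⋆ₐ[ℂ] Observables d) u, StarAlgEquiv.ext fun x => ?_⟩
  change F.symm (u * F x * star (u : Observables d')) = F.symm u * x * star (F.symm u)
  rw [map_mul, map_mul, map_star, F.symm_apply_apply]

/-- An isomorphism of spin systems induces an isomorphism of algebras that respects supports. -/
theorem SpinSystem.Iso.exists_equiv {S T : SpinSystem} (e : S.Iso T) [Nonempty (Config T.dim)] :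
    ∃ F : S.Obs ≃⋆ₐ[ℂ] T.Obs, (∀ ω ω', e.Transports ω ω' → ∀ x, ω x = ω' (F x)) ∧
      (∀ ω ω', IsState ω → IsState ω' → (∀ x, ω x = ω' (F x)) → e.Transports ω ω') ∧
      ∀ U α, SupportedOn (T.loc ⁻¹' U) α → SupportedOn (S.loc ⁻¹' U) (autConj F α) := by
  obtain ⟨F, hF, hs⟩ := exists_relabelling e.siteEquiv e.dim_eq
  refine ⟨F, fun ω ω' h => TransportsTo.eq_comp (e := e.siteEquiv) (hd := e.dim_eq) h.2.2 h.1 h.2.1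
    F hF, fun ω ω' hω hω' h => ⟨hω, hω', fun Γ M => (h _).trans (congrArg ω' (hF Γ M))⟩,
    fun U α hα j hj m => ?_⟩
  obtain ⟨m, rfl⟩ : ∃ m', m = castMat (e.dim_eq j) m' := ⟨castMat (e.dim_eq j).symm m, rfl⟩
  change F.symm (α (F (site j _))) = _
  rw [hs, hα, ← hs j, F.symm_apply_apply]
  rwa [Set.mem_preimage, ← e.loc_eq]

/-- States in the classes `q` and `q'` are related by a circuit. -/
def CircuitRelated (p : ℂ) (ε : ℝ) (m : ℕ) (q q' : StateClass) : Prop :=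
  ∃ (R : SpinSystem) (ω ω' : R.Functional) (h : IsState ω) (h' : IsState ω') (α : R.Aut),
    q = stateClass R ω h ∧ q' = stateClass R ω' h' ∧ IsCircuit p ε m α ∧ ∀ x, ω x = ω' (α x)

namespace CircuitRelated

variable {p : ℂ} {ε : ℝ} {m m' : ℕ} {q q' q₁ q₁' q₂ q₂' q₃ : StateClass}

theorem refl (m : ℕ) (q : StateClass) : CircuitRelated p ε m q q := by
  obtain ⟨S, ψ, h, rfl⟩ := exists_stateClass q
  exact ⟨S, ψ, ψ, h, h, 1, rfl, rfl, IsCircuit.one m, fun x => rfl⟩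

theorem symm (h : CircuitRelated p ε m q q') : CircuitRelated p ε m q' q := by
  obtain ⟨R, ω, ω', hω, hω', α, rfl, rfl, hα, he⟩ := h
  exact ⟨R, ω', ω, hω', hω, α⁻¹, rfl, rfl, hα.inv, fun x => by
    rw [he]
    exact congrArg ω' (α.apply_symm_apply x).symm⟩

theorem trans (h : CircuitRelated p ε m q₁ q₂) (h' : CircuitRelated p ε m' q₂ q₃) :
    CircuitRelated p ε (m + m') q₁ q₃ := by
  obtain ⟨R, ω₁, ω₂, hω₁, hω₂, α, h1, h2, hα, he⟩ := h
  obtain ⟨R', ω₂', ω₃, hω₂', hω₃, β, h2', h3, hβ, he'⟩ := h'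
  obtain ⟨e, hT⟩ := (stateClass_eq_iff hω₂ hω₂').1 (h2.symm.trans h2')
  have := hω₂'.nonempty_config
  obtain ⟨F, hF, hF', hs⟩ := e.exists_equiv
  obtain ⟨ω, hω, hωF⟩ : ∃ ω : R.Functional, IsState ω ∧ ∀ x, ω x = ω₃ (F x) :=
    ⟨_, hω₃.comp (F : R.Obs →⋆ₐ[ℂ] R'.Obs), fun _ => rfl⟩
  have hq : stateClass R ω hω = stateClass R' ω₃ hω₃ :=
    (stateClass_eq_iff hω hω₃).2 ⟨e, hF' ω ω₃ hω hω₃ hωF⟩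
  have hc : IsCircuit p ε (m + m') (autConj F β * α) := by
    rw [add_comm]
    exact (hβ.map (autConj F) (autConj_innerAut F) hs).mul hα
  have hx : ∀ x, ω₁ x = ω ((autConj F β * α) x) := fun x => by
    have h4 : F ((autConj F β * α) x) = β (F (α x)) := F.apply_symm_apply _
    exact (he x).trans ((hF ω₂ ω₂' hT (α x)).trans ((he' (F (α x))).trans
      ((congrArg ω₃ h4.symm).trans (hωF _).symm)))
  exact ⟨R, ω₁, ω, hω₁, hω, autConj F β * α, h1, h3.trans hq.symm, hc, hx⟩

theorem mul (h : CircuitRelated p ε m q₁ q₁') (h' : CircuitRelated p ε m q₂ q₂') :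
    CircuitRelated p ε m (q₁ * q₂) (q₁' * q₂') := by
  obtain ⟨R, ω, ω', hω, hω', α, rfl, rfl, hα, he⟩ := h
  obtain ⟨T, χ, χ', hχ, hχ', β, rfl, rfl, hβ, he'⟩ := h'
  obtain ⟨η, hη, ht⟩ := exists_isTensorState hω hχ
  obtain ⟨η', hη', ht'⟩ := exists_isTensorState hω' hχ'
  have := hη.nonempty_config
  refine ⟨R.stack T, η, η', hη, hη', stackAut R.dim T.dim (α, β), (stateClass_mul hω hχ hη ht).symm,
    (stateClass_mul hω' hχ' hη' ht').symm, hα.stack hβ, fun x => ?_⟩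
  have key := hη.ext_tensor (hη'.comp (stackAut R.dim T.dim (α, β) :
      Observables (Sum.elim R.dim T.dim) →⋆ₐ[ℂ] Observables (Sum.elim R.dim T.dim)))
    fun Γ M => by
      rw [tensor_stack, ht.apply hω hχ hη]
      refine (congrArg₂ (· * ·) (he _) (he' _)).trans ((ht'.apply hω' hχ' hη' _ _).symm.trans ?_)
      refine congrArg η' ?_
      refine Eq.trans ?_ (map_mul (stackAut R.dim T.dim (α, β)) _ _).symm
      rw [stackAut_inlHom, stackAut_inrHom]
  exact LinearMap.congr_fun key x

end CircuitRelated

/-- States in the classes `q` and `q'` have trivial extensions that are related by a circuit. -/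
def StablyRelated (p : ℂ) (ε : ℝ) (m : ℕ) (q q' : StateClass) : Prop :=
  ∃ t t', IsTrivialClass t ∧ IsTrivialClass t' ∧ CircuitRelated p ε m (q * t) (q' * t')

namespace StablyRelated

variable {p : ℂ} {ε : ℝ} {m m' : ℕ} {q q' q₁ q₁' q₂ q₂' q₃ : StateClass}

theorem of_circuitRelated (h : CircuitRelated p ε m q q') : StablyRelated p ε m q q' :=
  ⟨1, 1, isTrivialClass_one, isTrivialClass_one, by rwa [mul_one, mul_one]⟩

theorem refl (m : ℕ) (q : StateClass) : StablyRelated p ε m q q :=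
  of_circuitRelated (CircuitRelated.refl m q)

theorem symm (h : StablyRelated p ε m q q') : StablyRelated p ε m q' q := by
  obtain ⟨t, t', ht, ht', h⟩ := h
  exact ⟨t', t, ht', ht, h.symm⟩

theorem trans (h : StablyRelated p ε m q₁ q₂) (h' : StablyRelated p ε m' q₂ q₃) :
    StablyRelated p ε (m + m') q₁ q₃ := by
  obtain ⟨t₁, t₂, ht₁, ht₂, h⟩ := h
  obtain ⟨s₂, s₃, hs₂, hs₃, h'⟩ := h'
  refine ⟨t₁ * s₂, s₃ * t₂, ht₁.mul hs₂, hs₃.mul ht₂, ?_⟩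
  have h1 := h.mul (CircuitRelated.refl (p := p) (ε := ε) m s₂)
  have h2 := h'.mul (CircuitRelated.refl (p := p) (ε := ε) m' t₂)
  rw [mul_assoc, mul_assoc] at h1 h2
  rw [mul_comm s₂ t₂] at h2
  exact h1.trans h2

theorem mul (h : StablyRelated p ε m q₁ q₁') (h' : StablyRelated p ε m q₂ q₂') :
    StablyRelated p ε m (q₁ * q₂) (q₁' * q₂') := by
  obtain ⟨t, t', ht, ht', h⟩ := h
  obtain ⟨s, s', hs, hs', h'⟩ := h'
  refine ⟨t * s, t' * s', ht.mul hs, ht'.mul hs', ?_⟩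
  rw [mul_mul_mul_comm, mul_mul_mul_comm q₁']
  exact h.mul h'

theorem prod {n : ℕ} {f : ℕ → StateClass} (h : ∀ k < n, StablyRelated p ε m (f k) 1) :
    StablyRelated p ε m (∏ k ∈ Finset.range n, f k) 1 := by
  induction n with
  | zero => exact refl m _
  | succ n ih =>
    rw [Finset.prod_range_succ]
    have := (ih fun k hk => h k (hk.trans n.lt_succ_self)).mul (h n n.lt_succ_self)
    rwa [mul_one] at this

/-- If the states `ψ k`, `k ≤ n`, have approximate inverses `ψ' k` that also serve for the
neighbours, then `ψ 0` and `ψ n` are related, by a circuit whose depth does not depend on `n`: the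
stack of `ψ 0` with all the pairs `ψ (k + 1)`, `ψ' k` is the stack of `ψ n` with all the pairs `ψ k`,
`ψ' k`. -/
theorem chain {n : ℕ} {ψ ψ' : ℕ → StateClass}
    (h : ∀ k < n, StablyRelated p ε m (ψ k * ψ' k) 1)
    (h' : ∀ k < n, StablyRelated p ε m (ψ (k + 1) * ψ' k) 1) :
    StablyRelated p ε (m + m) (ψ 0) (ψ n) := by
  have h1 := (refl (p := p) (ε := ε) m (ψ 0)).mul (prod h').symm
  have h2 := (refl (p := p) (ε := ε) m (ψ n)).mul (prod h)
  rw [mul_one] at h1 h2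
  refine h1.trans ?_
  have e : ψ 0 * ∏ k ∈ Finset.range n, ψ (k + 1) * ψ' k =
      ψ n * ∏ k ∈ Finset.range n, ψ k * ψ' k := by
    rw [Finset.prod_mul_distrib, Finset.prod_mul_distrib, ← mul_assoc, ← mul_assoc,
      ← Finset.prod_range_succ_comm, mul_comm (ψ 0), ← Finset.prod_range_succ']
  rw [e]
  exact h2

end StablyRelated

/-! ### Moving finitely many sites -/

theorem finite_preimage_of_eqOn {ι : Type} {l l' : ι → ℂ} (E : Finset ι) (hE : ∀ j ∉ E, l' j = l j)
    (h : ∀ K : Set ℂ, IsCompact K → (l ⁻¹' K).Finite) (K : Set ℂ) (hK : IsCompact K) :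
    (l' ⁻¹' K).Finite := by
  refine ((h K hK).union E.finite_toSet).subset fun j hj => ?_
  by_cases hjE : j ∈ E
  · exact Or.inr hjE
  · exact Or.inl (by rwa [Set.mem_preimage, ← hE j hjE])

variable {p : ℂ} {ε : ℝ}

theorem IsState.exists_comp_aut {S : SpinSystem} {ω : S.Functional} (hω : IsState ω) (α : S.Aut) :
    ∃ ω' : S.Functional, IsState ω' ∧ ∀ x, ω' x = ω (α x) :=
  ⟨_, hω.comp (α : S.Obs →⋆ₐ[ℂ] S.Obs), fun _ => rfl⟩

/-- The spin system with a single site. -/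
def oneSite (n : ℕ) (z : ℂ) : SpinSystem :=
  ⟨Unit, fun _ => z, fun _ => n, fun _ _ => Set.toFinite _⟩

/-- A site that is moved from its place to `w` is, up to a unitary, exchanged with an ancilla that is
moved in the opposite direction. -/
theorem exists_exchange (S : SpinSystem) (j : S.Site) (w : ℂ)
    (h : ∀ K : Set ℂ, IsCompact K → (Function.update S.loc j w ⁻¹' K).Finite)
    [Nonempty (Config (S.stack (oneSite (S.dim j) w)).dim)] :
    ∃ (e : (S.stack (oneSite (S.dim j) w)).Iso
        ((S.relocate (Function.update S.loc j w) h).stack (oneSite (S.dim j) (S.loc j))))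
      (u : unitary (S.stack (oneSite (S.dim j) w)).Obs),
      ∀ ω ω' : (S.stack (oneSite (S.dim j) w)).Functional, IsState ω → IsState ω' →
        (∀ x, ω' x = ω (innerAut u x)) → e.Transports ω' ω := by
  obtain ⟨π, hi, hj, hk⟩ : ∃ π : Equiv.Perm (S.Site ⊕ Unit), π (Sum.inl j) = Sum.inr () ∧
      π (Sum.inr ()) = Sum.inl j ∧ ∀ k, k ≠ Sum.inl j → k ≠ Sum.inr () → π k = k :=
    ⟨Equiv.swap (Sum.inl j) (Sum.inr ()), Equiv.swap_apply_left _ _, Equiv.swap_apply_right _ _,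
      fun k => Equiv.swap_apply_of_ne_of_ne⟩
  have hd : ∀ k, Sum.elim S.dim (fun _ => S.dim j) k =
      Sum.elim S.dim (fun _ => S.dim j) (π k) := fun k => by
    by_cases h1 : k = Sum.inl j
    · rw [h1, hi]
      rfl
    by_cases h2 : k = Sum.inr ()
    · rw [h2, hj]
      rfl
    · rw [hk k h1 h2]
  have hloc : ∀ k, Sum.elim S.loc (fun _ => w) k =
      Sum.elim (Function.update S.loc j w) (fun _ => S.loc j) (π k) := fun k => by
    by_cases h1 : k = Sum.inl j
    · rw [h1, hi]
      rfl
    by_cases h2 : k = Sum.inr ()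
    · rw [h2, hj]
      simp
    · rw [hk k h1 h2]
      rcases k with k | k
      · simp [Function.update_of_ne fun hk : k = j => h1 (congrArg _ hk)]
      · exact (h2 rfl).elim
  have hN : Nonempty (Config (Sum.elim S.dim fun _ : Unit => S.dim j)) :=
    ‹Nonempty (Config (S.stack (oneSite (S.dim j) w)).dim)›
  obtain ⟨u, hu⟩ := exists_swap (d := Sum.elim S.dim fun _ : Unit => S.dim j) (by simp) π hi hj hk hd
  exact ⟨⟨π, hloc, hd⟩, u, fun ω ω' hω hω' hx =>
    ⟨hω', hω, fun Γ M => (hx _).trans (congrArg ω (hu Γ M))⟩⟩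

/-- Moving a single site does not change a state stably: the site is exchanged with an ancilla that
has been placed at its destination. -/
theorem stablyRelated_move (S : SpinSystem) {ψ : S.Functional} (hψ : IsState ψ) (j : S.Site) {w : ℂ}
    (h : ∀ K : Set ℂ, IsCompact K → (Function.update S.loc j w ⁻¹' K).Finite) :
    StablyRelated p ε 0 (stateClass S ψ hψ)
      (stateClass (S.relocate (Function.update S.loc j w) h) ψ hψ) := by
  obtain ⟨σ⟩ := hψ.nonempty_config
  obtain ⟨τ, hτ, ht⟩ : ∃ τ : (oneSite (S.dim j) w).Functional, IsState τ ∧ IsTrivial τ :=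
    ⟨_, isState_basisState _, isTrivial_basisState fun _ => σ j⟩
  obtain ⟨ω, hω, hten⟩ := exists_isTensorState hψ hτ
  have : Nonempty (Config (S.stack (oneSite (S.dim j) w)).dim) := hω.nonempty_config
  obtain ⟨e, u, hu⟩ := exists_exchange S j w h
  obtain ⟨ω', hω', hx⟩ : ∃ ω' : (S.stack (oneSite (S.dim j) w)).Functional, IsState ω' ∧
      ∀ x, ω' x = ω (innerAut u x) :=
    hω.exists_comp_aut (innerAut u)
  have h1 : stateClass S ψ hψ * stateClass (oneSite (S.dim j) w) τ hτ =
      stateClass (S.stack (oneSite (S.dim j) w)) ω hω := (stateClass_mul hψ hτ hω hten).symm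
  have h2 : stateClass (S.relocate (Function.update S.loc j w) h) ψ hψ *
      stateClass (oneSite (S.dim j) (S.loc j)) τ hτ =
      stateClass ((S.relocate (Function.update S.loc j w) h).stack (oneSite (S.dim j) (S.loc j)))
        ω hω := (stateClass_mul (S := S.relocate (Function.update S.loc j w) h)
          (T := oneSite (S.dim j) (S.loc j)) hψ hτ hω hten).symm
  have h3 := (stateClass_eq_iff (S := S.stack (oneSite (S.dim j) w))
    (T := (S.relocate (Function.update S.loc j w) h).stack (oneSite (S.dim j) (S.loc j)))
    hω' hω).2 ⟨e, hu ω ω' hω hω' hx⟩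
  exact ⟨_, _, ⟨oneSite (S.dim j) w, τ, hτ, ht, rfl⟩, ⟨oneSite (S.dim j) (S.loc j), τ, hτ, ht, rfl⟩,
    CircuitRelated.symm ⟨S.stack (oneSite (S.dim j) w), ω', ω, hω', hω, innerAut u,
      h2.trans h3.symm, h1, IsCircuit.inner u 0, hx⟩⟩

theorem stateClass_relocate_congr (S : SpinSystem) {ψ : S.Functional} (hψ : IsState ψ)
    {l l' : S.Site → ℂ} (e : l = l') (h : ∀ K : Set ℂ, IsCompact K → (l ⁻¹' K).Finite)
    (h' : ∀ K : Set ℂ, IsCompact K → (l' ⁻¹' K).Finite) :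
    stateClass (S.relocate l h) ψ hψ = stateClass (S.relocate l' h') ψ hψ := by
  subst e
  rfl

/-- Moving finitely many sites does not change a state stably. -/
theorem stablyRelated_relocate (S : SpinSystem) {ψ : S.Functional} (hψ : IsState ψ)
    (l₀ : S.Site → ℂ) (h₀ : ∀ K : Set ℂ, IsCompact K → (l₀ ⁻¹' K).Finite) (E : Finset S.Site)
    (l : S.Site → ℂ) (h : ∀ K : Set ℂ, IsCompact K → (l ⁻¹' K).Finite)
    (hl : ∀ j ∉ E, l j = l₀ j) :
    StablyRelated p ε 0 (stateClass (S.relocate l₀ h₀) ψ hψ) (stateClass (S.relocate l h) ψ hψ) := by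
  induction E using Finset.induction_on generalizing l with
  | empty =>
    obtain rfl : l = l₀ := funext fun j => hl j (by simp)
    exact StablyRelated.refl 0 _
  | insert i E hi ih =>
    have h1 : ∀ j ∉ E, Function.update l i (l₀ i) j = l₀ j := fun j hj => by
      by_cases hji : j = i
      · subst hji
        rw [Function.update_self]
      · rw [Function.update_of_ne hji, hl j (by simp [hji, hj])]
    have h1' := finite_preimage_of_eqOn E h1 h₀
    have h2 := ih _ h1' h1
    have e : Function.update (Function.update l i (l₀ i)) i (l i) = l := by simp
    have he : ∀ K : Set ℂ, IsCompact K →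
        (Function.update (Function.update l i (l₀ i)) i (l i) ⁻¹' K).Finite := by rwa [e]
    have h3 := stablyRelated_move (p := p) (ε := ε) (S.relocate _ h1') hψ i (w := l i) he
    have h4 : StablyRelated p ε 0 (stateClass (S.relocate l₀ h₀) ψ hψ)
        (stateClass (S.relocate (Function.update (Function.update l i (l₀ i)) i (l i)) he) ψ hψ) :=
      h2.trans h3
    rwa [stateClass_relocate_congr S hψ e _ h] at h4

end

/-! ### Invertible states in different positions -/

section

open SpinSystem Filter

theorem stateClass_relocate_iso {S T : SpinSystem} {ψ : S.Functional} {χ : T.Functional}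
    (hψ : IsState ψ) (hχ : IsState χ) (e : S.Iso T) (he : e.Transports ψ χ) {l : S.Site → ℂ}
    {l' : T.Site → ℂ} (h : ∀ K : Set ℂ, IsCompact K → (l ⁻¹' K).Finite)
    (h' : ∀ K : Set ℂ, IsCompact K → (l' ⁻¹' K).Finite) (hl : ∀ j, l j = l' (e.siteEquiv j)) :
    stateClass (S.relocate l h) ψ hψ = stateClass (T.relocate l' h') χ hχ :=
  (stateClass_eq_iff (S := S.relocate l h) (T := T.relocate l' h') hψ hχ).2
    ⟨⟨e.siteEquiv, hl, e.dim_eq⟩, he⟩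

theorem finite_preimage_sumElim {α β : Type} {l : α → ℂ} {l' : β → ℂ}
    (h : ∀ K : Set ℂ, IsCompact K → (l ⁻¹' K).Finite)
    (h' : ∀ K : Set ℂ, IsCompact K → (l' ⁻¹' K).Finite) (K : Set ℂ) (hK : IsCompact K) :
    (Sum.elim l l' ⁻¹' K).Finite := by
  refine (((h K hK).image Sum.inl).union ((h' K hK).image Sum.inr)).subset ?_
  rintro (j | j) hj
  · exact Or.inl ⟨j, hj, rfl⟩
  · exact Or.inr ⟨j, hj, rfl⟩

theorem finite_preimage_comp_equiv {α β : Type} (e : α ≃ β) {l : β → ℂ}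
    (h : ∀ K : Set ℂ, IsCompact K → (l ⁻¹' K).Finite) (K : Set ℂ) (hK : IsCompact K) :
    ((l ∘ e) ⁻¹' K).Finite := by
  rw [Set.preimage_comp]
  exact (h K hK).preimage e.injective.injOn

theorem stateClass_relocate_stack {S T : SpinSystem} {ψ : S.Functional} {χ : T.Functional}
    {ω : (S.stack T).Functional} (hψ : IsState ψ) (hχ : IsState χ) (hω : IsState ω)
    (ht : IsTensorState ψ χ ω) {l : S.Site → ℂ} {l' : T.Site → ℂ}
    (h : ∀ K : Set ℂ, IsCompact K → (l ⁻¹' K).Finite)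
    (h' : ∀ K : Set ℂ, IsCompact K → (l' ⁻¹' K).Finite)
    (hs : ∀ K : Set ℂ, IsCompact K → (Sum.elim l l' ⁻¹' K).Finite) :
    stateClass ((S.stack T).relocate (Sum.elim l l') hs) ω hω =
      stateClass (S.relocate l h) ψ hψ * stateClass (T.relocate l' h') χ hχ :=
  stateClass_mul (S := S.relocate l h) (T := T.relocate l' h') hψ hχ hω ht

/-- Triviality of a state does not depend on the locations of the sites. -/
theorem IsTrivialClass.relocate {S : SpinSystem} {ω : S.Functional} {hω : IsState ω}
    (ht : IsTrivialClass (stateClass S ω hω)) {l : S.Site → ℂ}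
    (h : ∀ K : Set ℂ, IsCompact K → (l ⁻¹' K).Finite) :
    IsTrivialClass (stateClass (S.relocate l h) ω hω) := by
  obtain ⟨T, τ, hτ, htτ, hq⟩ := ht
  obtain ⟨e, he⟩ := (stateClass_eq_iff hτ hω).1 hq.symm
  have h' : ∀ K : Set ℂ, IsCompact K → ((l ∘ e.siteEquiv) ⁻¹' K).Finite :=
    finite_preimage_comp_equiv e.siteEquiv h
  exact ⟨T.relocate (l ∘ e.siteEquiv) h', τ, hτ, htτ,
    (stateClass_relocate_iso hτ hω e he h' h fun _ => rfl).symm⟩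

theorem finite_preimage_comp (S : SpinSystem) {g : ℂ → ℂ}
    (hg : Tendsto g (cocompact ℂ) (cocompact ℂ)) (K : Set ℂ) (hK : IsCompact K) :
    ((g ∘ S.loc) ⁻¹' K).Finite := by
  obtain ⟨K', hK', hs⟩ := mem_cocompact.1 (hg hK.compl_mem_cocompact)
  refine (S.locallyFinite K' hK').subset fun j hj => ?_
  by_contra hn
  exact hs hn hj

/-- The class of the state `ψ` after the sites have been moved by the proper map `g`. -/
def movedClass (S : SpinSystem) {ψ : S.Functional} (hψ : IsState ψ) (g : ℂ → ℂ)
    (hg : Tendsto g (cocompact ℂ) (cocompact ℂ)) : StateClass :=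
  stateClass (S.relocate (g ∘ S.loc) (finite_preimage_comp S hg)) ψ hψ

/-- The map that pushes the closed disk of radius `r` radially out to the circle of radius `r + 1`. -/
def pushOut (r : ℝ) (x : ℂ) : ℂ := if ‖x‖ ≤ r then (((r + 1) / ‖x‖ : ℝ) : ℂ) * x else x

theorem pushOut_of_lt {r : ℝ} {x : ℂ} (h : r < ‖x‖) : pushOut r x = x := if_neg h.not_ge

theorem pushOut_mem_cone {r : ℝ} (hr : 0 ≤ r) {I : Set Circle} {x : ℂ} (hx : x ∈ cone 0 I) :
    pushOut r x ∈ cone 0 I ∧ r < ‖pushOut r x‖ := by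
  by_cases h : ‖x‖ ≤ r
  · obtain ⟨s, hs, ζ, hζ, rfl⟩ := hx
    have hn : ‖(0 : ℂ) + s * (ζ : ℂ)‖ = s := by
      rw [zero_add, norm_mul, Circle.norm_coe, Complex.norm_real, Real.norm_of_nonneg hs.le, mul_one]
    have he : pushOut r (0 + s * (ζ : ℂ)) = 0 + ((r + 1 : ℝ) : ℂ) * ζ := by
      rw [pushOut, if_pos h, hn, zero_add, zero_add, ← mul_assoc, ← Complex.ofReal_mul,
        div_mul_cancel₀ _ hs.ne']
    rw [he]
    refine ⟨⟨r + 1, by linarith, ζ, hζ, rfl⟩, ?_⟩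
    rw [zero_add, norm_mul, Circle.norm_coe, Complex.norm_real, Real.norm_of_nonneg (by linarith [hr])]
    linarith
  · rw [pushOut, if_neg h]
    exact ⟨hx, not_le.1 h⟩

theorem pushOut_eqOn (S : SpinSystem) (r : ℝ) (g : ℂ → ℂ) :
    ∃ E : Finset S.Site, ∀ j ∉ E, g (pushOut r (S.loc j)) = g (S.loc j) := by
  refine ⟨(S.locallyFinite _ (isCompact_closedBall 0 r)).toFinset, fun j hj => ?_⟩
  rw [Set.Finite.mem_toFinset, Set.mem_preimage, mem_closedBall_zero_iff, not_le] at hj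
  rw [pushOut_of_lt hj]

/-- There is a good conical cover with apex `0` such that, outside a compact set, the maps `g` and
`h` send each of its cones into one and the same narrow cone with apex `p`. -/
def Squeezes (p : ℂ) (ε : ℝ) (g h : ℂ → ℂ) : Prop :=
  ∃ (C : GoodConicalCover) (z : Fin C.card → Circle) (r : ℝ), C.apex = 0 ∧ 0 ≤ r ∧
    ∀ a, ∀ x ∈ cone 0 (C.base a), r < ‖x‖ →
      g x ∈ cone p (Metric.ball (z a) ε) ∧ h x ∈ cone p (Metric.ball (z a) ε)

/-- An invertible state and its inverse still cancel after their sites have been moved by two maps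
`g` and `h`, if these are close to each other at infinity: the cones of a sufficiently fine cover are
moved into narrow cones, and so the automorphism that trivializes the stack becomes a circuit. -/
theorem exists_moved_inverse {S : SpinSystem} {ψ : S.Functional} (hi : IsInvertible ψ)
    (hψ : IsState ψ) :
    ∃ (S' : SpinSystem) (ψ' : S'.Functional) (hψ' : IsState ψ'), ∀ (p : ℂ) (ε : ℝ) (g h : ℂ → ℂ)
      (hg : Tendsto g (cocompact ℂ) (cocompact ℂ)) (hh : Tendsto h (cocompact ℂ) (cocompact ℂ)),
      Squeezes p ε g h →
        StablyRelated p ε 2 (movedClass S hψ g hg * movedClass S' hψ' h hh) 1 := by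
  obtain ⟨-, S', ψ', ω, -, ht, T, τ, hτ, -, -, hC⟩ := hi
  obtain ⟨-, hψ', hω, -⟩ := id ht
  refine ⟨S', ψ', hψ', fun p ε g h hg hh ⟨C, z, r, h0, hr, hz⟩ => ?_⟩
  obtain ⟨R, ω₁, ω₂, α, ⟨T₁, τ₁, ω', e, hτ₁, ht₁, he₁⟩, h2, hα, he⟩ := hC C
  have hω₁ := he₁.2.1
  have hω₂ := IsTrivialExtension.isState h2
  have hω' := he₁.1
  have hτ₁' := ht₁.2.1
  have htriv : IsTrivialClass (stateClass R ω₂ hω₂) := by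
    obtain ⟨q, hq, hq'⟩ := (isTrivialExtension_iff hτ.1.isState hω₂).1 h2
    rw [hq']
    exact IsTrivialClass.mul ⟨T, τ, _, hτ, rfl⟩ hq
  obtain ⟨E, hE⟩ := pushOut_eqOn S r g
  obtain ⟨E', hE'⟩ := pushOut_eqOn S' r h
  obtain ⟨E₁, hE₁⟩ := pushOut_eqOn T₁ r g
  have f := finite_preimage_of_eqOn (l' := g ∘ pushOut r ∘ S.loc) E hE (finite_preimage_comp S hg)
  have f' := finite_preimage_of_eqOn (l' := h ∘ pushOut r ∘ S'.loc) E' hE'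
    (finite_preimage_comp S' hh)
  have f₁ := finite_preimage_of_eqOn (l' := g ∘ pushOut r ∘ T₁.loc) E₁ hE₁
    (finite_preimage_comp T₁ hg)
  have fs := finite_preimage_sumElim f f'
  have ft := finite_preimage_sumElim fs f₁
  have hR : ∀ K : Set ℂ, IsCompact K →
      ((Sum.elim (Sum.elim (g ∘ pushOut r ∘ S.loc) (h ∘ pushOut r ∘ S'.loc))
        (g ∘ pushOut r ∘ T₁.loc) ∘ e.siteEquiv.symm) ⁻¹' K).Finite :=
    finite_preimage_comp_equiv e.siteEquiv.symm ft
  have hq : stateClass (R.relocate _ hR) ω₁ hω₁ =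
      stateClass (S.relocate _ f) ψ hψ * stateClass (S'.relocate _ f') ψ' hψ' *
        stateClass (T₁.relocate _ f₁) τ₁ hτ₁' := by
    rw [← stateClass_relocate_stack hψ hψ' hω ((isTensorState_iff hψ hψ' hω).2 ht) f f' fs,
      ← stateClass_relocate_stack hω hτ₁' hω' ((isTensorState_iff hω hτ₁' hω').2 ht₁) fs f₁ ft]
    exact (stateClass_relocate_iso hω' hω₁ e he₁ ft hR fun j =>
      congrArg (Sum.elim (Sum.elim (g ∘ pushOut r ∘ S.loc) (h ∘ pushOut r ∘ S'.loc))
        (g ∘ pushOut r ∘ T₁.loc)) (e.siteEquiv.symm_apply_apply j).symm).symm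
  have := hω₁.nonempty_config
  have hmem : ∀ a k, ((S.stack S').stack T₁).loc k ∈ cone C.apex (C.base a) →
      Sum.elim (Sum.elim (g ∘ pushOut r ∘ S.loc) (h ∘ pushOut r ∘ S'.loc))
        (g ∘ pushOut r ∘ T₁.loc) k ∈ cone p (Metric.ball (z a) ε) := by
    intro a k hk
    rw [h0] at hk
    obtain ((k | k) | k) := k
    · obtain ⟨h3, h4⟩ := pushOut_mem_cone hr hk
      exact (hz a _ h3 h4).1
    · obtain ⟨h3, h4⟩ := pushOut_mem_cone hr hk
      exact (hz a _ h3 h4).2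
    · obtain ⟨h3, h4⟩ := pushOut_mem_cone hr hk
      exact (hz a _ h3 h4).1
  have hcirc := IsCLocal.isCircuit hα hR (p := p) (ε := ε) z fun a j hj => hmem a _ (by
    rwa [e.loc_eq, e.siteEquiv.apply_symm_apply])
  have h1 : StablyRelated p ε 2
      (stateClass (S.relocate _ f) ψ hψ * stateClass (S'.relocate _ f') ψ' hψ') 1 :=
    ⟨_, _, IsTrivialClass.relocate ⟨T₁, τ₁, hτ₁', hτ₁, rfl⟩ f₁, htriv.relocate hR,
      R.relocate _ hR, ω₁, ω₂, hω₁, hω₂, α, hq.symm, one_mul _, hcirc, he⟩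
  have h5 := (stablyRelated_relocate (p := p) (ε := ε) S hψ _ (finite_preimage_comp S hg) E _ f hE).mul
    (stablyRelated_relocate S' hψ' _ (finite_preimage_comp S' hh) E' _ f' hE')
  have h6 := h5.trans h1
  rwa [zero_add] at h6

end

/-! ### From a chain of maps to the phase -/

section

open SpinSystem Filter

theorem IsOpenInterval.isOpen {I : Set Circle} (h : IsOpenInterval I) : IsOpen I := by
  obtain ⟨l, r, -, -, rfl⟩ := h
  exact isLocalHomeomorph_circleExp.isOpenMap _ isOpen_Ioo

theorem GoodConicalCover.exists_lebesgue_number (C : GoodConicalCover) :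
    ∃ ε > 0, ∀ z, ∃ a, Metric.ball z (9 * ε) ⊆ C.base a := by
  obtain ⟨δ, hδ, h⟩ := lebesgue_number_lemma_of_metric (isCompact_univ (X := Circle))
    (fun a => (C.isOpenInterval a).isOpen) C.covers.ge
  refine ⟨δ / 9, by positivity, fun z => ?_⟩
  rw [mul_div_cancel₀ _ (by norm_num : (9 : ℝ) ≠ 0)]
  exact h z (Set.mem_univ z)

theorem movedClass_congr (S : SpinSystem) {ψ : S.Functional} (hψ : IsState ψ) {g g' : ℂ → ℂ}
    (e : g = g') (hg : Tendsto g (cocompact ℂ) (cocompact ℂ))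
    (hg' : Tendsto g' (cocompact ℂ) (cocompact ℂ)) : movedClass S hψ g hg = movedClass S hψ g' hg' := by
  subst e
  rfl

/-- An invertible state and its pushforward under `f` are in the same phase if `f` can be connected
to the identity by a chain of maps such that any two neighbours are close to each other at infinity.
-/
theorem samePhase_pushState_of_chain {S : SpinSystem} {ψ : S.Functional} (hi : IsInvertible ψ)
    (f : ℂ ≃ₜ ℂ)
    (hf : ∀ (p : ℂ) (ε : ℝ), 0 < ε → ∃ (n : ℕ) (g : ℕ → ℂ → ℂ), g 0 = id ∧ g n = f ∧
      (∀ k, Tendsto (g k) (cocompact ℂ) (cocompact ℂ)) ∧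
      ∀ k < n, Squeezes p ε (g k) (g k) ∧ Squeezes p ε (g (k + 1)) (g k)) :
    SamePhase ψ (pushState f ψ) := by
  refine ⟨hi.1, hi.1, fun C => ?_⟩
  have hψ := hi.1.isState
  obtain ⟨ε, hε, hC⟩ := C.exists_lebesgue_number
  obtain ⟨n, g, h0, hn, hg, hs⟩ := hf C.apex ε hε
  obtain ⟨S', ψ', hψ', hinv⟩ := exists_moved_inverse hi hψ
  have h1 := StablyRelated.chain (n := n) (ψ := fun k => movedClass S hψ (g k) (hg k))
    (ψ' := fun k => movedClass S' hψ' (g k) (hg k))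
    (fun k hk => hinv C.apex ε _ _ (hg k) (hg k) (hs k hk).1)
    (fun k hk => hinv C.apex ε _ _ (hg (k + 1)) (hg k) (hs k hk).2)
  have e0 : movedClass S hψ (g 0) (hg 0) = stateClass S ψ hψ :=
    (movedClass_congr S hψ h0 (hg 0) tendsto_id).trans rfl
  have en : movedClass S hψ (g n) (hg n) = stateClass (S.push f) (pushState f ψ) hψ :=
    (movedClass_congr S hψ hn (hg n) (hn ▸ hg n)).trans rfl
  simp only [e0, en] at h1
  obtain ⟨t, t', ht, ht', R, ω, ω', hω, hω', α, hq, hq', hα, he⟩ := h1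
  have := hω.nonempty_config
  exact ⟨R, ω, ω', α, (isTrivialExtension_iff hψ hω).2 ⟨t, ht, hq.symm⟩,
    (isTrivialExtension_iff (S := S.push f) hψ hω').2 ⟨t', ht', hq'.symm⟩, hα.isCLocal hε hC, he⟩

end

/-! ### Fine conical covers -/

section

open SpinSystem Filter

/-- The `a`-th of `N` arcs that cover the circle: the open interval `(a - 1 / 4, a + 5 / 4)` in units
of `2 * π / N`, which overlaps with the two neighbouring arcs only. -/
def arc (N : ℕ) (a : ℤ) : Set Circle :=
  Circle.exp '' Set.Ioo (2 * Real.pi / N * (a - 1 / 4)) (2 * Real.pi / N * (a + 5 / 4))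

theorem exp_mem_arc {N : ℕ} (hN : 0 < N) {a : ℤ} {u : ℝ} :
    Circle.exp (2 * Real.pi / N * u) ∈ arc N a ↔
      ∃ m : ℤ, (a : ℝ) - 1 / 4 < u - N * m ∧ u - N * m < a + 5 / 4 := by
  have hN' : (0 : ℝ) < N := Nat.cast_pos.2 hN
  have hh : 0 < 2 * Real.pi / N := by positivity
  have hm : ∀ m : ℤ, 2 * Real.pi / N * (u - N * m) = 2 * Real.pi / N * u - m * (2 * Real.pi) := by
    intro m
    field_simp
  constructor
  · rintro ⟨t, ⟨h1, h2⟩, he⟩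
    obtain ⟨m, hm'⟩ := Circle.exp_eq_exp.1 he.symm
    have : t = 2 * Real.pi / N * (u - N * m) := by rw [hm]; linarith
    rw [this] at h1 h2
    exact ⟨m, lt_of_mul_lt_mul_left h1 hh.le, lt_of_mul_lt_mul_left h2 hh.le⟩
  · rintro ⟨m, h1, h2⟩
    refine ⟨2 * Real.pi / N * (u - N * m), ⟨mul_lt_mul_of_pos_left h1 hh,
      mul_lt_mul_of_pos_left h2 hh⟩, Circle.exp_eq_exp.2 ⟨-m, ?_⟩⟩
    rw [hm]
    push_cast
    ring

theorem exists_exp_eq {N : ℕ} (hN : 0 < N) (z : Circle) :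
    ∃ u : ℝ, Circle.exp (2 * Real.pi / N * u) = z := by
  obtain ⟨t, rfl⟩ := Circle.exp_surjective z
  have hN' : (0 : ℝ) < N := Nat.cast_pos.2 hN
  exact ⟨t / (2 * Real.pi / N), by rw [mul_div_cancel₀ _ (by positivity)]⟩

theorem contractibleSpace_exp_image {K : Set ℝ} (hK : Convex ℝ K) (hne : K.Nonempty) {l r : ℝ}
    (hlr : r - l < 2 * Real.pi) (hs : K ⊆ Set.Ioo l r) : ContractibleSpace ↥(Circle.exp '' K) := by
  have hinj : Function.Injective fun t : Set.Ioo l r => Circle.exp t := fun t t' h =>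
    Subtype.ext (Circle.exp_injOn_Icc hlr (Set.Ioo_subset_Icc_self t.2)
      (Set.Ioo_subset_Icc_self t'.2) h)
  have h1 : Topology.IsOpenEmbedding fun t : Set.Ioo l r => Circle.exp t :=
    .of_continuous_injective_isOpenMap (Circle.exp.continuous.comp continuous_subtype_val) hinj
      (isLocalHomeomorph_circleExp.isOpenMap.comp isOpen_Ioo.isOpenMap_subtype_val)
  have h2 : Topology.IsEmbedding fun t : K => Circle.exp t :=
    h1.isEmbedding.comp (Topology.IsEmbedding.inclusion hs)
  have h3 : Set.range (fun t : K => Circle.exp t) = Circle.exp '' K := by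
    rw [Set.image_eq_range]
  have := hK.contractibleSpace hne
  exact ((h2.toHomeomorph.trans (Homeomorph.setCongr h3)).contractibleSpace_iff).1 this

theorem contractibleSpace_biInter_arc {N : ℕ} (hN : 3 ≤ N) {ι : Type} (c : ι → ℤ) {s : Finset ι}
    (hs : s.Nonempty) (hne : (⋂ a ∈ s, arc N (c a)).Nonempty) :
    ContractibleSpace ↥(⋂ a ∈ s, arc N (c a)) := by
  obtain ⟨a, ha⟩ := hs
  have hN0 : 0 < N := by omega
  have hN' : (3 : ℝ) ≤ N := by exact_mod_cast hN
  have hpi := Real.pi_pos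
  have hh : 0 < 2 * Real.pi / N := by positivity
  let K : Set ℝ := {t | t ∈ Set.Ioo (2 * Real.pi / N * (c a - 1 / 4)) (2 * Real.pi / N * (c a + 5 / 4)) ∧
    ∀ b ∈ s, Circle.exp t ∈ arc N (c b)}
  have hK : Circle.exp '' K = ⋂ a ∈ s, arc N (c a) := by
    ext z
    simp only [Set.mem_iInter]
    constructor
    · rintro ⟨t, ht, rfl⟩ b hb
      exact ht.2 b hb
    · intro hz
      obtain ⟨t, ht, rfl⟩ := hz a ha
      exact ⟨t, ⟨ht, hz⟩, rfl⟩
  rw [← hK] at hne ⊢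
  refine contractibleSpace_exp_image (Set.OrdConnected.convex ⟨?_⟩) hne.of_image ?_ fun t ht => ht.1
  · rintro t₁ ⟨⟨h1, h1'⟩, h1''⟩ t₂ ⟨⟨h2, h2'⟩, h2''⟩ t ⟨ht1, ht2⟩
    refine ⟨⟨h1.trans_le ht1, ht2.trans_lt h2'⟩, fun b hb => ?_⟩
    obtain ⟨u₁, rfl⟩ : ∃ u, t₁ = 2 * Real.pi / N * u := ⟨_, (mul_div_cancel₀ _ hh.ne').symm⟩
    obtain ⟨u₂, rfl⟩ : ∃ u, t₂ = 2 * Real.pi / N * u := ⟨_, (mul_div_cancel₀ _ hh.ne').symm⟩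
    obtain ⟨u, rfl⟩ : ∃ u, t = 2 * Real.pi / N * u := ⟨_, (mul_div_cancel₀ _ hh.ne').symm⟩
    replace h1 := lt_of_mul_lt_mul_left h1 hh.le
    replace h2' := lt_of_mul_lt_mul_left h2' hh.le
    replace ht1 := le_of_mul_le_mul_left ht1 hh
    replace ht2 := le_of_mul_le_mul_left ht2 hh
    obtain ⟨m, h3, h4⟩ := (exp_mem_arc hN0).1 (h1'' b hb)
    obtain ⟨m', h5, h6⟩ := (exp_mem_arc hN0).1 (h2'' b hb)
    -- Two different lifts of the `b`-th arc are too far apart to meet the `a`-th arc both.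
    have hmm : m = m' := by
      by_contra hne
      rcases lt_or_gt_of_ne hne with hlt | hlt
      · have : (m : ℝ) + 1 ≤ m' := by exact_mod_cast hlt
        nlinarith
      · have : (m' : ℝ) + 1 ≤ m := by exact_mod_cast hlt
        nlinarith
    subst hmm
    exact (exp_mem_arc hN0).2 ⟨m, by linarith, by linarith⟩
  · rw [← mul_sub, div_mul_eq_mul_div, div_lt_iff₀ (by positivity)]
    nlinarith

theorem eq_of_sub_mul_eq {N a b : ℕ} (ha : a < N) (hb : b < N) {m : ℤ} (h : (a : ℤ) - N * m = b) :
    a = b := by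
  have h1 : (a : ℤ) = b + N * m := by linarith
  have h2 := congrArg (· % (N : ℤ)) h1
  simp only [Int.add_mul_emod_self_left] at h2
  rw [Int.emod_eq_of_lt (by positivity) (by exact_mod_cast ha),
    Int.emod_eq_of_lt (by positivity) (by exact_mod_cast hb)] at h2
  exact_mod_cast h2

theorem disjoint_arc {M a b : ℕ} (ha : a < 2 * M) (hb : b < 2 * M) (hab : a ≠ b)
    (hp : a % 2 = b % 2) : Disjoint (arc (2 * M) a) (arc (2 * M) b) := by
  have hM0 : 0 < 2 * M := by omega
  rw [Set.disjoint_left]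
  intro z hz hz'
  obtain ⟨u, rfl⟩ := exists_exp_eq hM0 z
  obtain ⟨m, h1, h2⟩ := (exp_mem_arc hM0).1 hz
  obtain ⟨m', h3, h4⟩ := (exp_mem_arc hM0).1 hz'
  push_cast at h1 h2 h3 h4
  have h5 : (a : ℤ) - b + 2 * (M * (m - m')) < 2 := by
    have : (a : ℝ) - b + 2 * (M * (m - m')) < 2 := by linarith
    exact_mod_cast this
  have h6 : -2 < (a : ℤ) - b + 2 * (M * (m - m')) := by
    have : -2 < (a : ℝ) - b + 2 * (M * (m - m')) := by linarith
    exact_mod_cast this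
  refine hab (eq_of_sub_mul_eq ha hb (m := -(m - m')) ?_)
  push_cast
  rw [mul_neg, mul_assoc]
  generalize (M : ℤ) * (m - m') = k at *
  omega

/-- The cover of the plane by the `2 * M` cones with apex `0` over the arcs. -/
def arcCover (M : ℕ) (hM : 2 ≤ M) : GoodConicalCover where
  card := 2 * M
  apex := 0
  base a := arc (2 * M) (a : ℕ)
  isOpenInterval a := by
    have hM' : (2 : ℝ) ≤ M := by exact_mod_cast hM
    have hpi := Real.pi_pos
    refine ⟨_, _, ?_, ?_, rfl⟩
    · exact mul_lt_mul_of_pos_left (by linarith) (by positivity)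
    · rw [← sub_le_iff_le_add', ← mul_sub, div_mul_eq_mul_div, div_le_iff₀ (by positivity)]
      push_cast
      nlinarith
  covers := by
    refine Set.eq_univ_of_forall fun z => ?_
    have hM0 : 0 < 2 * M := by omega
    obtain ⟨u, rfl⟩ := exists_exp_eq hM0 z
    have hpos : (0 : ℤ) < (2 * M : ℕ) := by exact_mod_cast hM0
    have h1 := Int.emod_nonneg ⌊u⌋ hpos.ne'
    have h2 := Int.emod_lt_of_pos ⌊u⌋ hpos
    have h3 := Int.emod_add_mul_ediv ⌊u⌋ (2 * M : ℕ)
    refine Set.mem_iUnion.2 ⟨⟨(⌊u⌋ % (2 * M : ℕ)).toNat, by omega⟩,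
      (exp_mem_arc hM0).2 ⟨⌊u⌋ / (2 * M : ℕ), ?_⟩⟩
    have h4 : ((((⌊u⌋ % (2 * M : ℕ)).toNat : ℕ) : ℤ) : ℝ) =
        ⌊u⌋ - (2 * M : ℕ) * (⌊u⌋ / (2 * M : ℕ) : ℤ) := by
      rw [Int.toNat_of_nonneg h1]
      exact_mod_cast eq_sub_of_add_eq h3
    simp only [h4]
    constructor <;> linarith [Int.floor_le u, Int.lt_floor_add_one u]
  contractible s hs hne :=
    contractibleSpace_biInter_arc (by omega) (fun a : Fin (2 * M) => ((a : ℕ) : ℤ)) hs hne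
  inter_ssubset a b hab := by
    have hM0 : 0 < 2 * M := by omega
    refine Set.inter_ssubset_left_iff.2 fun hs => hab ?_
    have h0 : Circle.exp (2 * Real.pi / (2 * M : ℕ) * ((a : ℕ) + 1 / 2)) ∈
        arc (2 * M) (a : ℕ) := (exp_mem_arc hM0).2 ⟨0, by push_cast; linarith, by push_cast; linarith⟩
    obtain ⟨m, h1, h2⟩ := (exp_mem_arc hM0).1 (hs h0)
    have h3 : ((b : ℕ) : ℤ) - 1 < (a : ℕ) - (2 * M : ℕ) * m := by
      have : (((b : ℕ) : ℤ) : ℝ) - 1 < ((a : ℕ) : ℤ) - (2 * M : ℕ) * m := by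
        push_cast at *; linarith
      exact_mod_cast this
    have h4 : ((a : ℕ) : ℤ) - (2 * M : ℕ) * m < (b : ℕ) + 1 := by
      have : ((a : ℕ) : ℤ) - (2 * M : ℕ) * m < (((b : ℕ) : ℤ) : ℝ) + 1 := by
        push_cast at *; linarith
      exact_mod_cast this
    exact Fin.ext (eq_of_sub_mul_eq a.2 b.2 (m := m) (by omega))
  twoFamilies := by
    refine ⟨Finset.univ.filter fun a => (a : ℕ) % 2 = 0, Finset.univ.filter fun a => (a : ℕ) % 2 ≠ 0,
      Finset.disjoint_filter_filter_not _ _ _, Finset.filter_union_filter_not_eq _ _, ?_, ?_⟩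
    · intro a ha b hb hab
      have ha' := (Finset.mem_filter.1 ha).2
      have hb' := (Finset.mem_filter.1 hb).2
      exact cone_disjoint (disjoint_arc a.2 b.2 (fun h => hab (Fin.ext h)) (by omega))
    · intro a ha b hb hab
      have ha' := (Finset.mem_filter.1 ha).2
      have hb' := (Finset.mem_filter.1 hb).2
      exact cone_disjoint (disjoint_arc a.2 b.2 (fun h => hab (Fin.ext h)) (by omega))

/-- There are good conical covers by arbitrarily narrow cones. -/
theorem exists_fine_cover {δ : ℝ} (hδ : 0 < δ) :
    ∃ C : GoodConicalCover, C.apex = 0 ∧ ∀ a, ∃ t, C.base a ⊆ Circle.exp '' Metric.ball t δ := by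
  obtain ⟨n, hn⟩ := exists_nat_gt (2 * Real.pi / δ)
  refine ⟨arcCover (n + 2) (by omega), rfl, fun a =>
    ⟨2 * Real.pi / (2 * (n + 2) : ℕ) * ((a : ℕ) + 1 / 2), Set.image_mono fun t ht => ?_⟩⟩
  rw [div_lt_iff₀ hδ] at hn
  have hh : 2 * Real.pi / (2 * (n + 2) : ℕ) < δ := by
    rw [div_lt_iff₀ (by positivity)]
    push_cast
    nlinarith
  have hpi := Real.pi_pos
  have h0 : 0 < 2 * Real.pi / (2 * (n + 2) : ℕ) := by positivity
  obtain ⟨h1, h2⟩ := ht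
  push_cast at h1 h2 hh h0 ⊢
  rw [Metric.mem_ball, Real.dist_eq, abs_lt]
  constructor <;> nlinarith

end

/-! ### Directions at infinity -/

section

open SpinSystem Filter Topology

theorem mem_cone_of_norm_lt {p w : ℂ} {ε : ℝ} {ζ : Circle} (hw : w ≠ p)
    (h : ‖(w - p) / ‖w - p‖ - ζ‖ < ε) : w ∈ cone p (Metric.ball ζ ε) := by
  have h0 : 0 < ‖w - p‖ := norm_pos_iff.2 (sub_ne_zero.2 hw)
  have h1 : ((‖w - p‖ : ℝ) : ℂ) ≠ 0 := Complex.ofReal_ne_zero.2 h0.ne'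
  refine ⟨‖w - p‖, h0, ⟨(w - p) / ‖w - p‖, ?_⟩, ?_, ?_⟩
  · refine mem_sphere_zero_iff_norm.2 ?_
    rw [norm_div, Complex.norm_real, norm_norm, div_self h0.ne']
  · change dist ((w - p) / ‖w - p‖) (ζ : ℂ) < ε
    rwa [dist_eq_norm]
  · change w = p + ‖w - p‖ * ((w - p) / ‖w - p‖)
    rw [mul_div_cancel₀ _ h1, add_sub_cancel]

/-- Far away, the direction of a point does not depend on the point of view. -/
theorem eventually_direction (p : ℂ) {ε : ℝ} (hε : 0 < ε) :
    ∀ᶠ w in cocompact ℂ, w ≠ p ∧ ‖(w - p) / ‖w - p‖ - w / ‖w‖‖ < ε := by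
  have h1 := tendsto_norm_cocompact_atTop (E := ℂ) (eventually_gt_atTop (‖p‖ + 2 * ‖p‖ / ε))
  filter_upwards [h1] with w hw
  replace hw : ‖p‖ + 2 * ‖p‖ / ε < ‖w‖ := hw
  have hp := norm_nonneg p
  have hp' : 0 ≤ 2 * ‖p‖ / ε := by positivity
  have hwp : w ≠ p := by
    rintro rfl
    linarith
  have hw0 : 0 < ‖w‖ := by linarith
  refine ⟨hwp, ?_⟩
  have h0 : 0 < ‖w - p‖ := norm_pos_iff.2 (sub_ne_zero.2 hwp)
  have h0' : ((‖w - p‖ : ℝ) : ℂ) ≠ 0 := Complex.ofReal_ne_zero.2 h0.ne'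
  have hw0' : ((‖w‖ : ℝ) : ℂ) ≠ 0 := Complex.ofReal_ne_zero.2 hw0.ne'
  have e : (w - p) / ‖w - p‖ - w / ‖w‖ =
      (((w - p) / ‖w - p‖) * ((‖w‖ - ‖w - p‖ : ℝ) : ℂ) - p) / ‖w‖ := by
    push_cast
    field_simp
    ring
  have h2 : ‖(w - p) / ((‖w - p‖ : ℝ) : ℂ)‖ = 1 := by
    rw [norm_div, Complex.norm_real, norm_norm, div_self h0.ne']
  have h3 : |‖w‖ - ‖w - p‖| ≤ ‖p‖ := by
    have := abs_norm_sub_norm_le w (w - p)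
    rwa [sub_sub_cancel] at this
  rw [e, norm_div, Complex.norm_real, norm_norm, div_lt_iff₀ hw0]
  calc _ ≤ ‖(w - p) / ((‖w - p‖ : ℝ) : ℂ) * ((‖w‖ - ‖w - p‖ : ℝ) : ℂ)‖ + ‖p‖ := norm_sub_le _ _
    _ ≤ ‖p‖ + ‖p‖ := by
      rw [norm_mul, h2, one_mul, Complex.norm_real, Real.norm_eq_abs]
      linarith
    _ < ε * ‖w‖ := by
      have : 2 * ‖p‖ / ε < ‖w‖ := by linarith
      rw [div_lt_iff₀ hε] at this
      linarith

theorem tendsto_tanh_atTop : Tendsto Real.tanh atTop (𝓝 1) := by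
  have h1 : ∀ x, Real.tanh x = (1 - Real.exp (-(2 * x))) / (1 + Real.exp (-(2 * x))) := fun x => by
    rw [Real.tanh_eq_sinh_div_cosh, Real.sinh_eq, Real.cosh_eq]
    have h2 : Real.exp (-x) = Real.exp x * Real.exp (-(2 * x)) := by
      rw [← Real.exp_add]
      ring_nf
    have h3 := Real.exp_pos x
    rw [h2]
    field_simp
  have h4 : Tendsto (fun x : ℝ => Real.exp (-(2 * x))) atTop (𝓝 0) :=
    Real.tendsto_exp_neg_atTop_nhds_zero.comp (tendsto_id.const_mul_atTop two_pos)
  have h5 := (h4.const_sub 1).div (h4.const_add 1) (by norm_num)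
  simp only [sub_zero, add_zero, div_one] at h5
  exact h5.congr fun x => (h1 x).symm

theorem eventually_radialContraction {ε : ℝ} (hε : 0 < ε) :
    ∀ᶠ w in cocompact ℂ, ‖w / ‖w‖ - (radialContraction w : ℂ)‖ < ε := by
  have h1 := tendsto_tanh_atTop.comp (tendsto_norm_cocompact_atTop (E := ℂ))
  have h2 := h1 (Metric.ball_mem_nhds 1 hε)
  filter_upwards [h2] with w hw
  rw [Set.mem_preimage, Metric.mem_ball, Real.dist_eq, abs_sub_comm] at hw
  have e : w / ‖w‖ - (radialContraction w : ℂ) = ((1 - Real.tanh ‖w‖ : ℝ) : ℂ) * (w / ‖w‖) := by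
    change _ - (Real.tanh ‖w‖ : ℂ) * (w / ‖w‖) = _
    push_cast
    ring
  rw [e, norm_mul, Complex.norm_real, norm_div, Complex.norm_real, norm_norm]
  refine lt_of_le_of_lt (mul_le_of_le_one_right (norm_nonneg _) (div_self_le_one _)) hw

theorem norm_ofReal_mul_exp {s : ℝ} (hs : 0 ≤ s) (t : ℝ) : ‖(s : ℂ) * Circle.exp t‖ = s := by
  rw [norm_mul, Circle.norm_coe, Complex.norm_real, Real.norm_of_nonneg hs, mul_one]

theorem exists_radius {P : ℂ → Prop} (h : ∀ᶠ w in cocompact ℂ, P w) :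
    ∃ r, 0 < r ∧ ∀ w, r ≤ ‖w‖ → P w := by
  rw [← Metric.cobounded_eq_cocompact, ← comap_norm_atTop, eventually_comap, eventually_atTop] at h
  obtain ⟨r, hr⟩ := h
  exact ⟨max r 1, by positivity, fun w hw => hr _ ((le_max_left _ _).trans hw) w rfl⟩

/-- The direction of `g x`, seen from `p`, is `φ t` up to `ε` if `x` is a far away point in the
direction `t`. -/
def HasDirection (p : ℂ) (ε : ℝ) (g : ℂ → ℂ) (φ : ℝ → ℝ) : Prop :=
  ∃ r, ∀ s t : ℝ, r ≤ s → g (s * Circle.exp t) ∈ cone p (Metric.ball (Circle.exp (φ t)) ε)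

theorem dist_exp_le (s t : ℝ) : dist (Circle.exp s) (Circle.exp t) ≤ |s - t| := by
  have := Real.norm_exp_I_mul_ofReal_sub_one_le (x := s - t)
  change dist (Circle.exp s : ℂ) (Circle.exp t : ℂ) ≤ _
  rw [dist_eq_norm, Circle.coe_exp, Circle.coe_exp]
  have e : Complex.exp (s * Complex.I) - Complex.exp (t * Complex.I) =
      Complex.exp (t * Complex.I) * (Complex.exp (Complex.I * (s - t : ℝ)) - 1) := by
    rw [mul_sub, mul_one, ← Complex.exp_add]
    congr 2
    push_cast
    ring
  rw [e, norm_mul, Complex.norm_exp_ofReal_mul_I, one_mul]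
  exact this

/-- Maps whose directions at infinity are close to each other squeeze sufficiently narrow cones. -/
theorem HasDirection.squeezes {p : ℂ} {ε : ℝ} (hε : 0 < ε) {g h : ℂ → ℂ} {φ χ : ℝ → ℝ}
    (hg : HasDirection p (ε / 4) g φ) (hh : HasDirection p (ε / 4) h χ) (hφ : UniformContinuous φ)
    (hd : ∀ t, |χ t - φ t| ≤ ε / 4) : Squeezes p ε g h := by
  obtain ⟨r, hr⟩ := hg
  obtain ⟨r', hr'⟩ := hh
  obtain ⟨δ, hδ, hδ'⟩ := Metric.uniformContinuous_iff.1 hφ (ε / 4) (by linarith)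
  obtain ⟨C, h0, hC⟩ := exists_fine_cover hδ
  choose c hc using hC
  refine ⟨C, fun a => Circle.exp (φ (c a)), max 0 (max r r'), h0, le_max_left _ _,
    fun a x hx hxr => ?_⟩
  obtain ⟨s, hs, ζ, hζ, rfl⟩ := hx
  obtain ⟨t, ht, rfl⟩ := hc a hζ
  rw [zero_add] at hxr ⊢
  rw [norm_ofReal_mul_exp hs.le] at hxr
  have hrs : r ≤ s := (le_max_left _ _).trans ((le_max_right _ _).trans hxr.le)
  have hrs' : r' ≤ s := (le_max_right _ _).trans ((le_max_right _ _).trans hxr.le)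
  have h1 : dist (Circle.exp (φ t)) (Circle.exp (φ (c a))) < ε / 4 :=
    (dist_exp_le _ _).trans_lt (hδ' ht)
  have h2 := (dist_exp_le (χ t) (φ t)).trans (hd t)
  refine ⟨cone_mono (Metric.ball_subset_ball' ?_) (hr s t hrs),
    cone_mono (Metric.ball_subset_ball' ?_) (hr' s t hrs')⟩
  · linarith
  · linarith [dist_triangle (Circle.exp (χ t)) (Circle.exp (φ t)) (Circle.exp (φ (c a)))]

/-- The map that preserves the norm and turns the direction `t` into the direction `φ t`. -/
def turn (φ : ℝ → ℝ) (x : ℂ) : ℂ := ‖x‖ * Circle.exp (φ x.arg)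

theorem tendsto_turn (φ : ℝ → ℝ) : Tendsto (turn φ) (cocompact ℂ) (cocompact ℂ) := by
  rw [← Metric.cobounded_eq_cocompact, ← comap_norm_atTop, tendsto_comap_iff]
  refine tendsto_comap.congr fun x => ?_
  exact (norm_ofReal_mul_exp (norm_nonneg x) _).symm

theorem turn_id : turn (fun t => t) = id := by
  funext x
  rw [turn, Circle.coe_exp, Complex.norm_mul_exp_arg_mul_I, id]

theorem turn_apply {φ : ℝ → ℝ} (hφ : ∀ t, φ (t + 2 * Real.pi) = φ t + 2 * Real.pi) {s : ℝ}
    (hs : 0 < s) (t : ℝ) : turn φ (s * Circle.exp t) = s * Circle.exp (φ t) := by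
  obtain ⟨m, hm⟩ : ∃ m : ℤ, ((s : ℂ) * Circle.exp t).arg = t + m * (2 * Real.pi) := by
    refine Circle.exp_eq_exp.1 (Subtype.ext ?_)
    have h1 := Complex.norm_mul_exp_arg_mul_I ((s : ℂ) * Circle.exp t)
    rw [norm_ofReal_mul_exp hs.le] at h1
    exact mul_left_cancel₀ (Complex.ofReal_ne_zero.2 hs.ne') h1
  have hper : Function.Periodic (fun t => φ t - t) (2 * Real.pi) := fun t => by
    linarith [hφ t]
  have h2 : φ (t + m * (2 * Real.pi)) - (t + m * (2 * Real.pi)) = φ t - t := hper.int_mul m t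
  have h3 : φ (t + m * (2 * Real.pi)) = φ t + m * (2 * Real.pi) := by linarith
  rw [turn, norm_ofReal_mul_exp hs.le, hm, h3, Circle.exp_eq_exp.2 ⟨m, rfl⟩]

theorem hasDirection_turn (p : ℂ) {ε : ℝ} (hε : 0 < ε) {φ : ℝ → ℝ}
    (hφ : ∀ t, φ (t + 2 * Real.pi) = φ t + 2 * Real.pi) : HasDirection p ε (turn φ) φ := by
  obtain ⟨r, hr, h⟩ := exists_radius (eventually_direction p hε)
  refine ⟨r, fun s t hs => ?_⟩
  have hs0 : 0 < s := hr.trans_le hs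
  rw [turn_apply hφ hs0]
  obtain ⟨h1, h2⟩ := h (s * Circle.exp (φ t)) (by rwa [norm_ofReal_mul_exp hs0.le])
  refine mem_cone_of_norm_lt h1 ?_
  rwa [norm_ofReal_mul_exp hs0.le, mul_div_cancel_left₀ _ (Complex.ofReal_ne_zero.2 hs0.ne')] at h2

/-- A good homeomorphism that preserves the orientation has a limiting direction at infinity; it is
approximated by its direction on a large circle, which is a lift of a map of degree one. -/
theorem exists_hasDirection {f : ℂ ≃ₜ ℂ} (hf : IsGood f) (ho : IsOrientationPreserving f) (p : ℂ)
    {ε : ℝ} (hε : 0 < ε) :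
    ∃ φ : ℝ → ℝ, Continuous φ ∧ (∀ t, φ (t + 2 * Real.pi) = φ t + 2 * Real.pi) ∧
      HasDirection p ε f φ := by
  obtain ⟨g, hg⟩ := hf
  have hε8 : 0 < ε / 8 := by linarith
  have := isCompact_iff_compactSpace.1 (isCompact_closedBall (0 : ℂ) 1)
  obtain ⟨δ, hδ, hgδ⟩ := Metric.uniformContinuous_iff.1
    (CompactSpace.uniformContinuous_of_continuous g.continuous) (ε / 8) hε8
  have h1 := ((eventually_direction p hε8).and (eventually_direction (f 0) hε8)).and
    (eventually_radialContraction hε8)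
  obtain ⟨r, hr, h2⟩ := exists_radius ((f.isClosedEmbedding.tendsto_cocompact.eventually h1).and
    (eventually_radialContraction (half_pos hδ)))
  obtain ⟨φ, hφ, hfφ, h2π⟩ := ho 0 r hr
  simp only [zero_add, ← Circle.coe_exp] at hfφ
  have hne : ∀ t, f (r * Circle.exp t) ≠ f 0 := fun t h => by
    have h3 := f.injective h
    have h4 := norm_ofReal_mul_exp hr.le t
    rw [h3, norm_zero] at h4
    exact hr.ne h4
  have hdir : ∀ t, (f (r * Circle.exp t) - f 0) / ‖f (r * Circle.exp t) - f 0‖ =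
      Circle.exp (φ t) := fun t => by
    have h3 : ((‖f (r * Circle.exp t) - f 0‖ : ℝ) : ℂ) ≠ 0 :=
      Complex.ofReal_ne_zero.2 (norm_ne_zero_iff.2 (sub_ne_zero.2 (hne t)))
    rw [div_eq_iff h3, mul_comm (Circle.exp (φ t) : ℂ)]
    exact hfφ t
  have hquasi : ∀ t, φ (t + 2 * Real.pi) = φ t + 2 * Real.pi := by
    refine congrFun (Circle.isCoveringMap_exp.eq_of_comp_eq (by fun_prop) (by fun_prop)
      (funext fun t => ?_) 0 (by rw [zero_add, h2π]))
    change Circle.exp (φ (t + 2 * Real.pi)) = Circle.exp (φ t + 2 * Real.pi)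
    rw [Circle.exp_add_two_pi]
    refine Subtype.ext ?_
    rw [← hdir, ← hdir, Circle.exp_add_two_pi]
  refine ⟨φ, hφ, hquasi, r, fun s t hs => ?_⟩
  have hs0 : 0 < s := hr.trans_le hs
  obtain ⟨⟨⟨h3, h4⟩, -⟩, h5⟩ := (h2 (s * Circle.exp t) (by rwa [norm_ofReal_mul_exp hs0.le])).1
  have h6 := (h2 (s * Circle.exp t) (by rwa [norm_ofReal_mul_exp hs0.le])).2
  obtain ⟨⟨-, -, h7⟩, h8⟩ := (h2 (r * Circle.exp t) (norm_ofReal_mul_exp hr.le t).ge).1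
  have h9 := (h2 (r * Circle.exp t) (norm_ofReal_mul_exp hr.le t).ge).2
  rw [norm_ofReal_mul_exp hs0.le, mul_div_cancel_left₀ _ (Complex.ofReal_ne_zero.2 hs0.ne')] at h6
  rw [norm_ofReal_mul_exp hr.le, mul_div_cancel_left₀ _ (Complex.ofReal_ne_zero.2 hr.ne')] at h9
  have h10 : dist (radialContraction (f (s * Circle.exp t)))
      (radialContraction (f (r * Circle.exp t))) < ε / 8 := by
    rw [hg, hg]
    refine hgδ ?_
    rw [Subtype.dist_eq]
    rw [← dist_eq_norm] at h6 h9
    linarith [dist_triangle_left (radialContraction (s * Circle.exp t) : ℂ)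
      (radialContraction (r * Circle.exp t)) (Circle.exp t)]
  rw [Subtype.dist_eq] at h10
  rw [hdir] at h7
  refine mem_cone_of_norm_lt h3 ?_
  rw [← dist_eq_norm] at h4 h5 h7 h8 ⊢
  generalize radialContraction (f (s * Circle.exp t)) = a at *
  generalize radialContraction (f (r * Circle.exp t)) = b at *
  generalize f (s * Circle.exp t) / ((‖f (s * Circle.exp t)‖ : ℝ) : ℂ) = v at *
  generalize f (r * Circle.exp t) / ((‖f (r * Circle.exp t)‖ : ℝ) : ℂ) = w at *
  generalize (f (s * Circle.exp t) - p) / ((‖f (s * Circle.exp t) - p‖ : ℝ) : ℂ) = u at *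
  rw [dist_comm] at h7
  linarith [dist_triangle4 u v a b, dist_triangle u b (Circle.exp (φ t)),
    dist_triangle_left (b : ℂ) (Circle.exp (φ t)) w]

end

/-! ### Homeomorphisms of the plane act trivially on phases of invertible states -/

section

open Filter

theorem uniformContinuous_of_periodic {g : ℝ → ℝ} (hg : Function.Periodic g (2 * Real.pi))
    (hc : Continuous g) : UniformContinuous g := by
  have : Fact (0 < 2 * Real.pi) := ⟨Real.two_pi_pos⟩
  have h1 : Continuous (hg.lift : AddCircle (2 * Real.pi) → ℝ) := continuous_coinduced_dom.2 hc
  have h2 : UniformContinuous (QuotientAddGroup.mk' (AddSubgroup.zmultiples (2 * Real.pi))) :=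
    uniformContinuous_addMonoidHom_of_continuous (AddCircle.continuous_mk' _)
  exact (CompactSpace.uniformContinuous_of_continuous h1).comp h2

/-- The direction of `f` at infinity is homotopic to the identity, because it has degree one. The
homotopy is divided into steps so small that neighbouring maps squeeze the same narrow cones. -/
theorem exists_chain {f : ℂ ≃ₜ ℂ} (hf : IsGood f) (ho : IsOrientationPreserving f) (p : ℂ) {ε : ℝ}
    (hε : 0 < ε) :
    ∃ (n : ℕ) (g : ℕ → ℂ → ℂ), g 0 = id ∧ g n = f ∧
      (∀ k, Tendsto (g k) (cocompact ℂ) (cocompact ℂ)) ∧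
      ∀ k < n, Squeezes p ε (g k) (g k) ∧ Squeezes p ε (g (k + 1)) (g k) := by
  have hε4 : 0 < ε / 4 := by linarith
  obtain ⟨φ, hφ, hper, hdir⟩ := exists_hasDirection hf ho p hε4
  have hper' : Function.Periodic (fun t => φ t - t) (2 * Real.pi) := fun t => by
    linarith [hper t]
  have hc : Continuous fun t => φ t - t := hφ.sub continuous_id
  have hpi : 2 * Real.pi ≠ 0 := Real.two_pi_pos.ne'
  obtain ⟨B, hB⟩ := (hper'.isBounded_of_continuous hpi hc).exists_norm_le
  have hB' : ∀ t, |φ t - t| ≤ B := fun t => hB _ ⟨t, rfl⟩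
  have huc : UniformContinuous fun t => φ t - t := uniformContinuous_of_periodic hper' hc
  obtain ⟨n, hn⟩ := exists_nat_gt (B / (ε / 4))
  have hB0 : 0 ≤ B := (abs_nonneg _).trans (hB' 0)
  have hn0 : 0 < (n : ℝ) := (div_nonneg hB0 hε4.le).trans_lt hn
  rw [div_lt_iff₀ hε4] at hn
  let χ : ℕ → ℝ → ℝ := fun k t => t + k / n * (φ t - t)
  have hχ : ∀ k t, χ k (t + 2 * Real.pi) = χ k t + 2 * Real.pi := fun k t => by
    simp only [χ]
    rw [hper]
    ring
  have hχu : ∀ k, UniformContinuous (χ k) := fun k =>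
    uniformContinuous_id.add (huc.const_mul' _)
  let g : ℕ → ℂ → ℂ := fun k => if k = n then f else turn (χ k)
  have hg : ∀ k, HasDirection p (ε / 4) (g k) (χ k) := fun k => by
    by_cases hk : k = n
    · have : χ n = φ := funext fun t => by simp [χ, div_self hn0.ne']
      simp only [g, hk, if_true, this]
      exact hdir
    · simp only [g, hk, if_false]
      exact hasDirection_turn p hε4 (hχ k)
  refine ⟨n, g, ?_, if_pos rfl, fun k => ?_, fun k _ => ⟨?_, ?_⟩⟩
  · have h0 : 0 ≠ n := by
      rintro rfl
      simp at hn0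
    have : χ 0 = fun t => t := funext fun t => by simp [χ]
    simp only [g, h0, if_false, this, turn_id]
  · by_cases hk : k = n
    · simp only [g, hk, if_true]
      exact f.isClosedEmbedding.tendsto_cocompact
    · simp only [g, hk, if_false]
      exact tendsto_turn _
  · exact (hg k).squeezes hε (hg k) (hχu k) fun t => by
      rw [sub_self, abs_zero]
      exact hε4.le
  · refine (hg (k + 1)).squeezes hε (hg k) (hχu (k + 1)) fun t => ?_
    have : χ k t - χ (k + 1) t = -((φ t - t) / n) := by
      simp only [χ]
      push_cast
      ring
    rw [this, abs_neg, abs_div, abs_of_pos hn0, div_le_iff₀ hn0]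
    linarith [hB' t]

end

end SpinPhases

end

theorem mainTheorem6 (f : ℂ ≃ₜ ℂ) (hgood : SpinPhases.IsGood f)
    (horient : SpinPhases.IsOrientationPreserving f)
    (S : SpinPhases.SpinSystem) (ψ : S.Functional) (hψ : SpinPhases.SpinSystem.IsInvertible ψ) :
    SpinPhases.SpinSystem.SamePhase ψ (SpinPhases.SpinSystem.pushState f ψ) :=
  SpinPhases.samePhase_pushState_of_chain hψ f fun p _ hε =>
    SpinPhases.exists_chain hgood horient p hε
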